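/- Let $e_1\ge e_2\ge\dots\ge e_d\ge 0$ be integers with $f:=e_1+\dots+e_d\ge 2$, let $\mathcal E=\mathcal O_{\mathbf P^1}(e_1)\oplus\dots\oplus\mathcal O_{\mathbf P^1}(e_d)$ over $\mathbb C$, let $\pi:X:=\mathbf P(\mathcal E)\to\mathbf P^1$ be the associated projective bundle, and put $H:=\mathcal O_X(1)$, $R:=\pi^*\mathcal O_{\mathbf P^1}(1)$. For a subspace $W\subseteq \mathrm H^0(X,H)$ let $\mathrm K_{p,q}(X,H;W)$ be the middle cohomology of the Koszul complex $$\textstyle\bigwedge^{p+1}W\otimes \mathrm H^0(X,H^{q-1})\to\bigwedge^{p}W\otimes \mathrm H^0(X,H^{q})\to\bigwedge^{p-1}W\otimes \mathrm H^0(X,H^{q+1}),$$ and $\mathrm K_{p,q}(X,H):=\mathrm K_{p,q}(X,H;\mathrm H^0(X,H))$. The rank of $0\ne\alpha\in \mathrm K_{p,1}(X,H)$ is the least dimension of a subspace $W\subseteq \mathrm H^0(X,H)$ such that $\alpha$ lies in the image of $\mathrm K_{p,1}(X,H;W)$. For a vector space $V$, $\mathbf P(V)$ denotes the projective space of lines in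 $V$. For every $s\ne 0$ in $\mathrm H^0(X,R)$, the natural map $$\textstyle\delta_s:\ \bigwedge^{f}\mathrm H^0(X,H-R)\otimes \mathrm H^0(X,R)/\langle s\rangle\to \mathrm K_{f-1,1}(X,H),\qquad w_1\wedge\dots\wedge w_f\otimes t\mapsto\Big[\sum_i(-1)^{i-1}\,sw_1\wedge\dots\widehat{sw_i}\dots\wedge sw_f\otimes t\,w_i\Big],$$ has one-dimensional image, and this image equals the image of $\mathrm K_{f-1,1}(X,H;\mathrm H^0(X,H\otimes I_{Z(s)}))$ in $\mathrm K_{f-1,1}(X,H)$, where $\mathrm H^0(X,H\otimes I_{Z(s)})=s\cdot \mathrm H^0(X,H-R)$. The map $$\phi:\mathbf P(\mathrm H^0(X,R))\to\mathbf P(\mathrm K_{f-1,1}(X,H)),\qquad \phi([s]):=\mathrm{Im}(\delta_s),$$ is a morphism with $\phi^*\mathcal O(1)\cong\mathcal O(f-2)$, and pullback along $\phi$ (for any choice of such an isomorphism) is an isomorphism $$\phi^*:\ \mathrm H^0\big(\mathcal O_{\mathbf P(\mathrm K_{f-1,1}(X,H))}(1)\big)\ \xrightarrow{\ \sim\ }\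 \mathrm H^0\big(\mathcal O_{\mathbf P(\mathrm H^0(X,R))}(f-2)\big).$$ Moreover, $\mathrm K_{f-1,1}(X,H)$ is spanned by the syzygies $\alpha$ of rank $f$ that lie in the image of $\mathrm K_{f-1,1}(X,H;\mathrm H^0(X,H\otimes I_{Z(s)}))$ for some $s\ne 0$ in $\mathrm H^0(X,R)$. -/

import Mathlib

open scoped TensorProduct LinearAlgebra.Projectivization

noncomputable section

/-! ## Koszul cohomology -/

namespace Koszul

variable {R : Type} [CommRing R] {V V' N₀ N₁ N₂ N₀' N₁' N₂' : Type}
  [AddCommGroup V] [Module R V] [AddCommGroup V'] [Module R V']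
  [AddCommGroup N₀] [Module R N₀] [AddCommGroup N₁] [Module R N₁]
  [AddCommGroup N₂] [Module R N₂] [AddCommGroup N₀'] [Module R N₀']
  [AddCommGroup N₁'] [Module R N₁'] [AddCommGroup N₂'] [Module R N₂']

/-- The usual structure, stated so that instance search sees its additive monoid. -/
instance {p : ℕ} : AddCommGroup ((⋀[R]^p V) ⊗[R] N₀) :=
  { TensorProduct.addCommGroup with toAddCommMonoid := TensorProduct.addCommMonoid }

/-- The Koszul differential `⋀^{p+1} V ⊗ N₀ → ⋀^p V ⊗ N₁` attached to a multiplication map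
`μ : V × N₀ → N₁`; see `Koszul.d_ιMulti_tmul` for the formula. -/
def d (μ : V →ₗ[R] N₀ →ₗ[R] N₁) (p : ℕ) :
    (⋀[R]^(p + 1) V) ⊗[R] N₀ →ₗ[R] (⋀[R]^p V) ⊗[R] N₁ :=
  TensorProduct.lift <|
    exteriorPower.alternatingMapLinearEquiv (N := N₀ →ₗ[R] (⋀[R]^p V) ⊗[R] N₁) <|
      AlternatingMap.alternatizeUncurryFin
        { toFun := fun v => ((TensorProduct.mk R (⋀[R]^p V) N₁).compl₂ (μ v)).compAlternatingMap
            (exteriorPower.ιMulti R p)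
          map_add' := fun v w => by ext; simp [TensorProduct.tmul_add]
          map_smul' := fun c v => by ext; simp }

/-- `d (v₀ ∧ ⋯ ∧ v_p ⊗ n) = ∑ᵢ (-1)ⁱ (v₀ ∧ ⋯ omit vᵢ ⋯ ∧ v_p) ⊗ vᵢ n`. -/
lemma d_ιMulti_tmul (μ : V →ₗ[R] N₀ →ₗ[R] N₁) (p : ℕ) (v : Fin (p + 1) → V) (n : N₀) :
    d μ p (exteriorPower.ιMulti R (p + 1) v ⊗ₜ n) =
      ∑ i : Fin (p + 1), (-1 : ℤ) ^ (i : ℕ) •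
        (exteriorPower.ιMulti R p (i.removeNth v) ⊗ₜ[R] μ (v i) n) := by
  simp [d, AlternatingMap.alternatizeUncurryFin_apply, LinearMap.sum_apply]

/-- The Koszul differential is natural. -/
lemma d_natural {μ : V →ₗ[R] N₀ →ₗ[R] N₁} {μ' : V' →ₗ[R] N₀' →ₗ[R] N₁'}
    (g : V →ₗ[R] V') (h₀ : N₀ →ₗ[R] N₀') (h₁ : N₁ →ₗ[R] N₁')
    (h : ∀ v n, μ' (g v) (h₀ n) = h₁ (μ v n)) (p : ℕ) :
    d μ' p ∘ₗ TensorProduct.map (exteriorPower.map (p + 1) g) h₀ =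
      TensorProduct.map (exteriorPower.map p g) h₁ ∘ₗ d μ p := by
  apply TensorProduct.ext
  refine exteriorPower.linearMap_ext (N := N₀ →ₗ[R] (⋀[R]^p V') ⊗[R] N₁') ?_
  ext v n
  change d μ' p (TensorProduct.map (exteriorPower.map (p + 1) g) h₀
      (exteriorPower.ιMulti R (p + 1) v ⊗ₜ n)) =
    TensorProduct.map (exteriorPower.map p g) h₁ (d μ p (exteriorPower.ιMulti R (p + 1) v ⊗ₜ n))
  simp only [TensorProduct.map_tmul, exteriorPower.map_apply_ιMulti, d_ιMulti_tmul,
    map_sum, map_zsmul, Function.comp_apply, h]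
  rfl

/-- `d ∘ d = 0`. -/
lemma d_comp_d (μ₀ : V →ₗ[R] N₀ →ₗ[R] N₁) (μ₁ : V →ₗ[R] N₁ →ₗ[R] N₂)
    (h : ∀ v w n, μ₁ v (μ₀ w n) = μ₁ w (μ₀ v n)) (p : ℕ) :
    d μ₁ p ∘ₗ d μ₀ (p + 1) = 0 := by
  apply TensorProduct.ext
  refine exteriorPower.linearMap_ext (N := N₀ →ₗ[R] (⋀[R]^p V) ⊗[R] N₂) ?_
  ext v n
  have key := DFunLike.congr_fun
    (AlternatingMap.alternatizeUncurryFin_alternatizeUncurryFinLM_comp_of_symmetric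
      (f := LinearMap.mk₂ R (fun x y => ((TensorProduct.mk R (⋀[R]^p V) N₂).flip
          (μ₁ y (μ₀ x n))).compAlternatingMap (exteriorPower.ιMulti R p))
        (fun _ _ _ => by ext; simp)
        (fun _ _ _ => by ext; simp)
        (fun _ _ _ => by ext; simp)
        (fun _ _ _ => by ext; simp))
      (fun x y => by ext; simp [h x y n])) v
  simp only [AlternatingMap.alternatizeUncurryFin_apply, LinearMap.comp_apply,
    AlternatingMap.alternatizeUncurryFinLM_apply, LinearMap.mk₂_apply,
    LinearMap.compAlternatingMap_apply, LinearMap.flip_apply, TensorProduct.mk_apply,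
    AlternatingMap.zero_apply] at key
  change d μ₁ p (d μ₀ (p + 1) (exteriorPower.ιMulti R (p + 2) v ⊗ₜ n)) = 0
  simp only [d_ιMulti_tmul, map_sum, map_zsmul]
  simpa using key

/-- The differential `⋀^p V ⊗ N₁ → ⋀^{p-1} V ⊗ N₂`, which is zero for `p = 0`. -/
def dOut (μ₁ : V →ₗ[R] N₁ →ₗ[R] N₂) :
    (p : ℕ) → ((⋀[R]^p V) ⊗[R] N₁ →ₗ[R] (⋀[R]^(p - 1) V) ⊗[R] N₂)
  | 0 => 0
  | p + 1 => d μ₁ p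

/-- The cycles in `⋀^p V ⊗ N₁`. -/
abbrev cycles (μ₁ : V →ₗ[R] N₁ →ₗ[R] N₂) (p : ℕ) : Submodule R ((⋀[R]^p V) ⊗[R] N₁) :=
  LinearMap.ker (dOut μ₁ p)

/-- The boundaries, as a subspace of the cycles. -/
abbrev boundaries (μ₀ : V →ₗ[R] N₀ →ₗ[R] N₁) (μ₁ : V →ₗ[R] N₁ →ₗ[R] N₂) (p : ℕ) :
    Submodule R (cycles μ₁ p) :=
  (LinearMap.range (d μ₀ p)).comap (cycles μ₁ p).subtype

/-- The middle cohomology of `⋀^{p+1} V ⊗ N₀ → ⋀^p V ⊗ N₁ → ⋀^{p-1} V ⊗ N₂`. -/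
def cohomology (μ₀ : V →ₗ[R] N₀ →ₗ[R] N₁) (μ₁ : V →ₗ[R] N₁ →ₗ[R] N₂) (p : ℕ) : Type :=
  cycles μ₁ p ⧸ boundaries μ₀ μ₁ p

instance (μ₀ : V →ₗ[R] N₀ →ₗ[R] N₁) (μ₁ : V →ₗ[R] N₁ →ₗ[R] N₂) (p : ℕ) :
    AddCommGroup (cohomology μ₀ μ₁ p) :=
  inferInstanceAs (AddCommGroup (cycles μ₁ p ⧸ boundaries μ₀ μ₁ p))

instance (μ₀ : V →ₗ[R] N₀ →ₗ[R] N₁) (μ₁ : V →ₗ[R] N₁ →ₗ[R] N₂) (p : ℕ) :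
    Module R (cohomology μ₀ μ₁ p) :=
  inferInstanceAs (Module R (cycles μ₁ p ⧸ boundaries μ₀ μ₁ p))

/-- The class of a cycle. -/
def toCohomology (μ₀ : V →ₗ[R] N₀ →ₗ[R] N₁) (μ₁ : V →ₗ[R] N₁ →ₗ[R] N₂) (p : ℕ) :
    cycles μ₁ p →ₗ[R] cohomology μ₀ μ₁ p :=
  (boundaries μ₀ μ₁ p).mkQ

lemma toCohomology_eq_zero (μ₀ : V →ₗ[R] N₀ →ₗ[R] N₁) (μ₁ : V →ₗ[R] N₁ →ₗ[R] N₂) (p : ℕ)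
    (x : cycles μ₁ p) :
    toCohomology μ₀ μ₁ p x = 0 ↔ (x : (⋀[R]^p V) ⊗[R] N₁) ∈ LinearMap.range (d μ₀ p) :=
  Submodule.Quotient.mk_eq_zero _

lemma dOut_natural {μ : V →ₗ[R] N₁ →ₗ[R] N₂} {μ' : V' →ₗ[R] N₁' →ₗ[R] N₂'}
    (g : V →ₗ[R] V') (h₁ : N₁ →ₗ[R] N₁') (h₂ : N₂ →ₗ[R] N₂')
    (h : ∀ v n, μ' (g v) (h₁ n) = h₂ (μ v n)) (p : ℕ) :
    dOut μ' p ∘ₗ TensorProduct.map (exteriorPower.map p g) h₁ =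
      TensorProduct.map (exteriorPower.map (p - 1) g) h₂ ∘ₗ dOut μ p := by
  cases p with
  | zero => simp [dOut]
  | succ p => exact d_natural g h₁ h₂ h p

/-- The map on Koszul cohomology induced by `⋀^p g ⊗ id` for a linear map `g : V → V'`
compatible with the multiplications. -/
def cohomologyMap {μ₀ : V →ₗ[R] N₀ →ₗ[R] N₁} {μ₁ : V →ₗ[R] N₁ →ₗ[R] N₂}
    {μ₀' : V' →ₗ[R] N₀ →ₗ[R] N₁} {μ₁' : V' →ₗ[R] N₁ →ₗ[R] N₂} (g : V →ₗ[R] V')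
    (h₀ : ∀ v n, μ₀' (g v) n = μ₀ v n) (h₁ : ∀ v n, μ₁' (g v) n = μ₁ v n) (p : ℕ) :
    cohomology μ₀ μ₁ p →ₗ[R] cohomology μ₀' μ₁' p :=
  Submodule.mapQ (boundaries μ₀ μ₁ p) (boundaries μ₀' μ₁' p)
    ((TensorProduct.map (exteriorPower.map p g) (LinearMap.id : N₁ →ₗ[R] N₁)).restrict
      (p := cycles μ₁ p) (q := cycles μ₁' p) (by
        intro x hx
        have := LinearMap.congr_fun
          (dOut_natural (μ := μ₁) (μ' := μ₁') g LinearMap.id LinearMap.id h₁ p) x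
        simp only [LinearMap.comp_apply] at this
        rw [LinearMap.mem_ker] at hx ⊢
        rw [this, hx, map_zero]))
    (by
      rintro ⟨x, hx⟩ ⟨y, hy⟩
      refine ⟨TensorProduct.map (exteriorPower.map (p + 1) g) LinearMap.id y, ?_⟩
      have := LinearMap.congr_fun
        (d_natural (μ := μ₀) (μ' := μ₀') g LinearMap.id LinearMap.id h₀ p) y
      simp only [LinearMap.comp_apply] at this
      rw [this, hy]
      rfl)

end Koszul

/-! ## Regular functions and sections of `𝒪(n)` on a projective space -/

/-- Polynomial functions on a vector space `A`: the algebra generated by the linear forms. -/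
def polyFunctions (A : Type) [AddCommGroup A] [Module ℂ A] : Subalgebra ℂ (A → ℂ) :=
  Algebra.adjoin ℂ (Set.range fun l : Module.Dual ℂ A => (l : A → ℂ))

/-- Regular functions on a (Zariski open) subset `U` of a complex vector space: functions that are
locally quotients `P / Q` of polynomial functions. -/
def regularFunctions {A : Type} [AddCommGroup A] [Module ℂ A] (U : Set A) :
    Subalgebra ℂ (U → ℂ) where
  carrier := {F | ∀ x : U, ∃ P ∈ polyFunctions A, ∃ Q ∈ polyFunctions A,
    Q x ≠ 0 ∧ ∀ y : U, Q y ≠ 0 → F y = P y / Q y}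
  mul_mem' := by
    intro F G hF hG x
    obtain ⟨P, hP, Q, hQ, hx, h⟩ := hF x
    obtain ⟨P', hP', Q', hQ', hx', h'⟩ := hG x
    refine ⟨P * P', mul_mem hP hP', Q * Q', mul_mem hQ hQ', mul_ne_zero hx hx', fun y hy => ?_⟩
    simp only [Pi.mul_apply] at hy ⊢
    rw [h y (left_ne_zero_of_mul hy), h' y (right_ne_zero_of_mul hy), div_mul_div_comm]
  add_mem' := by
    intro F G hF hG x
    obtain ⟨P, hP, Q, hQ, hx, h⟩ := hF x
    obtain ⟨P', hP', Q', hQ', hx', h'⟩ := hG x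
    refine ⟨P * Q' + Q * P', add_mem (mul_mem hP hQ') (mul_mem hQ hP'), Q * Q', mul_mem hQ hQ',
      mul_ne_zero hx hx', fun y hy => ?_⟩
    simp only [Pi.mul_apply, Pi.add_apply] at hy ⊢
    rw [h y (left_ne_zero_of_mul hy), h' y (right_ne_zero_of_mul hy),
      div_add_div _ _ (left_ne_zero_of_mul hy) (right_ne_zero_of_mul hy)]
  algebraMap_mem' := by
    intro c x
    exact ⟨algebraMap ℂ _ c, algebraMap_mem _ c, 1, one_mem _, one_ne_zero, fun y _ => by simp⟩

namespace ProjSpace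

variable (A : Type) [AddCommGroup A] [Module ℂ A]

/-- The punctured affine cone over the projective space `ℙ ℂ A` of lines in `A`. -/
def cone : Set A := {v | v ≠ 0}

variable {A} in
/-- Scaling on the punctured cone. -/
def scale (c : ℂˣ) (v : cone A) : cone A := ⟨c • (v : A), (smul_ne_zero_iff_ne c).2 v.2⟩

/-- `H⁰(𝒪(n))` on the projective space `ℙ ℂ A` of lines in `A`: regular functions on the punctured
cone that are homogeneous of degree `n`. -/
def sections (n : ℤ) : Submodule ℂ (cone A → ℂ) where
  carrier := {F | F ∈ regularFunctions (cone A) ∧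
    ∀ (c : ℂˣ) (v : cone A), F (scale c v) = (c : ℂ) ^ n * F v}
  zero_mem' := ⟨zero_mem _, by simp⟩
  add_mem' := fun hF hG => ⟨add_mem hF.1 hG.1, fun c v => by
    simp only [Pi.add_apply, hF.2 c v, hG.2 c v]; ring⟩
  smul_mem' := fun a F hF => ⟨Subalgebra.smul_mem _ hF.1 a, fun c v => by
    simp only [Pi.smul_apply, smul_eq_mul, hF.2 c v]; ring⟩

/-- A homogeneous lift of degree `n` of a map `φ : ℙ A → ℙ B`: a nowhere vanishing regular map `Φ`
of punctured cones, homogeneous of degree `n`, which induces `φ`. Such a lift exhibits `φ` as a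
morphism of varieties and is the same thing as an isomorphism `φ^* 𝒪(1) ≅ 𝒪(n)`; under this
isomorphism the pullback of a section `F` of `𝒪(1)` is `F ∘ Φ`. -/
structure IsHomogeneousLift {A B : Type} [AddCommGroup A] [Module ℂ A] [AddCommGroup B]
    [Module ℂ B] (φ : ℙ ℂ A → ℙ ℂ B) (n : ℤ) (Φ : cone A → cone B) : Prop where
  regular : ∀ l : Module.Dual ℂ B, (fun v => l (Φ v : B)) ∈ regularFunctions (cone A)
  homogeneous : ∀ (c : ℂˣ) (v : cone A), (Φ (scale c v) : B) = (c : ℂ) ^ n • (Φ v : B)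
  lifts : ∀ v : cone A, Projectivization.mk ℂ (Φ v : B) (Φ v).2 = φ (Projectivization.mk ℂ v v.2)

end ProjSpace

/-! ## The scroll `X = ℙ(ℰ)`, `ℰ = 𝒪(e₁) ⊕ ⋯ ⊕ 𝒪(e_d)` on `ℙ¹` -/

namespace Scroll

/-- The open set `(ℂ² \ 0) × (ℂᵈ \ 0)` of homogeneous coordinates `(x, z)` on `X`. Here `x` are
homogeneous coordinates on `ℙ¹`, and `z = (z₁, …, z_d)` are the coordinates of a one-dimensional
quotient `ℰ_x → ℂ` of the fibre of `ℰ` in the standard frames of the `𝒪(eᵢ)` given by `x`. -/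
def coords (d : ℕ) : Set ((Fin 2 → ℂ) × (Fin d → ℂ)) := {y | y.1 ≠ 0 ∧ y.2 ≠ 0}

variable {d : ℕ} (e : Fin d → ℕ)

/-- The torus action `(c, m) · (x, z) = (c x, (m c^{-eᵢ} zᵢ)ᵢ)`. -/
def act (c m : ℂˣ) (y : coords d) : coords d :=
  ⟨(fun k => (c : ℂ) * y.1.1 k, fun i => (m : ℂ) * (c : ℂ) ^ (-(e i : ℤ)) * y.1.2 i), by
    obtain ⟨⟨x, z⟩, hx, hz⟩ := y
    constructor
    · intro h
      exact hx (funext fun k => by simpa using congrFun h k)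
    · intro h
      exact hz (funext fun i => by simpa using congrFun h i)⟩

/-- The orbit relation of the torus action. -/
def orbitSetoid : Setoid (coords d) where
  r y y' := ∃ c m : ℂˣ, act e c m y = y'
  iseqv :=
    { refl := fun y => ⟨1, 1, by ext <;> simp [act]⟩
      symm := by
        rintro y _ ⟨c, m, rfl⟩
        refine ⟨c⁻¹, m⁻¹, ?_⟩
        ext i
        · simp [act]
        · have := zpow_ne_zero (e i : ℤ) c.ne_zero
          simp [act]
          field_simp
      trans := by
        rintro y _ _ ⟨c, m, rfl⟩ ⟨c', m', rfl⟩
        refine ⟨c' * c, m' * m, ?_⟩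
        ext i
        · simp [act, mul_assoc]
        · simp only [act, Units.val_mul, mul_zpow]
          ring }

/-- The variety `X = ℙ(ℰ)`, as the geometric quotient of `(ℂ² \ 0) × (ℂᵈ \ 0)` by the torus. -/
def Point : Type := Quotient (orbitSetoid e)

/-- `H⁰(X, aH + bR)`, where `H = 𝒪_X(1)` and `R = π^* 𝒪_{ℙ¹}(1)`. The line bundle `aH + bR` on
the quotient `X` is the one attached to the character `(c, m) ↦ m ^ a * c ^ b` of the torus, and
its sections are the regular functions on the space of homogeneous coordinates that transform
with this character. -/
def sections (a b : ℤ) : Submodule ℂ (coords d → ℂ) where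
  carrier := {F | F ∈ regularFunctions (coords d) ∧
    ∀ (c m : ℂˣ) (y : coords d), F (act e c m y) = (m : ℂ) ^ a * (c : ℂ) ^ b * F y}
  zero_mem' := ⟨zero_mem _, by simp⟩
  add_mem' := fun hF hG => ⟨add_mem hF.1 hG.1, fun c m y => by
    simp only [Pi.add_apply, hF.2 c m y, hG.2 c m y]; ring⟩
  smul_mem' := fun t F hF => ⟨Subalgebra.smul_mem _ hF.1 t, fun c m y => by
    simp only [Pi.smul_apply, smul_eq_mul, hF.2 c m y]; ring⟩

/-- `H⁰(X, qH)`. -/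
abbrev H0H (q : ℤ) : Type := sections e q 0

/-- `H⁰(X, R)`. -/
abbrev H0R : Type := sections e 0 1

/-- `H⁰(X, H - R)`. -/
abbrev H0HsubR : Type := sections e 1 (-1)

variable {e} in
/-- Multiplication of sections. -/
def mul {a b a' b' a'' b'' : ℤ} (ha : a + a' = a'') (hb : b + b' = b'') :
    sections e a b →ₗ[ℂ] sections e a' b' →ₗ[ℂ] sections e a'' b'' :=
  LinearMap.mk₂ ℂ
    (fun F G => ⟨F.1 * G.1, mul_mem F.2.1 G.2.1, fun c m y => by
      subst ha hb
      simp only [Pi.mul_apply, F.2.2 c m y, G.2.2 c m y, zpow_add₀ c.ne_zero,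
        zpow_add₀ m.ne_zero]
      ring⟩)
    (fun F F' G => Subtype.ext (add_mul F.1 F'.1 G.1))
    (fun t F G => Subtype.ext (smul_mul_assoc t F.1 G.1))
    (fun F G G' => Subtype.ext (mul_add F.1 G.1 G'.1))
    (fun t F G => Subtype.ext (mul_smul_comm t F.1 G.1))

/-- The constant section `1` of `𝒪_X = (1 - 1) H`. -/
def one : H0H e (1 - 1) := ⟨1, one_mem _, by simp⟩

variable {e} in
/-- Multiplication `V × H⁰(X, qH) → H⁰(X, (q+1)H)` (where `q + 1 = q'`), for a vector space `V`
mapping to `H⁰(X, H)`. -/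
abbrev mulH {V : Type} [AddCommGroup V] [Module ℂ V] (j : V →ₗ[ℂ] H0H e 1) (q q' : ℤ)
    (h : 1 + q = q') : V →ₗ[ℂ] H0H e q →ₗ[ℂ] H0H e q' :=
  mul (a := 1) (b := 0) h (add_zero 0) ∘ₗ j

/-- `K_{p,q}(X, H; V)` for a vector space `V` mapping to `H⁰(X, H)`: the middle cohomology of
`⋀^{p+1} V ⊗ H⁰((q-1)H) → ⋀^p V ⊗ H⁰(qH) → ⋀^{p-1} V ⊗ H⁰((q+1)H)`. -/
abbrev KV {V : Type} [AddCommGroup V] [Module ℂ V] (j : V →ₗ[ℂ] H0H e 1) (p : ℕ) (q : ℤ) : Type :=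
  Koszul.cohomology (mulH j (q - 1) q (add_sub_cancel 1 q)) (mulH j q (q + 1) (add_comm 1 q)) p

/-- `K_{p,q}(X, H; W)` for a subspace `W ⊆ H⁰(X, H)`. -/
abbrev KW (W : Submodule ℂ (H0H e 1)) (p : ℕ) (q : ℤ) : Type := KV e (V := W) W.subtype p q

/-- `K_{p,q}(X, H)`. -/
abbrev K (p : ℕ) (q : ℤ) : Type := KV e (LinearMap.id : H0H e 1 →ₗ[ℂ] H0H e 1) p q

/-- The natural map `K_{p,q}(X, H; W) → K_{p,q}(X, H)`. -/
def KWtoK (W : Submodule ℂ (H0H e 1)) (p : ℕ) (q : ℤ) : KW e W p q →ₗ[ℂ] K e p q :=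
  Koszul.cohomologyMap (V := W) W.subtype (fun _ _ => rfl) (fun _ _ => rfl) p

variable {e}

/-- The rank of a syzygy `α ∈ K_{p,1}(X, H)`: the least dimension of a subspace `W ⊆ H⁰(X, H)`
such that `α` comes from `K_{p,1}(X, H; W)`. -/
def rank {p : ℕ} (α : K e p 1) : ℕ :=
  sInf {n | ∃ W : Submodule ℂ (H0H e 1),
    Module.finrank ℂ W = n ∧ α ∈ LinearMap.range (KWtoK e W p 1)}

/-- Multiplication `H⁰(X, H - R) → H⁰(X, H)` by a section `s` of `R`. -/
def mulBy (s : H0R e) : H0HsubR e →ₗ[ℂ] H0H e 1 :=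
  (mul (e := e) (a'' := 1) (b'' := 0) (add_zero 1) (neg_add_cancel 1)).flip s

/-- `H⁰(X, H ⊗ I_{Z(s)}) ⊆ H⁰(X, H)`, the image of `H⁰(X, H - R)` under multiplication by `s`. -/
def sectionsVanishingOn (s : H0R e) : Submodule ℂ (H0H e 1) := LinearMap.range (mulBy s)

/-- The composite `⋀^{p+1} H⁰(H-R) ⊗ H⁰(R) → ⋀^p H⁰(H-R) ⊗ H⁰(H) → ⋀^p H⁰(H) ⊗ H⁰(H)` of the
Koszul differential and the map induced by multiplication by `s`. -/
def preDelta (s : H0R e) (p : ℕ) :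
    (⋀[ℂ]^(p + 1) (H0HsubR e)) ⊗[ℂ] (H0R e) →ₗ[ℂ] (⋀[ℂ]^p (H0H e 1)) ⊗[ℂ] (H0H e 1) :=
  TensorProduct.map (exteriorPower.map p (mulBy s)) LinearMap.id ∘ₗ
    Koszul.d (mul (e := e) (a := 1) (b := -1) (a' := 0) (b' := 1) (a'' := 1) (b'' := 0)
      (add_zero 1) (neg_add_cancel 1)) p

lemma preDelta_mem_ker (s : H0R e) (p : ℕ)
    (x : (⋀[ℂ]^(p + 1) (H0HsubR e)) ⊗[ℂ] (H0R e)) :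
    preDelta s p x ∈ Koszul.cycles
      (mulH (LinearMap.id : H0H e 1 →ₗ[ℂ] H0H e 1) 1 (1 + 1) (add_comm 1 1)) p := by
  rw [LinearMap.mem_ker]
  cases p with
  | zero => rfl
  | succ p =>
    have h1 := Koszul.d_natural
      (μ := mul (e := e) (a' := 1) (b' := 0) (a'' := 1 + 1) (b'' := 0) rfl (add_zero 0) ∘ₗ mulBy s)
      (μ' := mulH (LinearMap.id : H0H e 1 →ₗ[ℂ] H0H e 1) 1 (1 + 1) (add_comm 1 1))
      (mulBy s) LinearMap.id LinearMap.id (fun _ _ => rfl) p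
    have h2 := Koszul.d_comp_d
      (mul (e := e) (a := 1) (b := -1) (a' := 0) (b' := 1) (a'' := 1) (b'' := 0)
        (add_zero 1) (neg_add_cancel 1))
      (mul (e := e) (a' := 1) (b' := 0) (a'' := 1 + 1) (b'' := 0) rfl (add_zero 0) ∘ₗ mulBy s)
      (fun v w n => Subtype.ext (by
        change v.1 * s.1 * (w.1 * n.1) = w.1 * s.1 * (v.1 * n.1)
        ring)) p
    have h3 := LinearMap.congr_fun h1
      (Koszul.d (mul (e := e) (a := 1) (b := -1) (a' := 0) (b' := 1) (a'' := 1) (b'' := 0)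
        (add_zero 1) (neg_add_cancel 1)) (p + 1) x)
    have h4 := LinearMap.congr_fun h2 x
    simp only [LinearMap.comp_apply] at h3 h4
    rw [h4, LinearMap.zero_apply, map_zero] at h3
    exact h3

lemma preDelta_tmul_self (s : H0R e) (p : ℕ) (x : ⋀[ℂ]^(p + 1) (H0HsubR e)) :
    preDelta s p (x ⊗ₜ s) ∈ LinearMap.range (Koszul.d
      (mulH (LinearMap.id : H0H e 1 →ₗ[ℂ] H0H e 1) (1 - 1) 1 (add_sub_cancel 1 1)) p) := by
  refine ⟨exteriorPower.map (p + 1) (mulBy s) x ⊗ₜ one e, ?_⟩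
  let μ := mul (e := e) (a := 1) (b := -1) (a' := 0) (b' := 1) (a'' := 1) (b'' := 0)
    (add_zero 1) (neg_add_cancel 1)
  have h1 := Koszul.d_natural
    (μ := μ.compl₂ (LinearMap.toSpanSingleton ℂ (H0R e) s)) (μ' := μ)
    LinearMap.id (LinearMap.toSpanSingleton ℂ (H0R e) s) LinearMap.id (fun _ _ => rfl) p
  have h2 := Koszul.d_natural
    (μ := μ.compl₂ (LinearMap.toSpanSingleton ℂ (H0R e) s))
    (μ' := mulH (LinearMap.id : H0H e 1 →ₗ[ℂ] H0H e 1) (1 - 1) 1 (add_sub_cancel 1 1))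
    (mulBy s) (LinearMap.toSpanSingleton ℂ (H0H e (1 - 1)) (one e)) LinearMap.id
    (fun v n => Subtype.ext (by
      change (v.1 * s.1) * (n • 1) = v.1 * (n • s.1)
      simp)) p
  have h3 := LinearMap.congr_fun h1 (x ⊗ₜ 1)
  have h4 := LinearMap.congr_fun h2 (x ⊗ₜ 1)
  simp only [LinearMap.comp_apply, TensorProduct.map_tmul, exteriorPower.map_id,
    TensorProduct.map_id, LinearMap.id_apply, LinearMap.toSpanSingleton_apply, one_smul] at h3 h4
  simp only [preDelta, LinearMap.comp_apply]
  rw [h4, ← h3]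

/-- The natural map `⋀^{p+1} H⁰(H-R) ⊗ H⁰(R)/⟨s⟩ → K_{p,1}(X, H)` attached to a section `s` of
`R`; on `w₀ ∧ ⋯ ∧ w_p ⊗ t` it is the class of
`∑ᵢ (-1)ⁱ (s w₀ ∧ ⋯ omit s wᵢ ⋯ ∧ s w_p) ⊗ t wᵢ`. -/
def delta (s : H0R e) (p : ℕ) :
    (⋀[ℂ]^(p + 1) (H0HsubR e)) ⊗[ℂ] (H0R e ⧸ Submodule.span ℂ {s}) →ₗ[ℂ] K e p 1 :=
  TensorProduct.lift <| LinearMap.flip <|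
    Submodule.liftQ (M₂ := (⋀[ℂ]^(p + 1) (H0HsubR e)) →ₗ[ℂ] K e p 1) (Submodule.span ℂ {s})
      (TensorProduct.curry (Koszul.toCohomology _ _ p ∘ₗ
        (preDelta s p).codRestrict _ (preDelta_mem_ker s p))).flip
      (by
        rw [Submodule.span_singleton_le_iff_mem, LinearMap.mem_ker]
        refine LinearMap.ext fun x => ?_
        exact (Koszul.toCohomology_eq_zero _ _ p _).2 (preDelta_tmul_self s p x))

lemma delta_tmul (s : H0R e) (p : ℕ) (x : ⋀[ℂ]^(p + 1) (H0HsubR e)) (t : H0R e) :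
    delta s p (x ⊗ₜ Submodule.Quotient.mk t) =
      Koszul.toCohomology _ _ p ⟨preDelta s p (x ⊗ₜ t), preDelta_mem_ker s p _⟩ := rfl

end Scroll

end

/-! Write `V` for the sections of `H`, and `p = f - 1`. Evaluating the second factor of a cycle `γ ∈
⋀^p V ⊗ V` at a point turns the Koszul differential into contraction by the evaluation functional.
Over a point of `ℙ¹`, let `ξᵢ` be the functional taking the coefficient of `zᵢ`. The elements `γᵢ =
evT p ξᵢ γ` satisfy `ξᵢ⌟γⱼ + ξⱼ⌟γᵢ = 0`, and since the `ξᵢ` are independent there is `β ∈ ⋀^f V`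
with `ξᵢ⌟β = γᵢ` for all `i`. Two solutions differ by an element of `⋀^f` of the common kernel of
the `ξᵢ`. That kernel is `sₐ H⁰(H - R)`, of dimension `f`, so the ambiguity is a multiple of the one
generator `topWedge`. The cycle is a boundary exactly when the local solutions can be chosen
constant. In bundle terms this is `K_{f-1,1} ≅ H¹(ℙ¹, 𝒪(-f))`.

The obstruction is made explicit by two functionals on `⋀^f V`, taking the values `a₀^f` and `a₁^f`
on the generator at `a`. At the point `(1 : t)` the combination `lowForm - t^f highForm` kills the
ambiguity, so its value on a solution is a polynomial in `t` depending only on `γ`, of degree at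
most `f` by comparison of the two charts. Constant solutions, that is boundaries, contribute only
the exponents `0` and `f`. The remaining `f - 1` coefficients are coordinates on `K_{f-1,1}`: they
kill boundaries (`innerCoeffs_of_boundary`), and a cycle on which they vanish is a boundary because
normalised local solutions glue (`boundary_of_innerCoeffs`).

For a cycle coming from `δ_s` with `s = sₐ` and `τ ∈ H⁰(R)`, the local solution is `(τ/s) · topWedge
a`. Its residue is a geometric sum, whose inner coefficients are `-τ(a)` times the vector of
monomials of degree `f - 2` in `a` (`innerCoeffs_deltaCycle`). Thus `φ` is a rational normal curve:
its points span by Vandermonde, and pullback of linear forms gives all binary forms of degree `f -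
2`.

For `W = s H⁰(H - R)`, duality `⋀^p ≅ ⋀^f ⊗ dual` turns a cycle into a map `H⁰(H - R) → H⁰(H)`,
which the cycle condition forces to be multiplication by a section of `R`; so nothing beyond the
image of `δ_s` arises (`exists_evT_eq_of_cycle`). A space `W` of dimension less than `f` carries no
nonzero cycle: `u ∧ θ = 0` for degree reasons, and contracting by evaluation gives `u(y) θ = 0`.
This fixes the rank. -/

noncomputable section

/-! ### Regular functions on lines and planes: polynomials and binary forms -/

open Polynomial in
/-- A function on the affine line which is regular everywhere is a polynomial. -/
lemma exists_polynomial_of_locally_fraction (h : ℂ → ℂ)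
    (hreg : ∀ x, ∃ p q : ℂ[X], q.eval x ≠ 0 ∧ ∀ y, q.eval y ≠ 0 → h y = p.eval y / q.eval y) :
    ∃ P : ℂ[X], ∀ t, h t = P.eval t := by
  -- Induction on the degree of the denominator: the relation `q h = p` forces every root of `q` to
  -- be a root of `p`, so a common linear factor can be cancelled.
  have key : ∀ n : ℕ, ∀ p q : ℂ[X], q ≠ 0 → q.natDegree = n →
      (∀ y, q.eval y * h y = p.eval y) → ∃ P : ℂ[X], ∀ t, h t = P.eval t := by
    intro n
    induction n with
    | zero =>
      intro p q hq hn hpq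
      obtain ⟨c, rfl⟩ : ∃ c, q = C c := ⟨_, eq_C_of_natDegree_eq_zero hn⟩
      have hc : c ≠ 0 := by rintro rfl; simp at hq
      refine ⟨C c⁻¹ * p, fun t => ?_⟩
      rw [eval_mul, ← hpq t]
      simp [hc]
    | succ n ih =>
      intro p q hq hn hpq
      obtain ⟨r, hr⟩ : ∃ r, q.IsRoot r := by
        refine IsAlgClosed.exists_root q ?_
        rw [degree_eq_natDegree hq, hn]
        exact_mod_cast Nat.succ_ne_zero n
      have hr' : p.IsRoot r := by
        have := hpq r
        rw [hr.eq_zero, zero_mul] at this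
        exact this.symm
      obtain ⟨q1, rfl⟩ := dvd_iff_isRoot.2 hr
      obtain ⟨p1, rfl⟩ := dvd_iff_isRoot.2 hr'
      have hq1 : q1 ≠ 0 := right_ne_zero_of_mul hq
      have hoff : ∀ y, y ≠ r → q1.eval y * h y = p1.eval y := by
        intro y hy
        have := hpq y
        simp only [eval_mul, eval_sub, eval_X, eval_C] at this
        exact mul_left_cancel₀ (sub_ne_zero.2 hy) (by linear_combination this)
      refine ih p1 q1 hq1 ?_ fun y => ?_
      · rw [natDegree_mul (X_sub_C_ne_zero r) hq1, natDegree_X_sub_C] at hn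
        omega
      · rcases eq_or_ne y r with rfl | hy
        -- At the cancelled root the relation cannot be divided. Instead a fraction valid near this
        -- point is compared with the global one: they agree at infinitely many points, hence
        -- identically.
        · obtain ⟨p', q', hy', h'⟩ := hreg y
          have hid : q1 * p' = p1 * q' := by
            refine eq_of_infinite_eval_eq _ _ (Set.Infinite.mono (s := {y}ᶜ \ (q'.rootSet ℂ)) ?_ ?_)
            · intro z hz
              have hz' : q'.eval z ≠ 0 := by
                intro h0
                refine hz.2 ((mem_rootSet_of_ne ?_).2 (by simpa using h0))
                rintro rfl
                simp at hy'
              have h1 := hoff z hz.1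
              have h2 := h' z hz'
              simp only [Set.mem_ofPred_eq, eval_mul, ← h1, h2]
              field_simp
            · exact (Set.Infinite.sdiff (Set.Finite.infinite_compl (Set.finite_singleton y))
                (rootSet_finite q' ℂ))
          have := congrArg (eval y) hid
          simp only [eval_mul] at this
          rw [h' y hy', mul_div_assoc', this]
          field_simp
        · exact hoff y hy
  obtain ⟨p, q, h0, hpq⟩ := hreg 0
  have hq : q ≠ 0 := by rintro rfl; simp at h0
  -- The fraction at `0` says nothing where `q` vanishes; the extra factor `q` makes the relation
  -- hold there trivially.
  refine key _ (p * q) (q * q) (mul_ne_zero hq hq) rfl fun y => ?_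
  by_cases hy : q.eval y = 0
  · simp [hy]
  · rw [hpq y hy, eval_mul, eval_mul]
    field_simp

open Polynomial in
lemma polyFunctions_line {A : Type} [AddCommGroup A] [Module ℂ A] {P : A → ℂ}
    (hP : P ∈ polyFunctions A) (a b : A) : ∃ p : ℂ[X], ∀ t : ℂ, P (a + t • b) = p.eval t := by
  induction hP using Algebra.adjoin_induction with
  | mem P hP =>
    obtain ⟨l, rfl⟩ := hP
    exact ⟨C (l a) + C (l b) * X, fun t => by simp; ring⟩
  | algebraMap c => exact ⟨C c, fun t => by simp⟩
  | add P Q _ _ hP hQ =>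
    obtain ⟨p, hp⟩ := hP
    obtain ⟨q, hq⟩ := hQ
    exact ⟨p + q, fun t => by simp [hp, hq]⟩
  | mul P Q _ _ hP hQ =>
    obtain ⟨p, hp⟩ := hP
    obtain ⟨q, hq⟩ := hQ
    exact ⟨p * q, fun t => by simp [hp, hq]⟩

open Polynomial in
/-- The restriction of a regular function to an affine line is a polynomial. -/
lemma regularFunctions_line {A : Type} [AddCommGroup A] [Module ℂ A] {U : Set A} {F : U → ℂ}
    (hF : F ∈ regularFunctions U) (a b : A) (hU : ∀ t : ℂ, a + t • b ∈ U) :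
    ∃ p : ℂ[X], ∀ t : ℂ, F ⟨a + t • b, hU t⟩ = p.eval t := by
  refine exists_polynomial_of_locally_fraction _ fun x => ?_
  obtain ⟨P, hP, Q, hQ, hx, h⟩ := hF ⟨_, hU x⟩
  obtain ⟨p, hp⟩ := polyFunctions_line hP a b
  obtain ⟨q, hq⟩ := polyFunctions_line hQ a b
  refine ⟨p, q, by rw [← hq]; exact hx, fun y hy => ?_⟩
  rw [← hq] at hy
  rw [h ⟨_, hU y⟩ hy, hp, hq]

lemma regularFunctions_of_poly {A : Type} [AddCommGroup A] [Module ℂ A] (U : Set A) {P : A → ℂ}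
    (hP : P ∈ polyFunctions A) : (fun v : U => P v) ∈ regularFunctions U :=
  fun _ => ⟨P, hP, 1, one_mem _, one_ne_zero, fun y _ => by simp⟩

lemma linear_mem_polyFunctions {A : Type} [AddCommGroup A] [Module ℂ A] (l : Module.Dual ℂ A) :
    (l : A → ℂ) ∈ polyFunctions A :=
  Algebra.subset_adjoin ⟨l, rfl⟩

-- The hypothesis bounds the pole of `P` at infinity. Replacing `Q` by its reversed polynomial gives
-- `X ^ (deg Q + 1) * P = X ^ N * Q.reverse`, and the reversal has degree at most `deg Q`. The case
-- `N = 1` is Liouville's theorem for `ℙ¹`; larger `N` bounds the degrees of sections of line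
-- bundles.
open Polynomial in
lemma degree_lt_of_eval_inv {N : ℕ} (P Q : ℂ[X])
    (h : ∀ t : ℂ, t ≠ 0 → t * P.eval t = t ^ N * Q.eval t⁻¹) : P.degree < N := by
  have hid : X ^ (Q.natDegree + 1) * P = X ^ N * Q.reverse := by
    refine eq_of_infinite_eval_eq _ _
      (Set.Infinite.mono (s := {0}ᶜ) ?_ (Set.Finite.infinite_compl (Set.finite_singleton 0)))
    intro t ht
    have ht : t ≠ 0 := ht
    let _ : Invertible t⁻¹ := invertibleOfNonzero (inv_ne_zero ht)
    have := eval₂_reverse_mul_pow (RingHom.id ℂ) t⁻¹ Q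
    rw [invOf_eq_inv, inv_inv] at this
    simp only [eval₂_id] at this
    have h1 : Q.reverse.eval t = t ^ Q.natDegree * Q.eval t⁻¹ := by
      rw [← this, inv_pow]
      field_simp
    simp only [Set.mem_ofPred_eq, eval_mul, eval_pow, eval_X, h1]
    linear_combination t ^ Q.natDegree * h t ht
  rcases eq_or_ne P 0 with rfl | hP
  · simp
  have hd := congrArg natDegree hid
  have hQ : Q.reverse ≠ 0 := by
    intro h0
    rw [h0, mul_zero] at hid
    exact mul_ne_zero (pow_ne_zero _ X_ne_zero) hP hid
  rw [natDegree_mul (pow_ne_zero _ X_ne_zero) hP, natDegree_mul (pow_ne_zero _ X_ne_zero) hQ,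
    natDegree_X_pow, natDegree_X_pow] at hd
  have := reverse_natDegree_le Q
  rw [degree_eq_natDegree hP]
  exact_mod_cast (by omega : P.natDegree < N)

namespace ProjSpace

lemma vec_ne_zero_left (t : ℂ) : (![1, t] : Fin 2 → ℂ) ≠ 0 := fun h => by
  simpa using congrFun h 0

lemma vec_ne_zero_right (t : ℂ) : (![t, 1] : Fin 2 → ℂ) ≠ 0 := fun h => by
  simpa using congrFun h 1

open Polynomial in
/-- A homogeneous function on `ℂ² \ 0` of degree `N - 1` which is polynomial in the two standard
charts is a binary form. -/
lemma exists_form {N : ℕ} (h : cone (Fin 2 → ℂ) → ℂ)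
    (h0 : ∃ P : ℂ[X], ∀ t, h ⟨![1, t], vec_ne_zero_left t⟩ = P.eval t)
    (h1 : ∃ P : ℂ[X], ∀ t, h ⟨![t, 1], vec_ne_zero_right t⟩ = P.eval t)
    (hom : ∀ (c : ℂˣ) (v), h (scale c v) = (c : ℂ) ^ ((N : ℤ) - 1) * h v) :
    ∃ a : Fin N → ℂ, ∀ v : cone (Fin 2 → ℂ),
      h v = ∑ k, a k * (v.1 0 ^ (N - 1 - (k : ℕ)) * v.1 1 ^ (k : ℕ)) := by
  obtain ⟨P, hP⟩ := h0
  obtain ⟨Q, hQ⟩ := h1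
  -- Homogeneity of degree `N - 1` is the transition function between the charts; the extra factor
  -- `t` keeps the exponent natural when `N = 0`.
  have hPQ : ∀ t : ℂ, t ≠ 0 → t * P.eval t = t ^ N * Q.eval t⁻¹ := by
    intro t ht
    rw [← hP, ← hQ]
    have := hom (Units.mk0 t ht) ⟨![t⁻¹, 1], vec_ne_zero_right _⟩
    rw [show scale (Units.mk0 t ht) ⟨![t⁻¹, 1], vec_ne_zero_right _⟩ =
      ⟨![1, t], vec_ne_zero_left t⟩ from Subtype.ext (by
        simp [scale, Units.smul_def, ht])] at this
    rw [this, Units.val_mk0, zpow_sub₀ ht, zpow_one, zpow_natCast]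
    field_simp
  have hdeg := degree_lt_of_eval_inv P Q hPQ
  have hdeg' := degree_lt_of_eval_inv (N := N) Q P (by
    intro t ht
    have := hPQ t⁻¹ (inv_ne_zero ht)
    rw [inv_inv, inv_pow] at this
    have h2 : t ^ N ≠ 0 := pow_ne_zero _ ht
    calc t * Q.eval t = t * t ^ N * ((t ^ N)⁻¹ * Q.eval t) := by field_simp
      _ = t ^ N * P.eval t⁻¹ := by rw [← this]; field_simp)
  have hsum : ∀ t, P.eval t = ∑ k : Fin N, P.coeff k * t ^ (k : ℕ) := by
    intro t
    rcases eq_or_ne P 0 with rfl | hP0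
    · simp
    rw [eval_eq_sum_range' (n := N) (by
      rw [degree_eq_natDegree hP0] at hdeg; exact_mod_cast hdeg), Finset.sum_range]
  refine ⟨fun k => P.coeff k, ?_⟩
  have claim : ∀ x : cone (Fin 2 → ℂ), x.1 0 ≠ 0 →
      h x = ∑ k : Fin N, P.coeff k * (x.1 0 ^ (N - 1 - (k : ℕ)) * x.1 1 ^ (k : ℕ)) := by
    intro x hx
    have := hom (Units.mk0 _ hx) ⟨![1, x.1 1 / x.1 0], vec_ne_zero_left _⟩
    rw [show scale (Units.mk0 _ hx) ⟨![1, x.1 1 / x.1 0], vec_ne_zero_left _⟩ = x from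
      Subtype.ext (by
        ext i
        fin_cases i
        · simp [scale, Units.smul_def]
        · simp [scale, Units.smul_def]
          field_simp)] at this
    rw [this, hP, hsum, Finset.mul_sum]
    refine Finset.sum_congr rfl fun k _ => ?_
    have hk := k.2
    rw [Units.val_mk0, show (N : ℤ) - 1 = ((N - 1 - (k : ℕ) + k : ℕ) : ℤ) by omega, zpow_natCast,
      pow_add, div_pow]
    field_simp
  intro x
  by_cases hx : x.1 0 = 0
  · have hx1 : x.1 1 ≠ 0 := by
      intro h1
      apply x.2
      ext i
      fin_cases i
      · exact hx
      · exact h1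
    -- The point `(0 : 1)` is missed by the first chart, but the formula found there is a polynomial
    -- identity in the second chart for `t ≠ 0`, hence also at `t = 0`.
    have hpoly : ∀ t : ℂ, Q.eval t = ∑ k : Fin N, P.coeff k * t ^ (N - 1 - (k : ℕ)) := by
      have : Q = ∑ k : Fin N, C (P.coeff k) * X ^ (N - 1 - (k : ℕ)) := by
        refine eq_of_infinite_eval_eq _ _
          (Set.Infinite.mono (s := {0}ᶜ) ?_ (Set.Finite.infinite_compl (Set.finite_singleton 0)))
        intro t ht
        have := claim ⟨![t, 1], vec_ne_zero_right t⟩ ht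
        rw [hQ] at this
        simp [eval_finsetSum, this]
      intro t
      conv_lhs => rw [this]
      simp [eval_finsetSum]
    have := hom (Units.mk0 _ hx1) ⟨![0, 1], vec_ne_zero_right _⟩
    rw [show scale (Units.mk0 _ hx1) ⟨![0, 1], vec_ne_zero_right _⟩ = x from
      Subtype.ext (by
        ext i
        fin_cases i
        · simp [scale, Units.smul_def, hx]
        · simp [scale, Units.smul_def])] at this
    rw [this, hQ, hpoly, Finset.mul_sum, hx]
    refine Finset.sum_congr rfl fun k _ => ?_
    have hk := k.2
    by_cases hk' : N - 1 - (k : ℕ) = 0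
    · rw [hk', Units.val_mk0, show (N : ℤ) - 1 = (k : ℕ) by omega, zpow_natCast]
      ring
    · simp [hk']
  · exact claim x hx

/-- The restriction to a translate of a plane of a regular function which is homogeneous of degree
`N - 1` there is a binary form. -/
lemma exists_form_of_regular {A : Type} [AddCommGroup A] [Module ℂ A] {U : Set A} {F : U → ℂ}
    (hF : F ∈ regularFunctions U) {N : ℕ} (v w u : A)
    (hU : ∀ x : cone (Fin 2 → ℂ), u + (x.1 0 • v + x.1 1 • w) ∈ U)
    (hom : ∀ (c : ℂˣ) (x : cone (Fin 2 → ℂ)),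
      F ⟨_, hU (scale c x)⟩ = (c : ℂ) ^ ((N : ℤ) - 1) * F ⟨_, hU x⟩) :
    ∃ a : Fin N → ℂ, ∀ x : cone (Fin 2 → ℂ),
      F ⟨_, hU x⟩ = ∑ k, a k * (x.1 0 ^ (N - 1 - (k : ℕ)) * x.1 1 ^ (k : ℕ)) := by
  refine exists_form (fun x => F ⟨_, hU x⟩) ?_ ?_ hom
  · have e : ∀ t : ℂ, u + ((![1, t] : Fin 2 → ℂ) 0 • v + (![1, t] : Fin 2 → ℂ) 1 • w)
        = (u + v) + t • w := fun t => by simp [add_assoc]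
    have hU' : ∀ t : ℂ, (u + v) + t • w ∈ U := fun t => by
      rw [← e]; exact hU ⟨_, vec_ne_zero_left t⟩
    obtain ⟨p, hp⟩ := regularFunctions_line hF (u + v) w hU'
    exact ⟨p, fun t => by rw [← hp]; exact congrArg F (Subtype.ext (e t))⟩
  · have e : ∀ t : ℂ, u + ((![t, 1] : Fin 2 → ℂ) 0 • v + (![t, 1] : Fin 2 → ℂ) 1 • w)
        = (u + w) + t • v := fun t => by simp; abel
    have hU' : ∀ t : ℂ, (u + w) + t • v ∈ U := fun t => by
      rw [← e]; exact hU ⟨_, vec_ne_zero_right t⟩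
    obtain ⟨p, hp⟩ := regularFunctions_line hF (u + w) v hU'
    exact ⟨p, fun t => by rw [← hp]; exact congrArg F (Subtype.ext (e t))⟩

lemma comb_ne_zero {A : Type} [AddCommGroup A] [Module ℂ A] {v w : A}
    (hvw : LinearIndependent ℂ ![v, w]) (x : cone (Fin 2 → ℂ)) : x.1 0 • v + x.1 1 • w ≠ 0 := by
  intro h
  obtain ⟨h0, h1⟩ := LinearIndependent.pair_iff.1 hvw _ _ h
  refine x.2 (funext fun i => ?_)
  fin_cases i
  · exact h0
  · exact h1

/-- A regular function on a translate of a punctured vector space, homogeneous of degree `1`, is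
linear. -/
lemma linear_of_regular {A B : Type} [AddCommGroup A] [Module ℂ A] [AddCommGroup B] [Module ℂ B]
    {U : Set A} {F : U → ℂ} (hF : F ∈ regularFunctions U) (u : A) (g : B →ₗ[ℂ] A)
    (hU : ∀ x : cone B, u + g x.1 ∈ U)
    (hom : ∀ (c : ℂˣ) (x : cone B), F ⟨_, hU (scale c x)⟩ = (c : ℂ) * F ⟨_, hU x⟩) :
    ∃ l : Module.Dual ℂ B, ∀ x : cone B, F ⟨_, hU x⟩ = l x.1 := by
  classical
  -- The value `0` at the origin is the only one compatible with homogeneity of degree `1`.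
  let l : B → ℂ := fun x => if hx : x = 0 then 0 else F ⟨_, hU ⟨x, hx⟩⟩
  have hl : ∀ x : cone B, l x.1 = F ⟨_, hU x⟩ := fun x => dif_neg x.2
  have hl0 : l 0 = 0 := dif_pos rfl
  have hsmul : ∀ (c : ℂ) (x : B), l (c • x) = c * l x := by
    intro c x
    by_cases hx : x = 0
    · simp [hx, hl0]
    by_cases hc : c = 0
    · simp [hc, hl0]
    have := hom (Units.mk0 c hc) ⟨x, hx⟩
    rw [← hl, ← hl] at this
    exact this
  have hadd : ∀ x y : B, l (x + y) = l x + l y := by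
    intro x y
    by_cases hxy : LinearIndependent ℂ ![x, y]
    · have hU' : ∀ r : cone (Fin 2 → ℂ), u + (r.1 0 • g x + r.1 1 • g y) ∈ U := fun r => by
        simpa using hU ⟨_, comb_ne_zero hxy r⟩
      have hval : ∀ r : cone (Fin 2 → ℂ), F ⟨_, hU' r⟩ = l (r.1 0 • x + r.1 1 • y) := fun r => by
        rw [hl ⟨_, comb_ne_zero hxy r⟩]
        exact congrArg F (Subtype.ext (by simp))
      -- On the plane spanned by independent vectors the function is a binary form of degree `N - 1
      -- = 1`, so it is additive there; dependent vectors are covered by homogeneity alone.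
      obtain ⟨a, ha⟩ := exists_form_of_regular hF (N := 2) (g x) (g y) u hU' (fun c r => by
        rw [hval, hval, show (scale c r).1 0 • x + (scale c r).1 1 • y =
          (c : ℂ) • (r.1 0 • x + r.1 1 • y) by
            simp [scale, Units.smul_def, smul_smul], hsmul]
        simp)
      have e1 := ha ⟨![1, 1], vec_ne_zero_left _⟩
      have e2 := ha ⟨![1, 0], vec_ne_zero_left _⟩
      have e3 := ha ⟨![0, 1], vec_ne_zero_right _⟩
      rw [hval] at e1 e2 e3
      simp only [Matrix.cons_val_zero, Matrix.cons_val_one, one_smul, zero_smul, add_zero,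
        zero_add, Fin.sum_univ_two] at e1 e2 e3
      rw [e1, e2, e3]
      simp
    · rw [LinearIndependent.pair_iff] at hxy
      push Not at hxy
      obtain ⟨s, t, hst, hne⟩ := hxy
      by_cases hs : s = 0
      · have ht : t ≠ 0 := hne hs
        have hy : y = 0 := by simpa [hs, ht] using hst
        simp [hy, hl0]
      · have hx : x = (-(s⁻¹ * t)) • y := by
          have : s⁻¹ • (s • x + t • y) = 0 := by rw [hst, smul_zero]
          rw [smul_add, smul_smul, smul_smul, inv_mul_cancel₀ hs, one_smul] at this
          rw [neg_smul]
          exact eq_neg_of_add_eq_zero_left this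
        rw [hx]
        have : (-(s⁻¹ * t)) • y + y = (-(s⁻¹ * t) + 1) • y := by rw [add_smul, one_smul]
        rw [this, hsmul, hsmul]
        ring
  exact ⟨{ toFun := l, map_add' := hadd, map_smul' := hsmul }, fun x => (hl x).symm⟩

/-- A regular function on a translate of a punctured vector space, homogeneous of degree `0`, is
constant. -/
lemma const_of_regular {A B : Type} [AddCommGroup A] [Module ℂ A] [AddCommGroup B] [Module ℂ B]
    {U : Set A} {F : U → ℂ} (hF : F ∈ regularFunctions U) (u : A) (g : B →ₗ[ℂ] A)
    (hU : ∀ x : cone B, u + g x.1 ∈ U)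
    (hom : ∀ (c : ℂˣ) (x : cone B), F ⟨_, hU (scale c x)⟩ = F ⟨_, hU x⟩) (x y : cone B) :
    F ⟨_, hU x⟩ = F ⟨_, hU y⟩ := by
  by_cases hxy : LinearIndependent ℂ ![x.1, y.1]
  · have hU' : ∀ r : cone (Fin 2 → ℂ), u + (r.1 0 • g x.1 + r.1 1 • g y.1) ∈ U := fun r => by
      simpa using hU ⟨_, comb_ne_zero hxy r⟩
    have hval : ∀ r : cone (Fin 2 → ℂ), F ⟨_, hU' r⟩ = F ⟨_, hU ⟨_, comb_ne_zero hxy r⟩⟩ :=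
      fun r => congrArg F (Subtype.ext (by simp))
    obtain ⟨a, ha⟩ := exists_form_of_regular hF (N := 1) (g x.1) (g y.1) u hU' (fun c r => by
      rw [hval, hval, ← hom c ⟨_, comb_ne_zero hxy r⟩]
      simp only [Nat.cast_one, sub_self, zpow_zero, one_mul]
      exact congrArg F (Subtype.ext (by simp [scale, Units.smul_def, smul_smul])))
    have e2 := ha ⟨![1, 0], vec_ne_zero_left _⟩
    have e3 := ha ⟨![0, 1], vec_ne_zero_right _⟩
    have f2 : F ⟨_, hU' ⟨![1, 0], vec_ne_zero_left _⟩⟩ = F ⟨_, hU x⟩ :=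
      congrArg F (Subtype.ext (by simp))
    have f3 : F ⟨_, hU' ⟨![0, 1], vec_ne_zero_right _⟩⟩ = F ⟨_, hU y⟩ :=
      congrArg F (Subtype.ext (by simp))
    rw [← f2, ← f3, e2, e3]
    simp
  · rw [LinearIndependent.pair_iff] at hxy
    push Not at hxy
    obtain ⟨s, t, hst, hne⟩ := hxy
    have hs : s ≠ 0 := by
      intro hs
      have ht : t ≠ 0 := hne hs
      exact y.2 (by simpa [hs, ht] using hst)
    have ht : t ≠ 0 := by
      intro ht
      exact x.2 (by simpa [hs, ht] using hst)
    have hx : x = scale (Units.mk0 (-(s⁻¹ * t)) (by simp [hs, ht])) y := by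
      refine Subtype.ext ?_
      have : s⁻¹ • (s • x.1 + t • y.1) = 0 := by rw [hst, smul_zero]
      rw [smul_add, smul_smul, smul_smul, inv_mul_cancel₀ hs, one_smul] at this
      simp only [scale, Units.smul_def, Units.val_mk0]
      rw [neg_smul]
      exact eq_neg_of_add_eq_zero_left this
    rw [hx, hom]

end ProjSpace

end

/-! ### Explicit sections on the scroll: monomial bases and multiplication -/

noncomputable section

/-- A polynomial function on `ℂ` with finitely many prescribed coefficients which vanishes at
infinitely many points is zero. -/
lemma coeff_eq_zero_of_sum_pow {N : ℕ} (c : Fin N → ℂ) (S : Set ℂ) (hS : S.Infinite)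
    (h : ∀ t ∈ S, ∑ k, c k * t ^ (k : ℕ) = 0) : c = 0 := by
  let P : Polynomial ℂ := ∑ k : Fin N, Polynomial.monomial k (c k)
  have hP : P = 0 := by
    refine Polynomial.eq_of_infinite_eval_eq _ _ (Set.Infinite.mono ?_ hS)
    intro t ht
    simpa [P, Polynomial.eval_finsetSum] using h t ht
  ext k
  have := congrArg (fun Q => Polynomial.coeff Q k) hP
  simpa [P, Polynomial.finsetSum_coeff, Polynomial.coeff_monomial, Fin.val_inj] using this

namespace Scroll

open ProjSpace

variable {d : ℕ} {e : Fin d → ℕ}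

/-- The point with homogeneous coordinates `(x, z)`. -/
def pt (x : cone (Fin 2 → ℂ)) (z : cone (Fin d → ℂ)) : coords d := ⟨(x.1, z.1), x.2, z.2⟩

/-- The `i`-th coordinate vector of `ℂᵈ`. -/
def unitVec (i : Fin d) : cone (Fin d → ℂ) := ⟨Pi.single i 1, by simp [cone]⟩

/-- Evaluation of sections at a point of the space of homogeneous coordinates. -/
def ev {a b : ℤ} (y : coords d) : sections e a b →ₗ[ℂ] ℂ :=
  LinearMap.proj y ∘ₗ (sections e a b).subtype

@[simp] lemma ev_apply {a b : ℤ} (y : coords d) (F : sections e a b) : ev y F = F.1 y := rfl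

/-- The torus elements `(1, m)` scale only `z`, so over a fixed `x` a section of `H + bR` is regular
and homogeneous of degree `1` on the punctured fibre. -/
lemma section_linear {b : ℤ} (F : sections e 1 b) (x : cone (Fin 2 → ℂ)) :
    ∃ l : Module.Dual ℂ (Fin d → ℂ), ∀ z, F.1 (pt x z) = l z.1 := by
  have hU : ∀ z : cone (Fin d → ℂ),
      ((x.1, 0) : (Fin 2 → ℂ) × (Fin d → ℂ)) + LinearMap.inr ℂ (Fin 2 → ℂ) (Fin d → ℂ) z.1 ∈
        coords d := fun z => by
    constructor
    · simpa using show x.1 ≠ 0 from x.2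
    · simpa using show z.1 ≠ 0 from z.2
  have hpt : ∀ z : cone (Fin d → ℂ), (⟨_, hU z⟩ : coords d) = pt x z := fun z =>
    Subtype.ext (by ext <;> simp [pt])
  obtain ⟨l, hl⟩ := linear_of_regular F.2.1 _ _ hU (fun c z => by
    rw [hpt, hpt]
    have := F.2.2 1 c (pt x z)
    rw [show act e 1 c (pt x z) = pt x (scale c z) from
      Subtype.ext (by ext <;> simp [act, pt, scale, Units.smul_def])] at this
    simpa using this)
  exact ⟨l, fun z => by rw [← hl, hpt]⟩

/-- The linear functional on `sections e a b` of evaluating at `x` the coefficient of `zᵢ`. -/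
abbrev coeffAt {a b : ℤ} (x : cone (Fin 2 → ℂ)) (i : Fin d) : sections e a b →ₗ[ℂ] ℂ :=
  ev (pt x (unitVec i))

lemma section_apply {b : ℤ} (F : sections e 1 b) (x : cone (Fin 2 → ℂ))
    (z : cone (Fin d → ℂ)) : F.1 (pt x z) = ∑ i, z.1 i * coeffAt x i F := by
  obtain ⟨l, hl⟩ := section_linear F x
  simp only [ev_apply, hl, unitVec]
  conv_lhs => rw [pi_eq_sum_univ z.1, map_sum]
  refine Finset.sum_congr rfl fun i _ => ?_
  rw [map_smul, smul_eq_mul]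
  congr 3
  ext j
  simp [Pi.single_apply, eq_comm]

lemma section_ext {b : ℤ} {F G : sections e 1 b} (h : ∀ x i, coeffAt x i F = coeffAt x i G) :
    F = G := by
  refine Subtype.ext (funext fun y => ?_)
  change F.1 (pt ⟨y.1.1, y.2.1⟩ ⟨y.1.2, y.2.2⟩) = G.1 (pt ⟨y.1.1, y.2.1⟩ ⟨y.1.2, y.2.2⟩)
  simp only [section_apply, h]

/-- The choice `m = c ^ eᵢ` cancels the twist of the `i`-th coordinate. Consequently the coefficient
of `zᵢ` in a section of `H + bR` is homogeneous of degree `eᵢ + b` in `x`. -/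
lemma act_unitVec (c : ℂˣ) (x : cone (Fin 2 → ℂ)) (i : Fin d) :
    act e c (c ^ e i) (pt x (unitVec i)) = pt (scale c x) (unitVec i) := by
  refine Subtype.ext (Prod.ext ?_ ?_)
  · ext k
    simp [act, pt, scale, Units.smul_def]
  · ext k
    rcases eq_or_ne k i with rfl | h
    · simp [act, pt, unitVec]
    · simp [act, pt, unitVec, h]

/-- Each coefficient is a binary form of degree `M i - 1 = eᵢ + b`. Counting monomials by `M i` also
covers degree `-1`, where there are none; this happens for `H - R` when `eᵢ = 0`. -/
lemma exists_coeff {b : ℤ} {M : Fin d → ℕ} (hM : ∀ i, (M i : ℤ) = e i + 1 + b)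
    (F : sections e 1 b) : ∃ c : (Σ i, Fin (M i)) → ℂ, ∀ x i,
      coeffAt x i F = ∑ k : Fin (M i), c ⟨i, k⟩ * (x.1 0 ^ (M i - 1 - (k : ℕ)) * x.1 1 ^ (k : ℕ)) := by
  have key : ∀ i, ∃ a : Fin (M i) → ℂ, ∀ x, coeffAt x i F =
      ∑ k : Fin (M i), a k * (x.1 0 ^ (M i - 1 - (k : ℕ)) * x.1 1 ^ (k : ℕ)) := by
    intro i
    have hval : ∀ x : cone (Fin 2 → ℂ),
        ((0, Pi.single i 1) : (Fin 2 → ℂ) × (Fin d → ℂ)) +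
          (x.1 0 • (Pi.single 0 1, 0) + x.1 1 • (Pi.single 1 1, 0)) = (pt x (unitVec i)).1 := by
      intro x
      refine Prod.ext ?_ ?_
      · ext k
        fin_cases k <;> simp [pt]
      · simp [pt, unitVec]
    have hU : ∀ x : cone (Fin 2 → ℂ),
        ((0, Pi.single i 1) : (Fin 2 → ℂ) × (Fin d → ℂ)) +
          (x.1 0 • (Pi.single 0 1, 0) + x.1 1 • (Pi.single 1 1, 0)) ∈ coords d := fun x => by
      rw [hval]; exact (pt x (unitVec i)).2
    have hpt : ∀ x, (⟨_, hU x⟩ : coords d) = pt x (unitVec i) := fun x => Subtype.ext (hval x)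
    obtain ⟨a, ha⟩ := exists_form_of_regular F.2.1 (N := M i) _ _ _ hU (fun c x => by
      rw [hpt, hpt, ← act_unitVec (e := e), F.2.2, hM,
        show (e i : ℤ) + 1 + b - 1 = e i + b by ring, zpow_add₀ c.ne_zero]
      simp)
    exact ⟨a, fun x => by rw [← ha, hpt]; rfl⟩
  choose a ha using key
  exact ⟨fun j => a j.1 j.2, fun x i => ha i x⟩

lemma fst_mem_poly (k : Fin 2) :
    (fun y : (Fin 2 → ℂ) × (Fin d → ℂ) => y.1 k) ∈ polyFunctions ((Fin 2 → ℂ) × (Fin d → ℂ)) :=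
  linear_mem_polyFunctions (LinearMap.proj k ∘ₗ LinearMap.fst ℂ (Fin 2 → ℂ) (Fin d → ℂ))

lemma snd_mem_poly (i : Fin d) :
    (fun y : (Fin 2 → ℂ) × (Fin d → ℂ) => y.2 i) ∈ polyFunctions ((Fin 2 → ℂ) × (Fin d → ℂ)) :=
  linear_mem_polyFunctions (LinearMap.proj i ∘ₗ LinearMap.snd ℂ (Fin 2 → ℂ) (Fin d → ℂ))

/-- The section `zᵢ x₀^(Mᵢ - 1 - k) x₁^k` of `H + bR`, where `Mᵢ = eᵢ + 1 + b`. -/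
def mono {b : ℤ} {M : Fin d → ℕ} (hM : ∀ i, (M i : ℤ) = e i + 1 + b) (j : Σ i, Fin (M i)) :
    sections e 1 b :=
  ⟨fun y => y.1.2 j.1 * (y.1.1 0 ^ (M j.1 - 1 - (j.2 : ℕ)) * y.1.1 1 ^ (j.2 : ℕ)),
    regularFunctions_of_poly (coords d) (mul_mem (snd_mem_poly j.1)
      (mul_mem (pow_mem (fst_mem_poly 0) (M j.1 - 1 - (j.2 : ℕ)))
        (pow_mem (fst_mem_poly 1) (j.2 : ℕ)))), fun c m y => by
      have hk := j.2.2
      have h1 : b = -(e j.1 : ℤ) + ((M j.1 - 1 - (j.2 : ℕ) : ℕ) + (j.2 : ℕ)) := by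
        have := hM j.1
        omega
      simp only [act, mul_pow]
      conv_rhs => rw [h1, zpow_add₀ c.ne_zero, zpow_add₀ c.ne_zero, zpow_natCast, zpow_natCast,
        zpow_one]
      ring⟩

lemma coeffAt_mono {b : ℤ} {M : Fin d → ℕ} (hM : ∀ i, (M i : ℤ) = e i + 1 + b)
    (x : cone (Fin 2 → ℂ)) (i : Fin d) (j : Σ i, Fin (M i)) :
    coeffAt x i (mono hM j) =
      if j.1 = i then x.1 0 ^ (M j.1 - 1 - (j.2 : ℕ)) * x.1 1 ^ (j.2 : ℕ) else 0 := by
  simp [mono, pt, unitVec, Pi.single_apply]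

/-- The monomial basis of `H⁰(X, H + bR)`. -/
def monoBasis {b : ℤ} {M : Fin d → ℕ} (hM : ∀ i, (M i : ℤ) = e i + 1 + b) :
    Module.Basis (Σ i, Fin (M i)) ℂ (sections e 1 b) :=
  Module.Basis.mk (v := mono hM)
    (by
      rw [Fintype.linearIndependent_iff]
      intro g hg
      have key : ∀ i, (fun k : Fin (M i) => g ⟨i, k⟩) = 0 := by
        intro i
        refine coeff_eq_zero_of_sum_pow _ Set.univ Set.infinite_univ fun t _ => ?_
        have := congrArg (coeffAt ⟨![1, t], vec_ne_zero_left t⟩ i) hg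
        rw [map_sum, Fintype.sum_sigma, Finset.sum_eq_single i] at this
        · simpa [-ev_apply, coeffAt_mono] using this
        · intro j _ hj
          simp [-ev_apply, coeffAt_mono, hj]
        · simp
      rintro ⟨i, k⟩
      exact congrFun (key i) k)
    (by
      rintro F -
      obtain ⟨c, hc⟩ := exists_coeff hM F
      have : F = ∑ j, c j • mono hM j := by
        refine section_ext fun x i => ?_
        rw [hc, map_sum, Fintype.sum_sigma, Finset.sum_eq_single i]
        · simp [-ev_apply, coeffAt_mono]
        · intro j _ hj
          simp [-ev_apply, coeffAt_mono, hj]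
        · simp
      rw [this]
      exact Submodule.sum_mem _ fun j _ => Submodule.smul_mem _ _ (Submodule.subset_span ⟨j, rfl⟩))

lemma monoBasis_apply {b : ℤ} {M : Fin d → ℕ} (hM : ∀ i, (M i : ℤ) = e i + 1 + b)
    (j : Σ i, Fin (M i)) : monoBasis hM j = mono hM j := by
  simp [monoBasis]

variable (e) in
/-- The monomial basis of `H⁰(X, H)`. -/
def vb : Module.Basis (Σ i, Fin (e i + 1)) ℂ (H0H e 1) :=
  monoBasis (M := fun i => e i + 1) (b := 0) (fun i => by simp)

variable (e) in
/-- The monomial basis of `H⁰(X, H - R)`. -/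
def wb : Module.Basis (Σ i, Fin (e i)) ℂ (H0HsubR e) :=
  monoBasis (M := e) (b := -1) (fun i => by simp)

lemma vb_apply (j : Σ i, Fin (e i + 1)) (y : coords d) :
    (vb e j).1 y = y.1.2 j.1 * (y.1.1 0 ^ (e j.1 - (j.2 : ℕ)) * y.1.1 1 ^ (j.2 : ℕ)) := by
  rw [vb, monoBasis_apply]
  rfl

lemma wb_apply (j : Σ i, Fin (e i)) (y : coords d) :
    (wb e j).1 y = y.1.2 j.1 * (y.1.1 0 ^ (e j.1 - 1 - (j.2 : ℕ)) * y.1.1 1 ^ (j.2 : ℕ)) := by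
  rw [wb, monoBasis_apply]
  rfl

lemma coeffAt_vb (x : cone (Fin 2 → ℂ)) (i : Fin d) (j : Σ i, Fin (e i + 1)) :
    coeffAt x i (vb e j) = if j.1 = i then x.1 0 ^ (e j.1 - (j.2 : ℕ)) * x.1 1 ^ (j.2 : ℕ) else 0 := by
  rw [vb, monoBasis_apply, coeffAt_mono]
  rfl

lemma coeffAt_wb (x : cone (Fin 2 → ℂ)) (i : Fin d) (j : Σ i, Fin (e i)) :
    coeffAt x i (wb e j) =
      if j.1 = i then x.1 0 ^ (e j.1 - 1 - (j.2 : ℕ)) * x.1 1 ^ (j.2 : ℕ) else 0 := by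
  rw [wb, monoBasis_apply, coeffAt_mono]

instance : Module.Finite ℂ (H0H e 1) := Module.Finite.of_basis (vb e)

instance : Module.Finite ℂ (H0HsubR e) := Module.Finite.of_basis (wb e)

/-- The section `t₀ x₀ + t₁ x₁` of `R`. -/
def lin : (Fin 2 → ℂ) →ₗ[ℂ] H0R e where
  toFun t := ⟨fun y => t 0 * y.1.1 0 + t 1 * y.1.1 1,
    regularFunctions_of_poly (coords d) (add_mem
      (Subalgebra.smul_mem _ (fst_mem_poly 0) (t 0)) (Subalgebra.smul_mem _ (fst_mem_poly 1) (t 1))),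
    fun c m y => by simp [act]; ring⟩
  map_add' t t' := Subtype.ext (funext fun y => by simp; ring)
  map_smul' c t := Subtype.ext (funext fun y => by simp; ring)

lemma lin_apply (t : Fin 2 → ℂ) (y : coords d) :
    (lin t : H0R e).1 y = t 0 * y.1.1 0 + t 1 * y.1.1 1 := rfl

/-- Sections of multiples of `R` have degree `0` along the fibres of `π`, and a regular function of
degree `0` on a punctured vector space is constant. -/
lemma section_zero_const {b : ℤ} (F : sections e 0 b) (x : cone (Fin 2 → ℂ))
    (z z' : cone (Fin d → ℂ)) : F.1 (pt x z) = F.1 (pt x z') := by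
  have hU : ∀ z : cone (Fin d → ℂ),
      ((x.1, 0) : (Fin 2 → ℂ) × (Fin d → ℂ)) + LinearMap.inr ℂ (Fin 2 → ℂ) (Fin d → ℂ) z.1 ∈
        coords d := fun z => by
    constructor
    · simpa using show x.1 ≠ 0 from x.2
    · simpa using show z.1 ≠ 0 from z.2
  have hpt : ∀ z : cone (Fin d → ℂ), (⟨_, hU z⟩ : coords d) = pt x z := fun z =>
    Subtype.ext (by ext <;> simp [pt])
  have := const_of_regular F.2.1 _ _ hU (fun c z => by
    rw [hpt, hpt]
    have := F.2.2 1 c (pt x z)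
    rw [show act e 1 c (pt x z) = pt x (scale c z) from
      Subtype.ext (by ext <;> simp [act, pt, scale, Units.smul_def])] at this
    simpa using this) z z'
  rwa [hpt, hpt] at this

lemma exists_coeff_zero [Nonempty (Fin d)] {b : ℤ} {N : ℕ} (hN : (N : ℤ) = 1 + b)
    (F : sections e 0 b) : ∃ c : Fin N → ℂ, ∀ x z,
      F.1 (pt x z) = ∑ k : Fin N, c k * (x.1 0 ^ (N - 1 - (k : ℕ)) * x.1 1 ^ (k : ℕ)) := by
  let i : Fin d := Classical.arbitrary _
  have hval : ∀ x : cone (Fin 2 → ℂ),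
      ((0, Pi.single i 1) : (Fin 2 → ℂ) × (Fin d → ℂ)) +
        (x.1 0 • (Pi.single 0 1, 0) + x.1 1 • (Pi.single 1 1, 0)) = (pt x (unitVec i)).1 := by
    intro x
    refine Prod.ext ?_ ?_
    · ext k
      fin_cases k <;> simp [pt]
    · simp [pt, unitVec]
  have hU : ∀ x : cone (Fin 2 → ℂ),
      ((0, Pi.single i 1) : (Fin 2 → ℂ) × (Fin d → ℂ)) +
        (x.1 0 • (Pi.single 0 1, 0) + x.1 1 • (Pi.single 1 1, 0)) ∈ coords d := fun x => by
    rw [hval]; exact (pt x (unitVec i)).2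
  have hpt : ∀ x, (⟨_, hU x⟩ : coords d) = pt x (unitVec i) := fun x => Subtype.ext (hval x)
  obtain ⟨a, ha⟩ := exists_form_of_regular F.2.1 (N := N) _ _ _ hU (fun c x => by
    rw [hpt, hpt, ← act_unitVec (e := e), F.2.2, hN, show (1 : ℤ) + b - 1 = b by ring]
    simp)
  exact ⟨a, fun x z => by rw [← ha, hpt, section_zero_const F x z (unitVec i)]⟩

lemma lin_surjective [Nonempty (Fin d)] : Function.Surjective (lin : (Fin 2 → ℂ) →ₗ[ℂ] H0R e) := by
  intro F
  obtain ⟨c, hc⟩ := exists_coeff_zero (N := 2) (by norm_num) F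
  refine ⟨c, Subtype.ext (funext fun y => ?_)⟩
  have := hc ⟨y.1.1, y.2.1⟩ ⟨y.1.2, y.2.2⟩
  simp [Fin.sum_univ_two] at this
  rw [lin_apply]
  exact this.symm

lemma lin_injective [Nonempty (Fin d)] : Function.Injective (lin : (Fin 2 → ℂ) →ₗ[ℂ] H0R e) := by
  rw [← LinearMap.ker_eq_bot, LinearMap.ker_eq_bot']
  intro t ht
  let i : Fin d := Classical.arbitrary _
  have h (x : cone (Fin 2 → ℂ)) : t 0 * x.1 0 + t 1 * x.1 1 = 0 :=
    congrFun (congrArg Subtype.val ht) (pt x (unitVec i))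
  ext k
  fin_cases k
  · simpa using h ⟨![1, 0], vec_ne_zero_left 0⟩
  · simpa using h ⟨![0, 1], vec_ne_zero_right 0⟩

lemma structure_const [Nonempty (Fin d)] (F : H0H e (1 - 1)) : ∃ c : ℂ, ∀ y, F.1 y = c := by
  have hF : F.1 ∈ sections e 0 0 := F.2
  obtain ⟨c, hc⟩ := exists_coeff_zero (N := 1) (by norm_num) (⟨F.1, hF⟩ : sections e 0 0)
  refine ⟨c 0, fun y => ?_⟩
  have := hc ⟨y.1.1, y.2.1⟩ ⟨y.1.2, y.2.2⟩
  simp only [Fin.sum_univ_one, Fin.val_zero, Nat.sub_self, pow_zero, mul_one] at this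
  exact this

lemma mulBy_apply (s : H0R e) (w : H0HsubR e) (y : coords d) :
    (mulBy s w).1 y = w.1 y * s.1 y := rfl

/-- Monomials are multiplied by adding exponents. -/
lemma mulBy_lin_wb (t : Fin 2 → ℂ) (j : Σ i, Fin (e i)) :
    mulBy (lin t) (wb e j) = t 0 • vb e ⟨j.1, j.2.castSucc⟩ + t 1 • vb e ⟨j.1, j.2.succ⟩ := by
  refine Subtype.ext (funext fun y => ?_)
  have hj := j.2.2
  change (mulBy (lin t) (wb e j)).1 y =
    t 0 * (vb e ⟨j.1, j.2.castSucc⟩).1 y + t 1 * (vb e ⟨j.1, j.2.succ⟩).1 y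
  rw [mulBy_apply, vb_apply, vb_apply, wb_apply, lin_apply]
  simp only [Fin.val_castSucc, Fin.val_succ]
  rw [show e j.1 - (j.2 : ℕ) = (e j.1 - 1 - j.2) + 1 by omega,
    show e j.1 - ((j.2 : ℕ) + 1) = e j.1 - 1 - j.2 by omega]
  ring

end Scroll

end

/-! ### Contractions in the exterior algebra and evaluation of Koszul cochains -/

noncomputable section

namespace ExteriorAlgebra

variable {V V' : Type} [AddCommGroup V] [Module ℂ V] [AddCommGroup V'] [Module ℂ V']

/-- Contraction of the exterior algebra by a linear form. -/
def ctr (ξ : Module.Dual ℂ V) : ExteriorAlgebra ℂ V →ₗ[ℂ] ExteriorAlgebra ℂ V :=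
  CliffordAlgebra.contractLeft (Q := (0 : QuadraticForm ℂ V)) ξ

lemma ctr_ι_mul (ξ : Module.Dual ℂ V) (v : V) (x : ExteriorAlgebra ℂ V) :
    ctr ξ (ι ℂ v * x) = ξ v • x - ι ℂ v * ctr ξ x :=
  CliffordAlgebra.contractLeft_ι_mul ξ v x

lemma ctr_algebraMap (ξ : Module.Dual ℂ V) (c : ℂ) :
    ctr ξ (algebraMap ℂ (ExteriorAlgebra ℂ V) c) = 0 :=
  CliffordAlgebra.contractLeft_algebraMap _ ξ c

lemma ctr_ctr (ξ : Module.Dual ℂ V) (x : ExteriorAlgebra ℂ V) : ctr ξ (ctr ξ x) = 0 :=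
  CliffordAlgebra.contractLeft_contractLeft ξ x

lemma ctr_comm (ξ η : Module.Dual ℂ V) (x : ExteriorAlgebra ℂ V) :
    ctr ξ (ctr η x) = -ctr η (ctr ξ x) :=
  CliffordAlgebra.contractLeft_comm ξ η x

lemma ctr_add (ξ η : Module.Dual ℂ V) (x : ExteriorAlgebra ℂ V) :
    ctr (ξ + η) x = ctr ξ x + ctr η x := by
  simp [ctr]

lemma ctr_smul (c : ℂ) (ξ : Module.Dual ℂ V) (x : ExteriorAlgebra ℂ V) :
    ctr (c • ξ) x = c • ctr ξ x := by
  simp [ctr]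

lemma ctr_sum {I : Type} (S : Finset I) (ξ : I → Module.Dual ℂ V) (x : ExteriorAlgebra ℂ V) :
    ctr (∑ i ∈ S, ξ i) x = ∑ i ∈ S, ctr (ξ i) x := by
  simp [ctr]

@[elab_as_elim]
lemma left_induct {C : ExteriorAlgebra ℂ V → Prop} (x : ExteriorAlgebra ℂ V)
    (algebraMap : ∀ c, C (algebraMap ℂ _ c)) (add : ∀ x y, C x → C y → C (x + y))
    (ι_mul : ∀ x v, C x → C (ι ℂ v * x)) : C x :=
  CliffordAlgebra.left_induction (0 : QuadraticForm ℂ V) algebraMap add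
    (fun x m h => ι_mul x m h) x

lemma ctr_map (g : V →ₗ[ℂ] V') (ξ : Module.Dual ℂ V') (x : ExteriorAlgebra ℂ V) :
    ctr ξ (map g x) = map g (ctr (ξ ∘ₗ g) x) := by
  induction x using left_induct with
  | algebraMap c => simp [ctr_algebraMap]
  | add x y hx hy => simp [hx, hy]
  | ι_mul x v hx => simp [ctr_ι_mul, hx]

lemma ι_mul_ι_mul_swap (u v : V) (x : ExteriorAlgebra ℂ V) :
    ι ℂ u * (ι ℂ v * x) = -(ι ℂ v * (ι ℂ u * x)) := by
  rw [← mul_assoc, ← mul_assoc, ← neg_mul]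
  congr 1
  exact eq_neg_of_add_eq_zero_left (ι_add_mul_swap u v)

lemma ι_mul_mem {n : ℕ} (v : V) {x : ExteriorAlgebra ℂ V} (hx : x ∈ ⋀[ℂ]^n V) :
    ι ℂ v * x ∈ ⋀[ℂ]^(n + 1) V := by
  change _ ∈ LinearMap.range (ι ℂ) ^ (n + 1)
  rw [pow_succ']
  exact Submodule.mul_mem_mul ⟨v, rfl⟩ hx

lemma power_induct {n : ℕ} {C : ExteriorAlgebra ℂ V → Prop} (ιMulti : ∀ v, C (ιMulti ℂ n v))
    (zero : C 0) (add : ∀ x y, C x → C y → C (x + y)) (smul : ∀ (c : ℂ) x, C x → C (c • x))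
    {x : ExteriorAlgebra ℂ V} (hx : x ∈ ⋀[ℂ]^n V) : C x := by
  rw [← ιMulti_span_fixedDegree] at hx
  induction hx using Submodule.span_induction with
  | mem x hx => obtain ⟨v, rfl⟩ := hx; exact ιMulti v
  | zero => exact zero
  | add x y _ _ hx hy => exact add x y hx hy
  | smul c x _ hx => exact smul c x hx

lemma ctr_ιMulti (ξ : Module.Dual ℂ V) {n : ℕ} (v : Fin (n + 1) → V) :
    ctr ξ (ιMulti ℂ (n + 1) v) =
      ∑ i : Fin (n + 1), ((-1 : ℤ) ^ (i : ℕ)) • ξ (v i) • ιMulti ℂ n (i.removeNth v) := by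
  induction n with
  | zero =>
    rw [ιMulti_succ_apply, ctr_ι_mul, ιMulti_zero_apply,
      show (1 : ExteriorAlgebra ℂ V) = algebraMap ℂ _ 1 by simp, ctr_algebraMap]
    simp
  | succ n ih =>
    rw [ιMulti_succ_apply, ctr_ι_mul, ih, Fin.sum_univ_succ (n := n + 1)]
    have h0 : Matrix.vecTail v = Fin.removeNth 0 v := by
      ext i; simp [Matrix.vecTail, Fin.removeNth]
    rw [h0, sub_eq_add_neg, Finset.mul_sum, ← Finset.sum_neg_distrib]
    congr 1
    · simp
    refine Finset.sum_congr rfl fun i _ => ?_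
    rw [ιMulti_succ_apply (i.succ.removeNth v)]
    have h1 : i.succ.removeNth v 0 = v 0 := by simp [Fin.removeNth]
    have h2 : Matrix.vecTail (i.succ.removeNth v) = i.removeNth (Fin.removeNth 0 v) := by
      ext j; simp [Matrix.vecTail, Fin.removeNth]
    rw [h1, h2, Fin.val_succ, pow_succ, mul_smul_comm, mul_smul_comm]
    simp [Fin.removeNth]

lemma ctr_mem {n : ℕ} (ξ : Module.Dual ℂ V) {x : ExteriorAlgebra ℂ V}
    (hx : x ∈ ⋀[ℂ]^(n + 1) V) : ctr ξ x ∈ ⋀[ℂ]^n V := by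
  refine power_induct (C := fun x => ctr ξ x ∈ ⋀[ℂ]^n V) ?_ ?_ ?_ ?_ hx
  · intro v
   
    rw [ctr_ιMulti]
    exact Submodule.sum_mem _ fun i _ => zsmul_mem (Submodule.smul_mem _ _
      (ιMulti_range ℂ n ⟨_, rfl⟩)) _
  · simp
  · intro x y hx hy
    rw [map_add]; exact add_mem hx hy
  · intro c x hx
    rw [map_smul]; exact Submodule.smul_mem _ _ hx

/-- A transvection-like projection acts on the exterior algebra by a contraction. -/
lemma map_sub_smulRight (ξ : Module.Dual ℂ V) (u : V) (x : ExteriorAlgebra ℂ V) :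
    map (LinearMap.id - ξ.smulRight u) x = x - ι ℂ u * ctr ξ x := by
  induction x using left_induct with
  | algebraMap c => simp [ctr_algebraMap]
  | add x y hx hy => simp only [map_add, hx, hy, mul_add]; abel
  | ι_mul x v hx =>
    have h0 : ι ℂ u * (ι ℂ u * ctr ξ x) = 0 := by rw [← mul_assoc, ι_sq_zero, zero_mul]
    rw [map_mul, map_apply_ι, hx, ctr_ι_mul]
    simp only [LinearMap.sub_apply, LinearMap.id_apply, LinearMap.smulRight_apply, map_sub,
      map_smul, sub_mul, mul_sub, smul_mul_assoc, mul_smul_comm, h0, smul_zero, sub_zero]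
    rw [ι_mul_ι_mul_swap u v]
    abel

/-- An element killed by all contractions `ξᵢ` is fixed by the projection to their common kernel. -/
lemma map_proj_eq_self {I : Type} [DecidableEq I] (ξ : I → Module.Dual ℂ V) (u : I → V)
    (hξ : ∀ i j, ξ i (u j) = if i = j then 1 else 0) (x : ExteriorAlgebra ℂ V)
    (hx : ∀ i, ctr (ξ i) x = 0) (S : Finset I) :
    map (LinearMap.id - ∑ i ∈ S, (ξ i).smulRight (u i)) x = x := by
  induction S using Finset.induction_on with
  | empty => simp
  | insert j S hj ih =>
    -- The projection is a composite of the rank one projections, since `ξ j` vanishes on the `u i`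
    -- already treated; each factor then acts by a contraction that kills `x`.
    have : LinearMap.id - ∑ i ∈ insert j S, (ξ i).smulRight (u i) =
        (LinearMap.id - (ξ j).smulRight (u j)) ∘ₗ
          (LinearMap.id - ∑ i ∈ S, (ξ i).smulRight (u i)) := by
      ext v
      have h0 : ξ j (∑ i ∈ S, ξ i v • u i) = 0 := by
        rw [map_sum]
        refine Finset.sum_eq_zero fun i hi => ?_
        rw [map_smul, hξ, if_neg (by rintro rfl; exact hj hi), smul_zero]
      simp only [LinearMap.sub_apply, LinearMap.id_apply, LinearMap.comp_apply,
        LinearMap.sum_apply, LinearMap.smulRight_apply, map_sub, h0,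
        Finset.sum_insert hj, LinearMap.add_apply]
      simp only [zero_smul]
      abel
    rw [this, ← map_comp_map, AlgHom.comp_apply, ih, map_sub_smulRight, hx, mul_zero, sub_zero]

/-- The functional on the exterior algebra given by the determinant in top degree. -/
def detFunctional {n : ℕ} (b : Module.Basis (Fin n) ℂ V) : ExteriorAlgebra ℂ V →ₗ[ℂ] ℂ :=
  liftAlternating (Pi.single n b.det)

lemma detFunctional_ιMulti {n : ℕ} (b : Module.Basis (Fin n) ℂ V) (v : Fin n → V) :
    detFunctional b (ιMulti ℂ n v) = b.det v := by
  rw [detFunctional, liftAlternating_apply_ιMulti, Pi.single_eq_same]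

/-- Both sides are alternating in `v`, so it suffices to compare them on permutations of the basis.
For `g = id` this says that the top exterior power is spanned by the wedge of the basis. -/
lemma ιMulti_comp_basis {n : ℕ} (b : Module.Basis (Fin n) ℂ V) (g : V →ₗ[ℂ] V')
    (v : Fin n → V) :
    ιMulti ℂ n (g ∘ v) = b.det v • ιMulti ℂ n (g ∘ b) := by
  have : (ιMulti ℂ n).compLinearMap g =
      (LinearMap.toSpanSingleton ℂ (ExteriorAlgebra ℂ V')
        (ιMulti ℂ n (g ∘ b))).compAlternatingMap b.det := by
    refine Module.Basis.ext_alternating b fun i hi => ?_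
    obtain ⟨σ, rfl⟩ : ∃ σ : Equiv.Perm (Fin n), i = σ :=
      ⟨Equiv.ofBijective i (Finite.injective_iff_bijective.1 hi), rfl⟩
    have h1 : (ιMulti ℂ n).compLinearMap g (fun j => b (σ j)) =
        Equiv.Perm.sign σ • (ιMulti ℂ n).compLinearMap g b :=
      AlternatingMap.map_perm _ b σ
    have h2 : b.det (fun j => b (σ j)) = Equiv.Perm.sign σ • b.det b :=
      AlternatingMap.map_perm _ b σ
    rw [h1, LinearMap.compAlternatingMap_apply, h2, Module.Basis.det_self]
    rcases Int.units_eq_one_or (Equiv.Perm.sign σ) with h | h <;>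
      simp [h, Units.smul_def] <;> rfl
  exact DFunLike.congr_fun this v

lemma eq_detFunctional_smul {n : ℕ} (b : Module.Basis (Fin n) ℂ V) {x : ExteriorAlgebra ℂ V}
    (hx : x ∈ ⋀[ℂ]^n V) : x = detFunctional b x • ιMulti ℂ n b := by
  refine power_induct (C := fun x => x = detFunctional b x • ιMulti ℂ n b) ?_ ?_ ?_ ?_ hx
  · intro v
    rw [detFunctional_ιMulti]; exact ιMulti_comp_basis b LinearMap.id v
  · simp
  · intro x y hx hy
    rw [map_add, add_smul, ← hx, ← hy]
  · intro c x hx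
    rw [map_smul, smul_assoc, ← hx]

lemma eq_zero_of_finrank_lt [Module.Finite ℂ V] {n : ℕ} (hn : Module.finrank ℂ V < n)
    {x : ExteriorAlgebra ℂ V} (hx : x ∈ ⋀[ℂ]^n V) : x = 0 := by
  refine power_induct (C := fun x => x = 0) ?_ ?_ ?_ ?_ hx
  · intro v
   
    refine AlternatingMap.map_linearDependent _ _ fun h => ?_
    have := h.fintype_card_le_finrank
    rw [Fintype.card_fin] at this
    omega
  · rfl
  · intro x y hx hy
    rw [hx, hy, add_zero]
  · intro c x hx
    rw [hx, smul_zero]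

end ExteriorAlgebra

open ExteriorAlgebra

/-! ### Polynomial families of vectors -/

/-- A family of vectors that depends polynomially on a parameter. -/
def IsPolyFamily {M : Type} [AddCommGroup M] [Module ℂ M] (F : ℂ → M) : Prop :=
  ∀ l : Module.Dual ℂ M, ∃ P : Polynomial ℂ, ∀ t, l (F t) = P.eval t

namespace IsPolyFamily

variable {M M' : Type} [AddCommGroup M] [Module ℂ M] [AddCommGroup M'] [Module ℂ M']

lemma const (m : M) : IsPolyFamily fun _ => m :=
  fun l => ⟨Polynomial.C (l m), fun t => by simp⟩

lemma add {F G : ℂ → M} (hF : IsPolyFamily F) (hG : IsPolyFamily G) :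
    IsPolyFamily fun t => F t + G t := fun l => by
  obtain ⟨P, hP⟩ := hF l
  obtain ⟨Q, hQ⟩ := hG l
  exact ⟨P + Q, fun t => by simp [hP, hQ]⟩

lemma linear {F : ℂ → M} (hF : IsPolyFamily F) (g : M →ₗ[ℂ] M') :
    IsPolyFamily fun t => g (F t) := fun l => hF (l ∘ₗ g)

lemma sub {F G : ℂ → M} (hF : IsPolyFamily F) (hG : IsPolyFamily G) :
    IsPolyFamily fun t => F t - G t := by
  simpa [sub_eq_add_neg] using hF.add (hG.linear (-LinearMap.id))

lemma sum {I : Type} (S : Finset I) {F : I → ℂ → M} (hF : ∀ i, IsPolyFamily (F i)) :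
    IsPolyFamily fun t => ∑ i ∈ S, F i t := by
  classical
  induction S using Finset.induction_on with
  | empty => simpa using const (0 : M)
  | insert j S hj ih => simpa [Finset.sum_insert hj] using (hF j).add ih

lemma smul {F : ℂ → M} (hF : IsPolyFamily F) (P : Polynomial ℂ) :
    IsPolyFamily fun t => P.eval t • F t := fun l => by
  obtain ⟨Q, hQ⟩ := hF l
  exact ⟨P * Q, fun t => by simp [hQ]⟩

lemma pow_smul {F : ℂ → M} (hF : IsPolyFamily F) (n : ℕ) :
    IsPolyFamily fun t => t ^ n • F t := by
  simpa using hF.smul (Polynomial.X ^ n)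

lemma ctr_of_basis {V I : Type} [AddCommGroup V] [Module ℂ V] [Fintype I]
    (b : Module.Basis I ℂ V) {ξ : ℂ → Module.Dual ℂ V}
    (hξ : ∀ i, ∃ P : Polynomial ℂ, ∀ t, ξ t (b i) = P.eval t) {F : ℂ → ExteriorAlgebra ℂ V}
    (hF : IsPolyFamily F) : IsPolyFamily fun t => ctr (ξ t) (F t) := by
  choose P hP using hξ
  have : ∀ t, ξ t = ∑ i, (P i).eval t • b.coord i := by
    intro t
    classical
    refine b.ext fun j => ?_
    simp [hP, Finsupp.single_apply]
  simp only [this, ctr_sum, ctr_smul]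
  exact sum _ fun i => (hF.linear (ctr (b.coord i))).smul _

end IsPolyFamily

/-- Solving the equations `ctr (ξᵢ) β = γᵢ` polynomially in a parameter, given constant vectors
`uⱼ` with `ξᵢ(uⱼ) = δᵢⱼ`. -/
lemma exists_ctr_eq {V I : Type} [AddCommGroup V] [Module ℂ V] [Fintype I] [DecidableEq I] {n : ℕ}
    (ξ : I → ℂ → Module.Dual ℂ V) (u : I → V)
    (hξ : ∀ t i j, ξ i t (u j) = if i = j then 1 else 0)
    (hpoly : ∀ i (F : ℂ → ExteriorAlgebra ℂ V), IsPolyFamily F →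
      IsPolyFamily fun t => ctr (ξ i t) (F t))
    (γ : I → ℂ → ExteriorAlgebra ℂ V) (hγ : ∀ i, IsPolyFamily (γ i))
    (hmem : ∀ i t, γ i t ∈ ⋀[ℂ]^n V)
    (hself : ∀ t i, ctr (ξ i t) (γ i t) = 0)
    (hcomm : ∀ t i j, i ≠ j → ctr (ξ i t) (γ j t) + ctr (ξ j t) (γ i t) = 0) :
    ∃ β : ℂ → ExteriorAlgebra ℂ V, IsPolyFamily β ∧ (∀ t, β t ∈ ⋀[ℂ]^(n + 1) V) ∧
      ∀ t i, ctr (ξ i t) (β t) = γ i t := by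
  have key : ∀ S : Finset I, ∃ β : ℂ → ExteriorAlgebra ℂ V, IsPolyFamily β ∧
      (∀ t, β t ∈ ⋀[ℂ]^(n + 1) V) ∧ ∀ t, ∀ i ∈ S, ctr (ξ i t) (β t) = γ i t := by
    intro S
    induction S using Finset.induction_on with
    | empty => exact ⟨fun _ => 0, .const 0, by simp, by simp⟩
    | insert j S hj ih =>
      obtain ⟨β, hβ, hβmem, h⟩ := ih
      -- The correction `uⱼ ∧ (γⱼ - ξⱼ⌟β)` repairs the `j`-th equation. Contracted by an earlier
      -- `ξᵢ` it becomes `-uⱼ ∧ (ξᵢ⌟γⱼ + ξⱼ⌟γᵢ) = 0`, so the earlier equations survive.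
      refine ⟨fun t => β t + ι ℂ (u j) * (γ j t - ctr (ξ j t) (β t)), ?_, ?_, ?_⟩
      · exact hβ.add (((hγ j).sub (hpoly j β hβ)).linear (LinearMap.mulLeft ℂ (ι ℂ (u j))))
      · exact fun t => add_mem (hβmem t)
          (ι_mul_mem _ (sub_mem (hmem j t) (ctr_mem _ (hβmem t))))
      · intro t i hi
        rw [map_add, ctr_ι_mul, hξ, map_sub]
        rcases Finset.mem_insert.1 hi with rfl | hi'
        · rw [hself, ctr_ctr]
          simp
        · have hij : i ≠ j := by rintro rfl; exact hj hi'
          rw [if_neg hij, h t i hi', ctr_comm (ξ i t) (ξ j t), h t i hi',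
            sub_neg_eq_add, hcomm t i j hij]
          simp
  obtain ⟨β, h1, h2, h3⟩ := key Finset.univ
  exact ⟨β, h1, h2, fun t i => h3 t i (Finset.mem_univ i)⟩

/-! ### Evaluating the second factor of a tensor -/

namespace Koszul

variable {V V' N N' : Type} [AddCommGroup V] [Module ℂ V] [AddCommGroup V'] [Module ℂ V']
  [AddCommGroup N] [Module ℂ N] [AddCommGroup N'] [Module ℂ N'] {n : ℕ}

/-- Apply a linear form to the second factor of `⋀ⁿ V ⊗ N`. -/
def evT (n : ℕ) (ξ : Module.Dual ℂ N) : (⋀[ℂ]^n V) ⊗[ℂ] N →ₗ[ℂ] ExteriorAlgebra ℂ V :=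
  TensorProduct.lift ((LinearMap.lsmul ℂ (ExteriorAlgebra ℂ V)).flip.compl₂ ξ ∘ₗ
    (⋀[ℂ]^n V).subtype)

@[simp] lemma evT_tmul (ξ : Module.Dual ℂ N) (x : ⋀[ℂ]^n V) (a : N) :
    evT n ξ (x ⊗ₜ a) = ξ a • (x : ExteriorAlgebra ℂ V) := rfl

lemma evT_mem (ξ : Module.Dual ℂ N) (x : (⋀[ℂ]^n V) ⊗[ℂ] N) : evT n ξ x ∈ ⋀[ℂ]^n V := by
  induction x using TensorProduct.induction_on with
  | zero => simp
  | tmul x a => exact Submodule.smul_mem _ _ x.2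
  | add x y hx hy => rw [map_add]; exact add_mem hx hy

lemma evT_add (ξ η : Module.Dual ℂ N) (x : (⋀[ℂ]^n V) ⊗[ℂ] N) :
    evT n (ξ + η) x = evT n ξ x + evT n η x := by
  induction x using TensorProduct.induction_on with
  | zero => simp
  | tmul x a => simp [add_smul]
  | add x y hx hy => rw [map_add, map_add, map_add, hx, hy]; abel

lemma evT_smul (c : ℂ) (ξ : Module.Dual ℂ N) (x : (⋀[ℂ]^n V) ⊗[ℂ] N) :
    evT n (c • ξ) x = c • evT n ξ x := by
  induction x using TensorProduct.induction_on with
  | zero => simp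
  | tmul x a => simp [mul_smul]
  | add x y hx hy => rw [map_add, map_add, smul_add, hx, hy]

lemma evT_sum {I : Type} (S : Finset I) (ξ : I → Module.Dual ℂ N) (x : (⋀[ℂ]^n V) ⊗[ℂ] N) :
    evT n (∑ i ∈ S, ξ i) x = ∑ i ∈ S, evT n (ξ i) x := by
  classical
  induction S using Finset.induction_on with
  | empty => simpa using evT_smul 0 (0 : Module.Dual ℂ N) x
  | insert j S hj ih => rw [Finset.sum_insert hj, Finset.sum_insert hj, evT_add, ih]

lemma evT_map (g : V →ₗ[ℂ] V') (h : N →ₗ[ℂ] N') (ξ : Module.Dual ℂ N')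
    (x : (⋀[ℂ]^n V) ⊗[ℂ] N) :
    evT n ξ (TensorProduct.map (exteriorPower.map n g) h x) =
      ExteriorAlgebra.map g (evT n (ξ ∘ₗ h) x) := by
  induction x using TensorProduct.induction_on with
  | zero => simp
  | tmul x a =>
    rw [TensorProduct.map_tmul, evT_tmul, evT_tmul, map_smul]
    congr 1
    obtain ⟨x, hx⟩ := x
    have : ∀ y : ⋀[ℂ]^n V, (exteriorPower.map n g y : ExteriorAlgebra ℂ V') =
        ExteriorAlgebra.map g (y : ExteriorAlgebra ℂ V) := by
      intro y
      have : (⋀[ℂ]^n V').subtype ∘ₗ exteriorPower.map n g =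
          (ExteriorAlgebra.map g).toLinearMap ∘ₗ (⋀[ℂ]^n V).subtype := by
        refine exteriorPower.linearMap_ext ?_
        ext v
        simp
      exact LinearMap.congr_fun this y
    exact this _
  | add x y hx hy => rw [map_add, map_add, map_add, map_add, hx, hy]

/-- Evaluation turns the Koszul differential into a contraction. -/
lemma evT_d (μ : V →ₗ[ℂ] N →ₗ[ℂ] N') (p : ℕ) (ξ : Module.Dual ℂ V) (a : Module.Dual ℂ N)
    (b : Module.Dual ℂ N') (h : ∀ v n, b (μ v n) = ξ v * a n)
    (x : (⋀[ℂ]^(p + 1) V) ⊗[ℂ] N) : evT p b (d μ p x) = ctr ξ (evT (p + 1) a x) := by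
  have : evT p b ∘ₗ d μ p = ctr ξ ∘ₗ evT (p + 1) a := by
    apply TensorProduct.ext
    refine exteriorPower.linearMap_ext (N := N →ₗ[ℂ] ExteriorAlgebra ℂ V) ?_
    ext v m
    change evT p b (d μ p (exteriorPower.ιMulti ℂ (p + 1) v ⊗ₜ m)) =
      ctr ξ (evT (p + 1) a (exteriorPower.ιMulti ℂ (p + 1) v ⊗ₜ m))
    rw [d_ιMulti_tmul, evT_tmul, exteriorPower.ιMulti_apply_coe, map_smul, ctr_ιMulti, map_sum,
      Finset.smul_sum]
    refine Finset.sum_congr rfl fun i _ => ?_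
    rw [map_zsmul, evT_tmul, exteriorPower.ιMulti_apply_coe, h, smul_comm (a m), smul_smul,
      mul_comm (ξ _)]
  exact LinearMap.congr_fun this x

/-- A tensor is zero if all its evaluations by a separating family vanish. -/
lemma eq_zero_of_evT {Y : Type} (ξ : Y → Module.Dual ℂ N) (hξ : ∀ a : N, (∀ y, ξ y a = 0) → a = 0)
    (x : (⋀[ℂ]^n V) ⊗[ℂ] N) (hx : ∀ y, evT n (ξ y) x = 0) : x = 0 := by
  classical
  let b := Module.Basis.ofVectorSpace ℂ (⋀[ℂ]^n V)
  have key : ∀ i, TensorProduct.lid ℂ N (TensorProduct.map (b.coord i) LinearMap.id x) = 0 := by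
    intro i
    refine hξ _ fun y => ?_
    -- Evaluations take values in the whole exterior algebra, so a coordinate functional on the
    -- power is extended to it.
    obtain ⟨l, hl⟩ := (b.coord i).exists_extend
    have : ∀ x : (⋀[ℂ]^n V) ⊗[ℂ] N,
        ξ y (TensorProduct.lid ℂ N (TensorProduct.map (b.coord i) LinearMap.id x)) =
          l (evT n (ξ y) x) := by
      intro x
      induction x using TensorProduct.induction_on with
      | zero => simp
      | tmul x a =>
        have := LinearMap.congr_fun hl x
        simp only [LinearMap.comp_apply, Submodule.subtype_apply] at this
        simp [this, mul_comm]
      | add x y hx hy => simp only [map_add, hx, hy]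
    rw [this, hx, map_zero]
  have hinj := (TensorProduct.equivFinsuppOfBasisLeft (N := N) b).injective
  refine hinj ?_
  rw [map_zero]
  ext i
  rw [Finsupp.zero_apply, ← key i]
  clear key hx
  induction x using TensorProduct.induction_on with
  | zero => simp
  | tmul x a => simp
  | add x y hx hy => simp only [map_add, Finsupp.add_apply, hx, hy]

end Koszul

end

/-! ### The generator over a point of the line, its two functionals, and local solutions -/

noncomputable section

/-- The determinant of an endomorphism which is triangular with constant diagonal. -/
lemma det_of_triangular {M I : Type} [AddCommGroup M] [Module ℂ M] [Fintype I]
    [DecidableEq I] (b : Module.Basis I ℂ M) (f : M →ₗ[ℂ] M) (r : I → ℤ) (c : ℂ)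
    (h : ∀ i j, r j ≤ r i → b.repr (f (b j)) i = if i = j then c else 0) :
    LinearMap.det f = c ^ Fintype.card I := by
  classical
  -- Ties in `r` are broken by an arbitrary enumeration; entries between distinct indices of equal
  -- `r` vanish anyway.
  let _ : LinearOrder I := LinearOrder.lift' (fun j => toLex (r j, Fintype.equivFin I j))
    (fun i j hij => by
      have := congrArg (fun x => (ofLex x).2) hij
      exact (Fintype.equivFin I).injective this)
  rw [← LinearMap.det_toMatrix b, Matrix.det_of_isUpperTriangular]
  · simp [LinearMap.toMatrix_apply, h]
  · intro i j hij
    have hij : toLex (r j, Fintype.equivFin I j) < toLex (r i, Fintype.equivFin I i) := hij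
    rw [LinearMap.toMatrix_apply, h, if_neg]
    · rintro rfl
      exact lt_irrefl _ hij
    · rcases Prod.Lex.lt_iff.1 hij with h | h
      · exact h.le
      · exact h.1.le

namespace Scroll

open ProjSpace ExteriorAlgebra Koszul

variable {d : ℕ} {e : Fin d → ℕ} {p : ℕ}

/-- The monomial basis of `H⁰(X, H - R)` indexed by an initial segment. -/
def wbf (hp : ∑ i, e i = p + 1) : Module.Basis (Fin (p + 1)) ℂ (H0HsubR e) :=
  (wb e).reindex (Fintype.equivOfCardEq (by simp [hp]))

/-- The section `a₀ x₁ - a₁ x₀` of `R`, which vanishes at `a`. -/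
def sec (a : Fin 2 → ℂ) : H0R e := lin ![-(a 1), a 0]

lemma sec_apply (a : Fin 2 → ℂ) (y : coords d) :
    (sec a : H0R e).1 y = a 0 * y.1.1 1 - a 1 * y.1.1 0 := by
  rw [sec, lin_apply]
  simp
  ring

/-- The generator `⋀ᵢ (sₐ wᵢ)` of `⋀^f (sₐ H⁰(X, H - R))`. -/
def topWedge (hp : ∑ i, e i = p + 1) (a : Fin 2 → ℂ) : ExteriorAlgebra ℂ (H0H e 1) :=
  ιMulti ℂ (p + 1) (mulBy (sec a) ∘ wbf hp)

lemma topWedge_mem (hp : ∑ i, e i = p + 1) (a : Fin 2 → ℂ) :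
    topWedge hp a ∈ ⋀[ℂ]^(p + 1) (H0H e 1) :=
  ιMulti_range ℂ _ ⟨_, rfl⟩

/-- Dividing monomials by `x₁` and discarding the remainder. -/
def divHigh : H0H e 1 →ₗ[ℂ] H0HsubR e :=
  (vb e).constr ℂ fun j => Fin.cases (motive := fun _ => H0HsubR e) 0 (fun k => wb e ⟨j.1, k⟩) j.2

/-- Dividing monomials by `x₀` and discarding the remainder. -/
def divLow : H0H e 1 →ₗ[ℂ] H0HsubR e :=
  (vb e).constr ℂ fun j =>
    Fin.lastCases (motive := fun _ => H0HsubR e) 0 (fun k => wb e ⟨j.1, k⟩) j.2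

/-- Any linear map back to `H⁰(H - R)` yields a functional on `⋀^f H⁰(H)` whose value on the
generator is a determinant. Two well chosen maps make this determinant a power of `a 0` or of `a 1`.
-/
lemma map_topWedge (hp : ∑ i, e i = p + 1) (a : Fin 2 → ℂ) (A : H0H e 1 →ₗ[ℂ] H0HsubR e) :
    detFunctional (wbf hp) (ExteriorAlgebra.map A (topWedge hp a)) =
      LinearMap.det (A ∘ₗ mulBy (sec a)) := by
  rw [topWedge, map_apply_ιMulti, detFunctional_ιMulti, ← Function.comp_assoc,
    ← LinearMap.coe_comp, Module.Basis.det_comp, Module.Basis.det_self, mul_one]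

/-- Multiplication by `a₀ x₁ - a₁ x₀` followed by division by `x₁` sends a monomial to `a₀` times
itself minus `a₁` times the one with lower `x₁`-exponent, if there is one. It is therefore
triangular with diagonal `a₀` for the grading by that exponent. -/
lemma det_divHigh (hp : ∑ i, e i = p + 1) (a : Fin 2 → ℂ) :
    LinearMap.det ((divHigh : H0H e 1 →ₗ[ℂ] H0HsubR e) ∘ₗ mulBy (sec a)) = a 0 ^ (p + 1) := by
  rw [det_of_triangular (wb e) _ (fun j => ((j.2 : ℕ) : ℤ)) (a 0)]
  · simp [hp]
  · rintro i ⟨j, k⟩ hij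
    rw [LinearMap.comp_apply, sec, mulBy_lin_wb, map_add, map_smul, map_smul, divHigh,
      Module.Basis.constr_basis, Module.Basis.constr_basis]
    simp only [Fin.cases_succ]
    obtain ⟨k, hk⟩ := k
    cases k with
    | zero =>
      rw [show (⟨0, hk⟩ : Fin (e j)).castSucc = 0 from rfl]
      simp [Finsupp.single_apply, eq_comm]
    | succ k =>
      have hk' : k < e j := by omega
      rw [show (⟨k + 1, hk⟩ : Fin (e j)).castSucc = (⟨k, hk'⟩ : Fin (e j)).succ from rfl]
      simp only [Fin.cases_succ, map_add, map_smul, Module.Basis.repr_self, Finsupp.add_apply,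
        Finsupp.smul_apply, Finsupp.single_apply]
      rw [if_neg (c := (⟨j, ⟨k, hk'⟩⟩ : Σ i, Fin (e i)) = i)]
      · simp [eq_comm]
      · rintro rfl
        simp at hij

/-- Division by `x₀` instead keeps `-a₁` on the diagonal and raises the `x₁`-exponent in the other
term, whence the opposite grading. -/
lemma det_divLow (hp : ∑ i, e i = p + 1) (a : Fin 2 → ℂ) :
    LinearMap.det ((divLow : H0H e 1 →ₗ[ℂ] H0HsubR e) ∘ₗ mulBy (sec a)) =
      (-(a 1)) ^ (p + 1) := by
  rw [det_of_triangular (wb e) _ (fun j => -((j.2 : ℕ) : ℤ)) (-(a 1))]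
  · simp [hp]
  · rintro i ⟨j, k⟩ hij
    rw [LinearMap.comp_apply, sec, mulBy_lin_wb, map_add, map_smul, map_smul, divLow,
      Module.Basis.constr_basis, Module.Basis.constr_basis]
    simp only [Fin.lastCases_castSucc]
    by_cases hk : (k : ℕ) + 1 < e j
    · rw [show k.succ = (⟨(k : ℕ) + 1, hk⟩ : Fin (e j)).castSucc from rfl]
      simp only [Fin.lastCases_castSucc, map_add, map_smul, Module.Basis.repr_self,
        Finsupp.add_apply, Finsupp.smul_apply, Finsupp.single_apply]
      rw [if_neg (c := (⟨j, ⟨(k : ℕ) + 1, hk⟩⟩ : Σ i, Fin (e i)) = i)]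
      · simp [eq_comm]
      · rintro rfl
        simp at hij
    · rw [show k.succ = Fin.last (e j) from Fin.ext (by
        have := k.2
        simp only [Fin.val_succ, Fin.val_last]
        omega)]
      simp only [Fin.lastCases_last, map_smul, smul_zero, add_zero, Module.Basis.repr_self,
        Finsupp.smul_apply, Finsupp.single_apply]
      simp [eq_comm]

/-- A functional with value `a₀^f` on the generator attached to `a`. -/
def highForm (hp : ∑ i, e i = p + 1) : Module.Dual ℂ (ExteriorAlgebra ℂ (H0H e 1)) :=
  detFunctional (wbf hp) ∘ₗ (ExteriorAlgebra.map divHigh).toLinearMap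

/-- A functional with value `a₁^f` on the generator attached to `a`. -/
def lowForm (hp : ∑ i, e i = p + 1) : Module.Dual ℂ (ExteriorAlgebra ℂ (H0H e 1)) :=
  (-1 : ℂ) ^ (p + 1) • detFunctional (wbf hp) ∘ₗ (ExteriorAlgebra.map divLow).toLinearMap

lemma highForm_topWedge (hp : ∑ i, e i = p + 1) (a : Fin 2 → ℂ) :
    highForm hp (topWedge hp a) = a 0 ^ (p + 1) :=
  (map_topWedge hp a _).trans (det_divHigh hp a)

lemma lowForm_topWedge (hp : ∑ i, e i = p + 1) (a : Fin 2 → ℂ) :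
    lowForm hp (topWedge hp a) = a 1 ^ (p + 1) := by
  have := (map_topWedge hp a divLow).trans (det_divLow hp a)
  simp only [lowForm, LinearMap.smul_apply, LinearMap.comp_apply, AlgHom.toLinearMap_apply, this,
    smul_eq_mul, ← mul_pow]
  simp

/-! ### Points of `ℙ¹` in the two standard charts -/

/-- The point `(1 : t)`. -/
def chart (t : ℂ) : cone (Fin 2 → ℂ) := ⟨![1, t], vec_ne_zero_left t⟩

/-- The point `(t : 1)`. -/
def chart' (t : ℂ) : cone (Fin 2 → ℂ) := ⟨![t, 1], vec_ne_zero_right t⟩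

lemma coeffAt_chart_vb (t : ℂ) (i : Fin d) (j : Σ i, Fin (e i + 1)) :
    coeffAt (chart t) i (vb e j) = if j.1 = i then t ^ (j.2 : ℕ) else 0 := by
  rw [coeffAt_vb]
  simp [chart]

lemma coeffAt_chart'_vb (t : ℂ) (i : Fin d) (j : Σ i, Fin (e i + 1)) :
    coeffAt (chart' t) i (vb e j) = if j.1 = i then t ^ (e j.1 - (j.2 : ℕ)) else 0 := by
  rw [coeffAt_vb]
  simp [chart']

lemma coeffAt_chart_wb (t : ℂ) (i : Fin d) (j : Σ i, Fin (e i)) :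
    coeffAt (chart t) i (wb e j) = if j.1 = i then t ^ (j.2 : ℕ) else 0 := by
  rw [coeffAt_wb]
  simp [chart]

lemma coeffAt_scale {b : ℤ} (c : ℂˣ) (x : cone (Fin 2 → ℂ)) (i : Fin d) :
    (coeffAt (scale c x) i : sections e 1 b →ₗ[ℂ] ℂ) =
      (c : ℂ) ^ ((e i : ℤ) + b) • coeffAt x i := by
  ext F
  rw [LinearMap.smul_apply, ev_apply, ev_apply, ← act_unitVec (e := e), F.2.2, zpow_add₀ c.ne_zero]
  simp

lemma coeffAt_chart' {b : ℤ} {t : ℂ} (ht : t ≠ 0) (i : Fin d) :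
    ∃ c : ℂ, c ≠ 0 ∧ (coeffAt (chart' t⁻¹) i : sections e 1 b →ₗ[ℂ] ℂ) =
      c • coeffAt (chart t) i := by
  refine ⟨t⁻¹ ^ ((e i : ℤ) + b), zpow_ne_zero _ (inv_ne_zero ht), ?_⟩
  rw [show chart' t⁻¹ = scale (Units.mk0 t⁻¹ (inv_ne_zero ht)) (chart t) from
    Subtype.ext (by simp [chart, chart', scale, Units.smul_def, ht]), coeffAt_scale]
  rfl

/-- Elements of `H⁰(X, H + bR)` are determined by their values over an infinite set of points. -/
lemma section_eq_zero_of_chart {F : H0H e 1} {S : Set ℂ} (hS : S.Infinite)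
    (h : ∀ t ∈ S, ∀ i, coeffAt (chart t) i F = 0) : F = 0 := by
  rw [← (vb e).sum_repr F] at h ⊢
  refine Finset.sum_eq_zero ?_
  rintro ⟨i, k⟩ -
  have key : (fun k : Fin (e i + 1) => (vb e).repr F ⟨i, k⟩) = 0 := by
    refine coeff_eq_zero_of_sum_pow _ S hS fun t ht => ?_
    have := h t ht i
    rw [map_sum, Fintype.sum_sigma, Finset.sum_eq_single i] at this
    · simpa [-ev_apply, coeffAt_chart_vb] using this
    · intro j _ hj
      simp [-ev_apply, coeffAt_chart_vb, hj]
    · simp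
  rw [show (vb e).repr F ⟨i, k⟩ = 0 from congrFun key k, zero_smul]

lemma pair_ne_zero {i j : Fin d} (hij : i ≠ j) :
    (Pi.single i 1 + Pi.single j 1 : Fin d → ℂ) ≠ 0 := fun h => by
  simpa [hij] using congrFun h i

/-- The sum of two coordinate vectors. -/
def pairVec {i j : Fin d} (hij : i ≠ j) : cone (Fin d → ℂ) := ⟨_, pair_ne_zero hij⟩

lemma ev_pairVec {b : ℤ} (x : cone (Fin 2 → ℂ)) {i j : Fin d} (hij : i ≠ j) :
    (ev (pt x (pairVec hij)) : sections e 1 b →ₗ[ℂ] ℂ) = coeffAt x i + coeffAt x j := by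
  ext F
  rw [ev_apply, section_apply]
  simp [-ev_apply, pairVec, add_mul, Finset.sum_add_distrib, Pi.single_apply]

/-! ### Cycles as families of vectors in the exterior algebra -/

variable (e p) in
/-- The cycles defining `K_{p,1}(X, H)`. -/
abbrev Cyc : Submodule ℂ ((⋀[ℂ]^p (H0H e 1)) ⊗[ℂ] (H0H e 1)) :=
  Koszul.cycles (mulH (LinearMap.id : H0H e 1 →ₗ[ℂ] H0H e 1) 1 (1 + 1) (add_comm 1 1)) p

/-- Contraction of a cycle for a multiplication map that is compatible with evaluation. -/
lemma ctr_evT_of_cycle {V : Type} [AddCommGroup V] [Module ℂ V] (j : V →ₗ[ℂ] H0H e 1) (hp0 : p ≠ 0)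
    {γ : (⋀[ℂ]^p V) ⊗[ℂ] (H0H e 1)}
    (hγ : γ ∈ Koszul.cycles (mulH j 1 (1 + 1) (add_comm 1 1)) p) (y : coords d) :
    ctr (ev y ∘ₗ j) (evT p (ev y) γ) = 0 := by
  obtain ⟨q, rfl⟩ := Nat.exists_eq_succ_of_ne_zero hp0
  have h : Koszul.d (mulH j 1 (1 + 1) (add_comm 1 1)) q γ = 0 := hγ
  rw [← evT_d (mulH j 1 (1 + 1) (add_comm 1 1)) q _ _ (ev y) (fun v n => rfl), h, map_zero]

lemma ctr_coeffAt_self (hp0 : p ≠ 0) (γ : Cyc e p) (x : cone (Fin 2 → ℂ)) (i : Fin d) :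
    ctr (coeffAt x i) (evT p (coeffAt x i) γ.1) = 0 :=
  ctr_evT_of_cycle LinearMap.id hp0 γ.2 _

/-- Polarisation: the cycle condition at `zᵢ = zⱼ = 1` expands into the two conditions at the
coordinate vectors and this cross term. -/
lemma ctr_coeffAt_comm (hp0 : p ≠ 0) (γ : Cyc e p) (x : cone (Fin 2 → ℂ)) {i j : Fin d}
    (hij : i ≠ j) :
    ctr (coeffAt x i) (evT p (coeffAt x j) γ.1) +
      ctr (coeffAt x j) (evT p (coeffAt x i) γ.1) = 0 := by
  have h := ctr_evT_of_cycle LinearMap.id hp0 γ.2 (pt x (pairVec hij))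
  rw [LinearMap.comp_id, ev_pairVec, evT_add, ctr_add, map_add, map_add, ctr_coeffAt_self hp0,
    ctr_coeffAt_self hp0, zero_add, add_zero] at h
  exact h

lemma isPolyFamily_evT {V N I : Type} [AddCommGroup V] [Module ℂ V] [AddCommGroup N] [Module ℂ N]
    [Fintype I] (b : Module.Basis I ℂ N) {n : ℕ} {ξ : ℂ → Module.Dual ℂ N}
    (hξ : ∀ i, ∃ P : Polynomial ℂ, ∀ t, ξ t (b i) = P.eval t) (x : (⋀[ℂ]^n V) ⊗[ℂ] N) :
    IsPolyFamily fun t => evT n (ξ t) x := by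
  choose P hP using hξ
  have : ∀ t, ξ t = ∑ i, (P i).eval t • b.coord i := by
    intro t
    classical
    refine b.ext fun j => ?_
    simp [hP, Finsupp.single_apply]
  simp only [this, evT_sum, evT_smul]
  exact .sum _ fun i => (IsPolyFamily.const _).smul _

/-- The sections `u` do not depend on the parameter, yet are dual to the evaluations at every point
of the chart. This is what makes the recursive solution polynomial in `t`. -/
lemma exists_family (hp0 : p ≠ 0) (γ : Cyc e p) (x : ℂ → cone (Fin 2 → ℂ)) (u : Fin d → H0H e 1)
    (hu : ∀ t i j, coeffAt (x t) i (u j) = if i = j then 1 else 0)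
    (hx : ∀ i j, ∃ P : Polynomial ℂ, ∀ t, coeffAt (x t) i (vb e j) = P.eval t) :
    ∃ β : ℂ → ExteriorAlgebra ℂ (H0H e 1), IsPolyFamily β ∧
      (∀ t, β t ∈ ⋀[ℂ]^(p + 1) (H0H e 1)) ∧
      ∀ t i, ctr (coeffAt (x t) i) (β t) = evT p (coeffAt (x t) i) γ.1 :=
  exists_ctr_eq (fun i t => coeffAt (x t) i) u hu
    (fun i _ hF => hF.ctr_of_basis (vb e) (hx i)) (fun i t => evT p (coeffAt (x t) i) γ.1)
    (fun i => isPolyFamily_evT (vb e) (hx i) γ.1) (fun _ _ => evT_mem _ _)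
    (fun _ i => ctr_coeffAt_self hp0 γ _ i) (fun _ _ _ hij => ctr_coeffAt_comm hp0 γ _ hij)

/-- On the chart `x₀ = 1` the dual sections are `zᵢ x₀^eᵢ`. -/
lemma exists_family_chart (hp0 : p ≠ 0) (γ : Cyc e p) :
    ∃ β : ℂ → ExteriorAlgebra ℂ (H0H e 1), IsPolyFamily β ∧
      (∀ t, β t ∈ ⋀[ℂ]^(p + 1) (H0H e 1)) ∧
      ∀ t i, ctr (coeffAt (chart t) i) (β t) = evT p (coeffAt (chart t) i) γ.1 := by
  refine exists_family hp0 γ chart (fun i => vb e ⟨i, 0⟩) (fun t i j => ?_) (fun i j => ?_)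
  · rw [coeffAt_chart_vb]
    simp [eq_comm]
  · simp only [coeffAt_chart_vb]
    by_cases h : j.1 = i
    · exact ⟨Polynomial.X ^ (j.2 : ℕ), fun t => by simp [h]⟩
    · exact ⟨0, fun t => by simp [h]⟩

/-- On the chart `x₁ = 1` the dual sections are `zᵢ x₁^eᵢ`. The evaluations at `(t⁻¹ : 1)` and `(1 :
t)` differ by a nonzero scalar that occurs on both sides of each equation, so the solution for the
former also serves the latter. -/
lemma exists_family_chart' (hp0 : p ≠ 0) (γ : Cyc e p) :
    ∃ β : ℂ → ExteriorAlgebra ℂ (H0H e 1), IsPolyFamily β ∧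
      (∀ t, β t ∈ ⋀[ℂ]^(p + 1) (H0H e 1)) ∧
      ∀ t, t ≠ 0 → ∀ i, ctr (coeffAt (chart t) i) (β t⁻¹) = evT p (coeffAt (chart t) i) γ.1 := by
  obtain ⟨β, h1, h2, h3⟩ := exists_family hp0 γ chart' (fun i => vb e ⟨i, Fin.last _⟩)
    (fun t i j => by
      rw [coeffAt_chart'_vb]
      simp [eq_comm])
    (fun i j => by
      simp only [coeffAt_chart'_vb]
      by_cases h : j.1 = i
      · exact ⟨Polynomial.X ^ (e j.1 - (j.2 : ℕ)), fun t => by simp [h]⟩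
      · exact ⟨0, fun t => by simp [h]⟩)
  refine ⟨β, h1, h2, fun t ht i => ?_⟩
  obtain ⟨c, hc, h⟩ := coeffAt_chart' (e := e) (b := 0) ht i
  have := h3 t⁻¹ i
  rw [h, ctr_smul, evT_smul] at this
  exact (smul_right_injective _ hc) this

lemma map_mem_power {V V' : Type} [AddCommGroup V] [Module ℂ V] [AddCommGroup V'] [Module ℂ V']
    (g : V →ₗ[ℂ] V') {n : ℕ} {x : ExteriorAlgebra ℂ V} (hx : x ∈ ⋀[ℂ]^n V) :
    ExteriorAlgebra.map g x ∈ ⋀[ℂ]^n V' := by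
  refine power_induct (C := fun x => ExteriorAlgebra.map g x ∈ ⋀[ℂ]^n V') ?_ ?_ ?_ ?_ hx
  · intro v
    rw [map_apply_ιMulti]
    exact ιMulti_range ℂ _ ⟨_, rfl⟩
  · simp
  · intro x y hx hy
    rw [map_add]
    exact add_mem hx hy
  · intro c x hx
    rw [map_smul]
    exact Submodule.smul_mem _ _ hx

/-- The sections in `t`-direction that differ from a multiple of `zᵢ x₀^eᵢ` by a multiple of
`x₁ - t x₀`. -/
lemma vb_sub_mem_range (t : ℂ) (i : Fin d) (k : ℕ) (hk : k < e i + 1) :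
    vb e ⟨i, ⟨k, hk⟩⟩ - t ^ k • vb e ⟨i, 0⟩ ∈
      LinearMap.range (mulBy (sec ![1, t] : H0R e)) := by
  induction k with
  | zero => simp
  | succ k ih =>
    have h1 := Submodule.smul_mem _ t (ih (by omega))
    have h2 : mulBy (sec ![1, t]) (wb e ⟨i, ⟨k, by omega⟩⟩) ∈
      LinearMap.range (mulBy (sec ![1, t] : H0R e)) := ⟨_, rfl⟩
    rw [sec, mulBy_lin_wb] at h2
    have h3 := add_mem h1 h2
    convert h3 using 1
    simp only [Matrix.cons_val_one, Matrix.cons_val_zero, Fin.succ_mk, Fin.castSucc_mk, pow_succ']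
    module

/-- An element killed by all evaluations at `(1 : t)` is fixed by the projection onto their common
kernel along the `zᵢ x₀^eᵢ`. That projection factors through multiplication by the section vanishing
at `(1 : t)`, so the element comes from the one-dimensional `⋀^f H⁰(X, H - R)`. -/
lemma eq_smul_topWedge (hp : ∑ i, e i = p + 1) (t : ℂ) {x : ExteriorAlgebra ℂ (H0H e 1)}
    (hx : x ∈ ⋀[ℂ]^(p + 1) (H0H e 1)) (h : ∀ i, ctr (coeffAt (chart t) i) x = 0) :
    ∃ c : ℂ, x = c • topWedge hp ![1, t] := by
  let π : H0H e 1 →ₗ[ℂ] H0H e 1 :=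
    LinearMap.id - ∑ i, (coeffAt (chart t) i : H0H e 1 →ₗ[ℂ] ℂ).smulRight (vb e ⟨i, 0⟩)
  have hπ : ExteriorAlgebra.map π x = x :=
    map_proj_eq_self (fun i => coeffAt (chart t) i) (fun i => vb e ⟨i, 0⟩)
      (fun i j => by rw [coeffAt_chart_vb]; simp [eq_comm]) x h Finset.univ
  have hrange : ∀ j, ∃ w, mulBy (sec ![1, t]) w = π (vb e j) := by
    rintro ⟨i, k⟩
    obtain ⟨w, hw⟩ := vb_sub_mem_range (e := e) t i k k.2
    refine ⟨w, hw.trans ?_⟩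
    simp only [π, LinearMap.sub_apply, LinearMap.id_apply, LinearMap.sum_apply,
      LinearMap.smulRight_apply, coeffAt_chart_vb]
    simp
  choose ρ hρ using hrange
  have hfac : π = mulBy (sec ![1, t]) ∘ₗ (vb e).constr ℂ ρ := by
    refine (vb e).ext fun j => ?_
    rw [LinearMap.comp_apply, Module.Basis.constr_basis, hρ]
  refine ⟨detFunctional (wbf hp) (ExteriorAlgebra.map ((vb e).constr ℂ ρ) x), ?_⟩
  conv_lhs => rw [← hπ, hfac, ← map_comp_map, AlgHom.comp_apply,
    eq_detFunctional_smul (wbf hp) (map_mem_power _ hx), map_smul, map_apply_ιMulti]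
  rfl

end Scroll

end

/-! ### The residue polynomial of a cycle and its inner coefficients -/

noncomputable section

namespace Scroll

open ProjSpace ExteriorAlgebra Koszul

variable {d : ℕ} {e : Fin d → ℕ} {p : ℕ}

/-- `β` solves at `(1 : t)` the equations that express a cycle `γ` locally as a boundary. -/
def Solves (γ : (⋀[ℂ]^p (H0H e 1)) ⊗[ℂ] (H0H e 1)) (t : ℂ) (β : ExteriorAlgebra ℂ (H0H e 1)) :
    Prop :=
  β ∈ ⋀[ℂ]^(p + 1) (H0H e 1) ∧
    ∀ i, ctr (coeffAt (chart t) i) β = evT p (coeffAt (chart t) i) γ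

/-- The combination of the two functionals that vanishes on the generator attached to `(1 : t)`. -/
def residue (hp : ∑ i, e i = p + 1) (t : ℂ) : Module.Dual ℂ (ExteriorAlgebra ℂ (H0H e 1)) :=
  lowForm hp - t ^ (p + 1) • highForm hp

lemma residue_apply (hp : ∑ i, e i = p + 1) (t : ℂ) (β : ExteriorAlgebra ℂ (H0H e 1)) :
    residue hp t β = lowForm hp β - t ^ (p + 1) * highForm hp β := rfl

lemma residue_topWedge (hp : ∑ i, e i = p + 1) (t : ℂ) (a : Fin 2 → ℂ) :
    residue hp t (topWedge hp a) = a 1 ^ (p + 1) - t ^ (p + 1) * a 0 ^ (p + 1) := by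
  rw [residue_apply, lowForm_topWedge, highForm_topWedge]

lemma Solves.exists_sub_eq (hp : ∑ i, e i = p + 1)
    {γ : (⋀[ℂ]^p (H0H e 1)) ⊗[ℂ] (H0H e 1)} {t : ℂ} {β β' : ExteriorAlgebra ℂ (H0H e 1)}
    (h : Solves γ t β) (h' : Solves γ t β') : ∃ c : ℂ, β - β' = c • topWedge hp ![1, t] :=
  eq_smul_topWedge hp t (sub_mem h.1 h'.1) fun i => by rw [map_sub, h.2, h'.2, sub_self]

/-- The ambiguity of a local solution is a multiple of the generator at `(1 : t)`, on which the
residue takes the value `t ^ (p + 1) - t ^ (p + 1) = 0`. -/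
lemma Solves.residue_eq (hp : ∑ i, e i = p + 1)
    {γ : (⋀[ℂ]^p (H0H e 1)) ⊗[ℂ] (H0H e 1)} {t : ℂ} {β β' : ExteriorAlgebra ℂ (H0H e 1)}
    (h : Solves γ t β) (h' : Solves γ t β') : residue hp t β = residue hp t β' := by
  obtain ⟨c, hc⟩ := h.exists_sub_eq hp h'
  rw [← sub_eq_zero, ← map_sub, hc, map_smul, residue_topWedge]
  simp

/-- Two solutions with the same values of the functionals agree. -/
lemma Solves.eq (hp : ∑ i, e i = p + 1)
    {γ : (⋀[ℂ]^p (H0H e 1)) ⊗[ℂ] (H0H e 1)} {t : ℂ} {β β' : ExteriorAlgebra ℂ (H0H e 1)}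
    (h : Solves γ t β) (h' : Solves γ t β') (hβ : highForm hp β = highForm hp β') : β = β' := by
  obtain ⟨c, hc⟩ := h.exists_sub_eq hp h'
  have := congrArg (highForm hp) hc
  rw [map_sub, hβ, sub_self, map_smul, highForm_topWedge] at this
  have hc0 : c = 0 := by simpa using this.symm
  rwa [hc0, zero_smul, sub_eq_zero] at hc

-- The residue does not depend on the solution, so either chart may compute it: the first shows that
-- it is polynomial in `t`, the second bounds its degree by `f = p + 1`.
open Polynomial in
lemma exists_residue_polynomial (hp : ∑ i, e i = p + 1) (hp0 : p ≠ 0) (γ : Cyc e p) :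
    ∃ P : ℂ[X], P.degree < (p + 2 : ℕ) ∧ ∀ t β, Solves γ.1 t β → P.eval t = residue hp t β := by
  obtain ⟨β, h1, h2, h3⟩ := exists_family_chart hp0 γ
  obtain ⟨β', h1', h2', h3'⟩ := exists_family_chart' hp0 γ
  obtain ⟨A, hA⟩ := h1 (lowForm hp)
  obtain ⟨B, hB⟩ := h1 (highForm hp)
  obtain ⟨A', hA'⟩ := h1' (lowForm hp)
  obtain ⟨B', hB'⟩ := h1' (highForm hp)
  have hP : ∀ t β, Solves γ.1 t β → (A - X ^ (p + 1) * B).eval t = residue hp t β := by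
    intro t x hx
    rw [hx.residue_eq hp (β' := β t) ⟨h2 t, h3 t⟩, residue_apply, hA, hB]
    simp
  -- With `A'` and `B'` the two functionals in the second chart, `P(t) = A'(t⁻¹) - t^(p+1) B'(t⁻¹)`,
  -- that is `t^(p+1) Q(t⁻¹)` for `Q = X^(p+1) A' - B'`.
  refine ⟨A - X ^ (p + 1) * B, degree_lt_of_eval_inv _ (X ^ (p + 1) * A' - B') ?_, hP⟩
  intro t ht
  rw [hP t (β' t⁻¹) ⟨h2' _, h3' t ht⟩, residue_apply, hA', hB']
  simp only [eval_sub, eval_mul, eval_pow, eval_X]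
  have h1 : t ^ (p + 1) * t⁻¹ ^ (p + 1) = 1 := by rw [← mul_pow, mul_inv_cancel₀ ht, one_pow]
  linear_combination (-t * eval t⁻¹ A') * h1

/-- The polynomial in `t` attached to a cycle. -/
def residuePoly (hp : ∑ i, e i = p + 1) (hp0 : p ≠ 0) (γ : Cyc e p) : Polynomial ℂ :=
  (exists_residue_polynomial hp hp0 γ).choose

lemma residuePoly_degree (hp : ∑ i, e i = p + 1) (hp0 : p ≠ 0) (γ : Cyc e p) :
    (residuePoly hp hp0 γ).degree < (p + 2 : ℕ) :=
  (exists_residue_polynomial hp hp0 γ).choose_spec.1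

lemma residuePoly_eval (hp : ∑ i, e i = p + 1) (hp0 : p ≠ 0) (γ : Cyc e p) {t : ℂ}
    {β : ExteriorAlgebra ℂ (H0H e 1)} (h : Solves γ.1 t β) :
    (residuePoly hp hp0 γ).eval t = residue hp t β :=
  (exists_residue_polynomial hp hp0 γ).choose_spec.2 t β h

lemma residuePoly_eq (hp : ∑ i, e i = p + 1) (hp0 : p ≠ 0) (γ : Cyc e p) (P : Polynomial ℂ)
    {S : Set ℂ} (hS : S.Infinite)
    (h : ∀ t ∈ S, ∃ β, Solves γ.1 t β ∧ residue hp t β = P.eval t) : residuePoly hp hp0 γ = P := by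
  refine Polynomial.eq_of_infinite_eval_eq _ _ (hS.mono fun t ht => ?_)
  obtain ⟨β, hβ, h'⟩ := h t ht
  exact (residuePoly_eval hp hp0 γ hβ).trans h'

lemma exists_solves (hp0 : p ≠ 0) (γ : Cyc e p) (t : ℂ) : ∃ β, Solves γ.1 t β := by
  obtain ⟨β, -, h2, h3⟩ := exists_family_chart hp0 γ
  exact ⟨β t, h2 t, h3 t⟩

lemma Solves.add {γ γ' : (⋀[ℂ]^p (H0H e 1)) ⊗[ℂ] (H0H e 1)} {t : ℂ}
    {β β' : ExteriorAlgebra ℂ (H0H e 1)} (h : Solves γ t β) (h' : Solves γ' t β') :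
    Solves (γ + γ') t (β + β') :=
  ⟨add_mem h.1 h'.1, fun i => by rw [map_add, map_add, h.2, h'.2]⟩

lemma Solves.smul {γ : (⋀[ℂ]^p (H0H e 1)) ⊗[ℂ] (H0H e 1)} {t : ℂ}
    {β : ExteriorAlgebra ℂ (H0H e 1)} (h : Solves γ t β) (c : ℂ) :
    Solves (c • γ) t (c • β) :=
  ⟨Submodule.smul_mem _ _ h.1, fun i => by rw [map_smul, map_smul, h.2]⟩

/-- The residue polynomial as a linear map. -/
def residueMap (hp : ∑ i, e i = p + 1) (hp0 : p ≠ 0) : Cyc e p →ₗ[ℂ] Polynomial ℂ where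
  toFun := residuePoly hp hp0
  map_add' γ γ' := residuePoly_eq hp hp0 _ _ Set.infinite_univ fun t _ => by
    obtain ⟨β, hβ⟩ := exists_solves hp0 γ t
    obtain ⟨β', hβ'⟩ := exists_solves hp0 γ' t
    exact ⟨β + β', hβ.add hβ', by
      rw [map_add, Polynomial.eval_add, residuePoly_eval hp hp0 γ hβ,
        residuePoly_eval hp hp0 γ' hβ']⟩
  map_smul' c γ := residuePoly_eq hp hp0 _ _ Set.infinite_univ fun t _ => by
    obtain ⟨β, hβ⟩ := exists_solves hp0 γ t
    exact ⟨c • β, hβ.smul c, by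
      simp [residuePoly_eval hp hp0 γ hβ]⟩

/-- The inner coefficients of the residue polynomial of a cycle. -/
def innerCoeffs (hp : ∑ i, e i = p + 1) (hp0 : p ≠ 0) : Cyc e p →ₗ[ℂ] (Fin p → ℂ) :=
  LinearMap.pi fun j => Polynomial.lcoeff ℂ ((j : ℕ) + 1) ∘ₗ residueMap hp hp0

lemma innerCoeffs_apply (hp : ∑ i, e i = p + 1) (hp0 : p ≠ 0) (γ : Cyc e p) (j : Fin p) :
    innerCoeffs hp hp0 γ j = (residuePoly hp hp0 γ).coeff ((j : ℕ) + 1) := rfl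

/-- The differential from `⋀^{p+1} H⁰(X, H) ⊗ H⁰(X, 𝒪)`. -/
abbrev dIn (e : Fin d → ℕ) (p : ℕ) :
    (⋀[ℂ]^(p + 1) (H0H e 1)) ⊗[ℂ] (H0H e (1 - 1)) →ₗ[ℂ] (⋀[ℂ]^p (H0H e 1)) ⊗[ℂ] (H0H e 1) :=
  Koszul.d (mulH (LinearMap.id : H0H e 1 →ₗ[ℂ] H0H e 1) (1 - 1) 1 (add_sub_cancel 1 1)) p

lemma one_apply (y : coords d) : (one e).1 y = 1 := rfl

lemma evT_dIn_one (x : ⋀[ℂ]^(p + 1) (H0H e 1)) (y : coords d) :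
    evT p (ev y) (dIn e p (x ⊗ₜ one e)) = ctr (ev y) (x : ExteriorAlgebra ℂ (H0H e 1)) := by
  rw [evT_d _ p (ev y) (ev y) (ev y) (fun v n => rfl), evT_tmul, ev_apply, one_apply, one_smul]

/-- Global functions on `X` are constant, so an element of `⋀^{p+1} V ⊗ H⁰(𝒪)` amounts to one `β`
and its differential is contraction of that `β` at every point. -/
lemma dIn_range [Nonempty (Fin d)] (γ : (⋀[ℂ]^p (H0H e 1)) ⊗[ℂ] (H0H e 1))
    (h : γ ∈ LinearMap.range (dIn e p)) : ∃ β ∈ ⋀[ℂ]^(p + 1) (H0H e 1), ∀ y : coords d,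
      evT p (ev y) γ = ctr (ev y) β := by
  obtain ⟨θ, rfl⟩ := h
  let y0 : coords d := pt (chart 0) (unitVec (Classical.arbitrary _))
  refine ⟨evT (p + 1) (ev y0) θ, evT_mem _ _, fun y => ?_⟩
  rw [evT_d _ p (ev y) (ev y) (ev y) (fun v n => rfl)]
  have : (ev y : H0H e (1 - 1) →ₗ[ℂ] ℂ) = ev y0 := by
    refine LinearMap.ext fun F => ?_
    obtain ⟨c, hc⟩ := structure_const F
    rw [ev_apply, ev_apply, hc, hc]
  rw [this]

/-- A constant solution exhibits a cycle as a boundary. -/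
lemma mem_range_dIn {γ : (⋀[ℂ]^p (H0H e 1)) ⊗[ℂ] (H0H e 1)} {S : Set ℂ} (hS : S.Infinite)
    {β : ExteriorAlgebra ℂ (H0H e 1)} (h : ∀ t ∈ S, Solves γ t β) :
    γ ∈ LinearMap.range (dIn e p) := by
  obtain ⟨t0, ht0⟩ := hS.nonempty
  refine ⟨(⟨β, (h t0 ht0).1⟩ : ⋀[ℂ]^(p + 1) (H0H e 1)) ⊗ₜ one e, ?_⟩
  rw [← sub_eq_zero]
  refine eq_zero_of_evT (fun y : S × Fin d => coeffAt (chart y.1) y.2)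
    (fun F hF => section_eq_zero_of_chart hS fun t ht i => hF (⟨t, ht⟩, i)) _ ?_
  rintro ⟨⟨t, ht⟩, i⟩
  rw [map_sub, evT_dIn_one, (h t ht).2, sub_self]

/-- A boundary has a solution `β` independent of `t`, so its residue `lowForm β - t ^ (p + 1) *
highForm β` involves only the two outer exponents. -/
lemma innerCoeffs_of_boundary [Nonempty (Fin d)] (hp : ∑ i, e i = p + 1) (hp0 : p ≠ 0)
    (γ : Cyc e p) (h : γ.1 ∈ LinearMap.range (dIn e p)) : innerCoeffs hp hp0 γ = 0 := by
  obtain ⟨β, hβ, h⟩ := dIn_range γ.1 h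
  have hP : residuePoly hp hp0 γ = Polynomial.C (lowForm hp β) -
      Polynomial.X ^ (p + 1) * Polynomial.C (highForm hp β) := by
    refine residuePoly_eq hp hp0 _ _ Set.infinite_univ fun t _ =>
      ⟨β, ⟨hβ, fun i => (h _).symm⟩, ?_⟩
    rw [residue_apply]
    simp only [Polynomial.eval_sub, Polynomial.eval_C, Polynomial.eval_mul, Polynomial.eval_pow,
      Polynomial.eval_X]
  ext j
  have hj := j.2
  rw [innerCoeffs_apply, hP, Polynomial.coeff_sub, Polynomial.coeff_C_succ,
    Polynomial.coeff_mul_C, Polynomial.coeff_X_pow, if_neg (by omega)]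
  simp

open Polynomial in
/-- A polynomial in `t` that is also a polynomial in `t⁻¹` is constant. -/
lemma eval_eq_of_eval_inv {P Q : ℂ[X]} (h : ∀ t : ℂ, t ≠ 0 → P.eval t = Q.eval t⁻¹) (t : ℂ) :
    P.eval t = P.eval 0 := by
  have := degree_lt_of_eval_inv (N := 1) P Q fun t ht => by rw [h t ht, pow_one]
  have h0 : P.natDegree = 0 := natDegree_eq_zero_iff_degree_le_zero.2 (by
    rcases eq_or_ne P 0 with rfl | hP
    · simp
    · rw [degree_eq_natDegree hP] at this ⊢
      exact_mod_cast Nat.lt_one_iff.1 (by exact_mod_cast this) |>.le)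
  rw [eq_C_of_natDegree_eq_zero h0]
  simp

lemma isPolyFamily_ιMulti {V : Type} [AddCommGroup V] [Module ℂ V] {n : ℕ} (v w : Fin n → V) :
    IsPolyFamily fun t : ℂ => ιMulti ℂ n fun k => v k + t • w k := by
  induction n with
  | zero => simpa using IsPolyFamily.const _
  | succ n ih =>
    have h := ih (Matrix.vecTail v) (Matrix.vecTail w)
    have := (h.linear (LinearMap.mulLeft ℂ (ι ℂ (v 0)))).add
      ((h.linear (LinearMap.mulLeft ℂ (ι ℂ (w 0)))).pow_smul 1)
    refine (funext fun t => ?_ : (fun t : ℂ => ιMulti ℂ (n + 1) fun k => v k + t • w k) = _) ▸ this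
    rw [ιMulti_succ_apply, map_add, map_smul, add_mul, smul_mul_assoc, pow_one]
    rfl

lemma ctr_topWedge (hp : ∑ i, e i = p + 1) {t : ℂ} {a : Fin 2 → ℂ} (ha : a 0 * t = a 1)
    (i : Fin d) : ctr (coeffAt (chart t) i) (topWedge hp a) = 0 := by
  rw [topWedge, ctr_ιMulti]
  refine Finset.sum_eq_zero fun k _ => ?_
  rw [Function.comp_apply, ev_apply, mulBy_apply, sec_apply]
  simp [pt, chart, ha]

lemma isPolyFamily_topWedge (hp : ∑ i, e i = p + 1) :
    IsPolyFamily fun t => topWedge hp ![1, t] := by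
  refine (funext fun t => ?_ : (fun t => topWedge hp ![1, t]) = _) ▸
    isPolyFamily_ιMulti (fun k => mulBy (lin ![0, 1]) (wbf hp k))
      (fun k => mulBy (lin ![-1, 0]) (wbf hp k))
  refine congrArg (ιMulti ℂ (p + 1)) (funext fun k => Subtype.ext (funext fun y => ?_))
  change (mulBy (sec ![1, t]) (wbf hp k)).1 y = (mulBy (lin ![0, 1]) (wbf hp k)).1 y +
    t * (mulBy (lin ![-1, 0]) (wbf hp k)).1 y
  simp only [mulBy_apply, sec_apply, lin_apply, Matrix.cons_val_zero, Matrix.cons_val_one]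
  ring

lemma isPolyFamily_topWedge' (hp : ∑ i, e i = p + 1) :
    IsPolyFamily fun t => topWedge hp ![t, 1] := by
  refine (funext fun t => ?_ : (fun t => topWedge hp ![t, 1]) = _) ▸
    isPolyFamily_ιMulti (fun k => mulBy (lin ![-1, 0]) (wbf hp k))
      (fun k => mulBy (lin ![0, 1]) (wbf hp k))
  refine congrArg (ιMulti ℂ (p + 1)) (funext fun k => Subtype.ext (funext fun y => ?_))
  change (mulBy (sec ![t, 1]) (wbf hp k)).1 y = (mulBy (lin ![-1, 0]) (wbf hp k)).1 y +
    t * (mulBy (lin ![0, 1]) (wbf hp k)).1 y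
  simp only [mulBy_apply, sec_apply, lin_apply, Matrix.cons_val_zero, Matrix.cons_val_one]
  ring

lemma Solves.sub_topWedge (hp : ∑ i, e i = p + 1) {γ : (⋀[ℂ]^p (H0H e 1)) ⊗[ℂ] (H0H e 1)} {t : ℂ}
    {β : ExteriorAlgebra ℂ (H0H e 1)} (h : Solves γ t β) (c : ℂ) {a : Fin 2 → ℂ}
    (ha : a 0 * t = a 1) : Solves γ t (β - c • topWedge hp a) :=
  ⟨sub_mem h.1 (Submodule.smul_mem _ _ (topWedge_mem hp a)), fun i => by
    rw [map_sub, map_smul, ctr_topWedge hp ha, smul_zero, sub_zero, h.2]⟩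

/-- Normalise the solutions by `highForm = 0` in the first chart and `lowForm = 0` in the second. If
the residue vanishes, both normalisations hold at once for `t ≠ 0`, so the two families agree there.
The result is polynomial in both `t` and `t⁻¹`, hence constant. -/
lemma exists_const_solution (hp : ∑ i, e i = p + 1) (hp0 : p ≠ 0) (γ : Cyc e p)
    (h : residuePoly hp hp0 γ = 0) : ∃ β, ∀ t, Solves γ.1 t β := by
  obtain ⟨β, h1, h2, h3⟩ := exists_family_chart hp0 γ
  obtain ⟨β', h1', h2', h3'⟩ := exists_family_chart' hp0 γ
  let b : ℂ → ExteriorAlgebra ℂ (H0H e 1) := fun t =>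
    β t - highForm hp (β t) • topWedge hp ![1, t]
  let b' : ℂ → ExteriorAlgebra ℂ (H0H e 1) := fun t =>
    β' t - lowForm hp (β' t) • topWedge hp ![t, 1]
  have hb : IsPolyFamily b := by
    obtain ⟨P, hP⟩ := h1 (highForm hp)
    simp only [b, hP]
    exact h1.sub ((isPolyFamily_topWedge hp).smul P)
  have hb' : IsPolyFamily b' := by
    obtain ⟨P, hP⟩ := h1' (lowForm hp)
    simp only [b', hP]
    exact h1'.sub ((isPolyFamily_topWedge' hp).smul P)
  have hs : ∀ t, Solves γ.1 t (b t) := fun t =>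
    Solves.sub_topWedge hp ⟨h2 t, h3 t⟩ _ (by simp)
  have hs' : ∀ t, t ≠ 0 → Solves γ.1 t (b' t⁻¹) := fun t ht =>
    Solves.sub_topWedge hp ⟨h2' _, h3' t ht⟩ _ (by simp [ht])
  have heq : ∀ t, t ≠ 0 → b t = b' t⁻¹ := by
    intro t ht
    refine (hs t).eq hp (hs' t ht) ?_
    have e1 : highForm hp (b t) = 0 := by
      simp [b, highForm_topWedge]
    have e2 : lowForm hp (b' t⁻¹) = 0 := by
      simp [b', lowForm_topWedge]
    have e3 := residuePoly_eval hp hp0 γ (hs' t ht)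
    rw [h, residue_apply, e2] at e3
    have e4 : highForm hp (b' t⁻¹) = 0 := by simpa [ht] using e3
    rw [e1, e4]
  refine ⟨b 0, fun t => ?_⟩
  have : b t = b 0 := by
    rw [← sub_eq_zero, ← Module.forall_dual_apply_eq_zero_iff ℂ]
    intro l
    obtain ⟨P, hP⟩ := hb l
    obtain ⟨Q, hQ⟩ := hb' l
    rw [map_sub, hP, hP, sub_eq_zero]
    exact eval_eq_of_eval_inv (fun t ht => by rw [← hP, ← hQ, heq t ht]) t
  rw [← this]
  exact hs t

/-- A cycle with vanishing inner residue coefficients is a boundary. -/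
lemma boundary_of_innerCoeffs (hp : ∑ i, e i = p + 1) (hp0 : p ≠ 0) (γ : Cyc e p)
    (h : innerCoeffs hp hp0 γ = 0) : γ.1 ∈ LinearMap.range (dIn e p) := by
  set D := residuePoly hp hp0 γ with hD
  have hDeq : D = Polynomial.C (D.coeff 0) +
      Polynomial.C (D.coeff (p + 1)) * Polynomial.X ^ (p + 1) := by
    ext n
    rw [Polynomial.coeff_add, Polynomial.coeff_C, Polynomial.coeff_C_mul, Polynomial.coeff_X_pow]
    rcases Nat.eq_zero_or_pos n with rfl | hn
    · simp
    · rw [if_neg hn.ne', zero_add]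
      by_cases hnp : n = p + 1
      · simp [hnp]
      rw [if_neg hnp, mul_zero]
      by_cases hlt : n < p + 1
      · have := congrFun h ⟨n - 1, by omega⟩
        rw [innerCoeffs_apply, ← hD] at this
        simpa [Nat.sub_add_cancel hn] using this
      · refine Polynomial.coeff_eq_zero_of_degree_lt
          (lt_of_lt_of_le (residuePoly_degree hp hp0 γ) ?_)
        exact_mod_cast (by omega : p + 2 ≤ n)
  -- a constant element with the same residue polynomial
  let A := topWedge hp ![1, 0]
  let B := topWedge hp ![0, 1]
  let β0 : ⋀[ℂ]^(p + 1) (H0H e 1) := ⟨D.coeff 0 • B - D.coeff (p + 1) • A,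
    sub_mem (Submodule.smul_mem _ _ (topWedge_mem hp _))
      (Submodule.smul_mem _ _ (topWedge_mem hp _))⟩
  have hcyc : dIn e p (β0 ⊗ₜ one e) ∈ Cyc e p := by
    obtain ⟨q, rfl⟩ := Nat.exists_eq_succ_of_ne_zero hp0
    exact LinearMap.congr_fun (d_comp_d _ (mulH (LinearMap.id : H0H e 1 →ₗ[ℂ] H0H e 1) 1 (1 + 1)
      (add_comm 1 1)) (fun v w n => Subtype.ext (mul_left_comm v.1 w.1 n.1)) q) (β0 ⊗ₜ one e)
  let γ0 : Cyc e p := ⟨_, hcyc⟩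
  -- The residues of `B` and `A` are `1` and `-t ^ (p + 1)`, which explains the coefficients in
  -- `β0`.
  have hres : residuePoly hp hp0 γ0 = D := by
    refine residuePoly_eq hp hp0 _ _ Set.infinite_univ fun t _ =>
      ⟨β0, ⟨β0.2, fun i => (evT_dIn_one β0 _).symm⟩, ?_⟩
    rw [hDeq]
    simp only [β0, map_sub, map_smul, residue_topWedge, A, B]
    simp
  have hsub : residuePoly hp hp0 (γ + (-1 : ℂ) • γ0) = 0 := by
    change residueMap hp hp0 (γ + (-1 : ℂ) • γ0) = 0
    rw [map_add, map_smul]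
    change D + (-1 : ℂ) • residuePoly hp hp0 γ0 = 0
    rw [hres]
    simp
  obtain ⟨β, hβ⟩ := exists_const_solution hp hp0 _ hsub
  have h1 := mem_range_dIn (S := Set.univ) Set.infinite_univ fun t _ => hβ t
  have h2 : γ0.1 ∈ LinearMap.range (dIn e p) := ⟨β0 ⊗ₜ one e, rfl⟩
  have h3 := add_mem h1 h2
  have h4 : (γ + (-1 : ℂ) • γ0).1 + γ0.1 = γ.1 := by
    change γ.1 + (-1 : ℂ) • γ0.1 + γ0.1 = γ.1
    module
  rwa [h4] at h3

end Scroll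

end

/-! ### Coordinates on the last syzygy space and the image of `δ_s` -/

noncomputable section

namespace Koszul

variable {V N₀ N₁ N₂ M : Type} [AddCommGroup V] [Module ℂ V] [AddCommGroup N₀] [Module ℂ N₀]
  [AddCommGroup N₁] [Module ℂ N₁] [AddCommGroup N₂] [Module ℂ N₂] [AddCommGroup M] [Module ℂ M]

lemma toCohomology_surjective (μ₀ : V →ₗ[ℂ] N₀ →ₗ[ℂ] N₁) (μ₁ : V →ₗ[ℂ] N₁ →ₗ[ℂ] N₂) (p : ℕ) :
    Function.Surjective (toCohomology μ₀ μ₁ p) :=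
  Submodule.mkQ_surjective _

/-- A linear map on cohomology from a linear map on cycles that vanishes on boundaries. -/
def liftCohomology {μ₀ : V →ₗ[ℂ] N₀ →ₗ[ℂ] N₁} {μ₁ : V →ₗ[ℂ] N₁ →ₗ[ℂ] N₂} {p : ℕ}
    (g : cycles μ₁ p →ₗ[ℂ] M)
    (hg : ∀ γ : cycles μ₁ p, γ.1 ∈ LinearMap.range (d μ₀ p) → g γ = 0) :
    cohomology μ₀ μ₁ p →ₗ[ℂ] M :=
  Submodule.liftQ (boundaries μ₀ μ₁ p) g hg

end Koszul

namespace Scroll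

open ProjSpace ExteriorAlgebra Koszul

variable {d : ℕ} {e : Fin d → ℕ} {p : ℕ}

variable (e p) in
/-- The class in `K_{p,1}(X, H)` of a cycle. -/
abbrev cls : Cyc e p →ₗ[ℂ] K e p 1 :=
  Koszul.toCohomology (mulH (LinearMap.id : H0H e 1 →ₗ[ℂ] H0H e 1) (1 - 1) 1 (add_sub_cancel 1 1))
    (mulH (LinearMap.id : H0H e 1 →ₗ[ℂ] H0H e 1) 1 (1 + 1) (add_comm 1 1)) p

lemma cls_surjective : Function.Surjective (cls e p) := toCohomology_surjective _ _ _

/-- Coordinates on the last syzygy space. -/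
def syzygyCoords [Nonempty (Fin d)] (hp : ∑ i, e i = p + 1) (hp0 : p ≠ 0) :
    K e p 1 →ₗ[ℂ] (Fin p → ℂ) :=
  liftCohomology (innerCoeffs hp hp0) fun γ hγ => innerCoeffs_of_boundary hp hp0 γ hγ

lemma syzygyCoords_cls [Nonempty (Fin d)] (hp : ∑ i, e i = p + 1) (hp0 : p ≠ 0) (γ : Cyc e p) :
    syzygyCoords hp hp0 (cls e p γ) = innerCoeffs hp hp0 γ := rfl

lemma syzygyCoords_injective [Nonempty (Fin d)] (hp : ∑ i, e i = p + 1) (hp0 : p ≠ 0) :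
    Function.Injective (syzygyCoords hp hp0) := by
  rw [injective_iff_map_eq_zero]
  intro α hα
  obtain ⟨γ, rfl⟩ := cls_surjective α
  exact (toCohomology_eq_zero _ _ p γ).2 (boundary_of_innerCoeffs hp hp0 γ hα)

/-- Each summand on either side carries the same product `s wᵢ τ`. Where `s ≠ 0`, this exhibits the
cycle locally as the contraction of `(τ / s) · ⋀ s wᵢ`. -/
lemma evT_preDelta (a : Fin 2 → ℂ) (w : Fin (p + 1) → H0HsubR e)
    (τ : H0R e) (y : coords d) :
    (sec a : H0R e).1 y • evT p (ev y) (preDelta (sec a) p (exteriorPower.ιMulti ℂ (p + 1) w ⊗ₜ τ)) =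
      τ.1 y • ctr (ev y) (ιMulti ℂ (p + 1) (mulBy (sec a) ∘ w)) := by
  rw [preDelta, LinearMap.comp_apply, d_ιMulti_tmul, map_sum, map_sum, ctr_ιMulti, Finset.smul_sum,
    Finset.smul_sum]
  refine Finset.sum_congr rfl fun i _ => ?_
  rw [map_zsmul, map_zsmul, TensorProduct.map_tmul, evT_tmul, exteriorPower.map_apply_ιMulti,
    exteriorPower.ιMulti_apply_coe, smul_comm, smul_comm (τ.1 y), smul_smul, smul_smul]
  congr 2
  change (sec a : H0R e).1 y * ((w i).1 y * τ.1 y) = τ.1 y * ((w i).1 y * (sec a : H0R e).1 y)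
  ring

/-- The class of the image of `w₁ ∧ ⋯ ∧ w_f ⊗ τ`. -/
def deltaCycle (hp : ∑ i, e i = p + 1) (a : Fin 2 → ℂ) (τ : H0R e) : Cyc e p :=
  ⟨preDelta (sec a) p (exteriorPower.ιMulti ℂ (p + 1) (wbf hp) ⊗ₜ τ), preDelta_mem_ker _ _ _⟩

lemma infinite_ne (a : Fin 2 → ℂ) (ha : a ≠ 0) : {t : ℂ | a 0 * t - a 1 ≠ 0}.Infinite := by
  refine Set.Infinite.mono (s := {a 1 / a 0}ᶜ) ?_
    (Set.Finite.infinite_compl (Set.finite_singleton _))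
  intro t ht h
  by_cases h0 : a 0 = 0
  · refine ha (funext fun i => ?_)
    fin_cases i
    · exact h0
    · simpa [h0] using h
  · exact ht (by
      rw [Set.mem_singleton_iff, eq_div_iff h0]
      linear_combination h)

lemma solves_deltaCycle (hp : ∑ i, e i = p + 1) (a τ : Fin 2 → ℂ) {t : ℂ}
    (ht : a 0 * t - a 1 ≠ 0) : Solves (deltaCycle hp a (lin τ)).1 t
      (((τ 0 + τ 1 * t) / (a 0 * t - a 1)) • topWedge hp a) := by
  refine ⟨Submodule.smul_mem _ _ (topWedge_mem hp a), fun i => ?_⟩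
  have h := evT_preDelta a (wbf hp) (lin τ) (pt (chart t) (unitVec i))
  have h1 : (sec a : H0R e).1 (pt (chart t) (unitVec i)) = a 0 * t - a 1 := by
    rw [sec_apply]
    simp [pt, chart]
  have h2 : (lin τ : H0R e).1 (pt (chart t) (unitVec i)) = τ 0 + τ 1 * t := by
    rw [lin_apply]
    simp [pt, chart]
  rw [h1, h2] at h
  refine smul_right_injective _ ht ?_
  change _ = (a 0 * t - a 1) • evT p (coeffAt (chart t) i) _
  rw [deltaCycle, h, map_smul]
  beta_reduce
  rw [smul_smul, mul_div_cancel₀ _ ht]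
  rfl

/-- The vector of monomials of degree `p - 1` in `a`. -/
def monoVec (p : ℕ) (a : Fin 2 → ℂ) : Fin p → ℂ := fun j => a 0 ^ (j : ℕ) * a 1 ^ (p - 1 - (j : ℕ))

-- The local solution has residue `τ(t) (a₁^(p+1) - (a₀ t)^(p+1)) / (a₀ t - a₁)`, minus `τ` times a
-- geometric sum. In the coefficient of `t ^ (j + 1)` the two terms of `τ` combine into the common
-- factor `τ(a)`, so up to scalar the class depends only on `a`.
open Polynomial in
lemma innerCoeffs_deltaCycle (hp : ∑ i, e i = p + 1) (hp0 : p ≠ 0) (a τ : Fin 2 → ℂ)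
    (ha : a ≠ 0) :
    innerCoeffs hp hp0 (deltaCycle hp a (lin τ)) = -(τ 0 * a 0 + τ 1 * a 1) • monoVec p a := by
  have hD : residuePoly hp hp0 (deltaCycle hp a (lin τ)) =
      -((C (τ 0) + C (τ 1) * X) *
        ∑ k ∈ Finset.range (p + 1), C (a 0 ^ k * a 1 ^ (p - k)) * X ^ k) := by
    refine residuePoly_eq hp hp0 _ _ (infinite_ne a ha) fun t ht =>
      ⟨_, solves_deltaCycle hp a τ ht, ?_⟩
    have ht : a 0 * t - a 1 ≠ 0 := ht
    have hg := (Commute.all (a 0 * t) (a 1)).geom_sum₂_mul (p + 1)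
    have hg' : (∑ k ∈ Finset.range (p + 1), C (a 0 ^ k * a 1 ^ (p - k)) * X ^ k).eval t =
        ∑ k ∈ Finset.range (p + 1), (a 0 * t) ^ k * a 1 ^ (p + 1 - 1 - k) := by
      rw [eval_finsetSum]
      refine Finset.sum_congr rfl fun k _ => ?_
      simp only [eval_mul, eval_C, eval_pow, eval_X, mul_pow, Nat.add_sub_cancel]
      ring
    rw [map_smul, residue_topWedge, eval_neg, eval_mul, hg', smul_eq_mul]
    simp only [eval_add, eval_mul, eval_C, eval_X]
    rw [mul_pow] at hg
    rw [div_mul_eq_mul_div, div_eq_iff ht]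
    linear_combination (τ 0 + τ 1 * t) * hg
  ext j
  have hj := j.2
  rw [innerCoeffs_apply, hD]
  simp only [coeff_neg, add_mul, coeff_add, mul_assoc, coeff_C_mul, coeff_X_mul,
    finsetSum_coeff, coeff_X_pow, mul_ite, mul_one, mul_zero, Finset.sum_ite_eq, Finset.mem_range]
  rw [if_pos (by omega), if_pos (by omega)]
  simp only [monoVec, Pi.smul_apply, smul_eq_mul]
  rw [show p - ((j : ℕ) + 1) = p - 1 - j by omega, show p - (j : ℕ) = (p - 1 - j) + 1 by omega]
  ring

/-- The points `(i : 1)` for `i < p` are distinct, so their monomial vectors form an invertible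
Vandermonde matrix. -/
lemma vec_eq_smul_monoVec (x : Fin p → ℂ) : x ∈ Submodule.span ℂ
    (Set.range fun i : Fin p => monoVec p ![((i : ℕ) : ℂ), 1]) := by
  let A : Matrix (Fin p) (Fin p) ℂ := Matrix.vandermonde fun i => ((i : ℕ) : ℂ)
  have hA : IsUnit A.det := isUnit_iff_ne_zero.2 (Matrix.det_vandermonde_ne_zero_iff.2
    fun i j hij => Fin.ext (by exact_mod_cast hij))
  have : x = ∑ i, Matrix.vecMul x A⁻¹ i • monoVec p ![((i : ℕ) : ℂ), 1] := by
    have h : Matrix.vecMul (Matrix.vecMul x A⁻¹) A = x := by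
      rw [Matrix.vecMul_vecMul, Matrix.nonsing_inv_mul _ hA, Matrix.vecMul_one]
    conv_lhs => rw [← h]
    ext j
    simp [Matrix.vecMul, dotProduct, monoVec, A, Matrix.vandermonde_apply]
  rw [this]
  exact Submodule.sum_mem _ fun i _ => Submodule.smul_mem _ _ (Submodule.subset_span ⟨i, rfl⟩)

/-- Since `a ≠ 0`, some linear form `τ` takes the value `-1` at `a`, which makes the scalar in front
of the monomial vector equal to `1`. -/
lemma exists_syzygyCoords_eq [Nonempty (Fin d)] (hp : ∑ i, e i = p + 1) (hp0 : p ≠ 0)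
    {a : Fin 2 → ℂ} (ha : a ≠ 0) :
    ∃ τ : H0R e, syzygyCoords hp hp0 (cls e p (deltaCycle hp a τ)) = monoVec p a := by
  have : ∃ τ : Fin 2 → ℂ, τ 0 * a 0 + τ 1 * a 1 = -1 := by
    by_cases h0 : a 0 = 0
    · have h1 : a 1 ≠ 0 := fun h1 => ha (funext fun i => by fin_cases i; exacts [h0, h1])
      exact ⟨![0, -(a 1)⁻¹], by simp [h1]⟩
    · exact ⟨![-(a 0)⁻¹, 0], by simp [h0]⟩
  obtain ⟨τ, hτ⟩ := this
  exact ⟨lin τ, by rw [syzygyCoords_cls, innerCoeffs_deltaCycle hp hp0 a τ ha, hτ]; simp⟩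

lemma syzygyCoords_surjective [Nonempty (Fin d)] (hp : ∑ i, e i = p + 1) (hp0 : p ≠ 0) :
    Function.Surjective (syzygyCoords hp hp0) := by
  rw [← LinearMap.range_eq_top, eq_top_iff]
  rintro x -
  refine Submodule.span_le.2 ?_ (vec_eq_smul_monoVec x)
  rintro _ ⟨i, rfl⟩
  obtain ⟨τ, hτ⟩ := exists_syzygyCoords_eq hp hp0 (vec_ne_zero_right ((i : ℕ) : ℂ))
  exact ⟨_, hτ⟩

/-- The last syzygy space has dimension `f - 1`. -/
def syzygyEquiv [Nonempty (Fin d)] (hp : ∑ i, e i = p + 1) (hp0 : p ≠ 0) :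
    K e p 1 ≃ₗ[ℂ] (Fin p → ℂ) :=
  LinearEquiv.ofBijective (syzygyCoords hp hp0)
    ⟨syzygyCoords_injective hp hp0, syzygyCoords_surjective hp hp0⟩

/-- The generator of the image of `δₛ`, for `s` the section vanishing at `a`. -/
def lastSyzygy [Nonempty (Fin d)] (hp : ∑ i, e i = p + 1) (hp0 : p ≠ 0) (a : Fin 2 → ℂ) : K e p 1 :=
  (syzygyEquiv hp hp0).symm (monoVec p a)

lemma monoVec_ne_zero (hp0 : p ≠ 0) {a : Fin 2 → ℂ} (ha : a ≠ 0) : monoVec p a ≠ 0 := by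
  intro h
  refine ha (funext fun i => ?_)
  fin_cases i
  · have := congrFun h ⟨p - 1, by omega⟩
    simp only [monoVec, Nat.sub_self, pow_zero, mul_one, Pi.zero_apply] at this
    exact eq_zero_of_pow_eq_zero this
  · have := congrFun h ⟨0, by omega⟩
    simp only [monoVec, Nat.sub_zero, pow_zero, one_mul, Pi.zero_apply] at this
    exact eq_zero_of_pow_eq_zero this

lemma cls_deltaCycle [Nonempty (Fin d)] (hp : ∑ i, e i = p + 1) (hp0 : p ≠ 0)
    {a : Fin 2 → ℂ} (ha : a ≠ 0)
    (τ : H0R e) : ∃ c : ℂ, cls e p (deltaCycle hp a τ) = c • lastSyzygy hp hp0 a := by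
  obtain ⟨τ, rfl⟩ := lin_surjective τ
  refine ⟨-(τ 0 * a 0 + τ 1 * a 1), syzygyCoords_injective hp hp0 ?_⟩
  have : syzygyCoords hp hp0 (lastSyzygy hp hp0 a) = monoVec p a :=
    (syzygyEquiv hp hp0).apply_symm_apply _
  rw [syzygyCoords_cls, innerCoeffs_deltaCycle hp hp0 a τ ha, map_smul, this]

/-- The image of `δₛ` is the line spanned by the generator. -/
lemma range_delta [Nonempty (Fin d)] (hp : ∑ i, e i = p + 1) (hp0 : p ≠ 0)
    {a : Fin 2 → ℂ} (ha : a ≠ 0) :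
    LinearMap.range (delta (sec a : H0R e) p) = Submodule.span ℂ {lastSyzygy hp hp0 a} := by
  apply le_antisymm
  · rintro _ ⟨x, rfl⟩
    induction x using TensorProduct.induction_on with
    | zero => simp
    | add x y hx hy => rw [map_add]; exact add_mem hx hy
    | tmul x τ =>
      obtain ⟨τ, rfl⟩ := Submodule.Quotient.mk_surjective _ τ
      -- The space `⋀^f H⁰(X, H - R)` is a line, so only the wedge of the basis tensored with `τ`
      -- has to be considered.
      have hx : x = detFunctional (wbf hp) (x : ExteriorAlgebra ℂ (H0HsubR e)) •
          exteriorPower.ιMulti ℂ (p + 1) (wbf hp) :=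
        Subtype.ext (eq_detFunctional_smul (wbf hp) x.2)
      obtain ⟨c, hc⟩ := cls_deltaCycle hp hp0 ha τ
      rw [hx, ← TensorProduct.smul_tmul', map_smul, delta_tmul]
      refine Submodule.smul_mem _ _ (Submodule.mem_span_singleton.2 ⟨c, ?_⟩)
      rw [← hc]
      rfl
  · rw [Submodule.span_singleton_le_iff_mem]
    obtain ⟨τ, hτ⟩ := exists_syzygyCoords_eq hp hp0 ha
    refine ⟨exteriorPower.ιMulti ℂ (p + 1) (wbf hp) ⊗ₜ Submodule.Quotient.mk τ, ?_⟩
    rw [delta_tmul]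
    exact syzygyCoords_injective hp hp0
      (hτ.trans ((syzygyEquiv hp hp0).apply_symm_apply _).symm)

end Scroll

end

/-! ### Syzygies coming from subspaces, and the lower bound on the rank -/

noncomputable section

namespace Koszul

variable {V N : Type} [AddCommGroup V] [Module ℂ V] [AddCommGroup N] [Module ℂ N] {n : ℕ}

/-- Apply a functional to the first factor of `⋀ⁿ V ⊗ N`. -/
def evL (l : Module.Dual ℂ (ExteriorAlgebra ℂ V)) : (⋀[ℂ]^n V) ⊗[ℂ] N →ₗ[ℂ] N :=
  TensorProduct.lift (LinearMap.lsmul ℂ N ∘ₗ l ∘ₗ (⋀[ℂ]^n V).subtype)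

lemma apply_evL (l : Module.Dual ℂ (ExteriorAlgebra ℂ V)) (ξ : Module.Dual ℂ N)
    (x : (⋀[ℂ]^n V) ⊗[ℂ] N) : ξ (evL l x) = l (evT n ξ x) := by
  induction x using TensorProduct.induction_on with
  | zero => simp
  | tmul x a => simp [evL, mul_comm]
  | add x y hx hy => simp only [map_add, hx, hy]

variable {V' N₀ N₁ N₂ : Type} [AddCommGroup V'] [Module ℂ V'] [AddCommGroup N₀] [Module ℂ N₀]
  [AddCommGroup N₁] [Module ℂ N₁] [AddCommGroup N₂] [Module ℂ N₂]

lemma map_mem_cycles {μ₁ : V →ₗ[ℂ] N₁ →ₗ[ℂ] N₂} {μ₁' : V' →ₗ[ℂ] N₁ →ₗ[ℂ] N₂} (g : V →ₗ[ℂ] V')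
    (h₁ : ∀ v n, μ₁' (g v) n = μ₁ v n) (γ : cycles μ₁ n) :
    TensorProduct.map (exteriorPower.map n g) LinearMap.id γ.1 ∈ cycles μ₁' n := by
  have h := LinearMap.congr_fun
    (dOut_natural (μ := μ₁) (μ' := μ₁') g LinearMap.id LinearMap.id h₁ n) γ.1
  rw [LinearMap.comp_apply, LinearMap.comp_apply, LinearMap.mem_ker.1 γ.2, map_zero] at h
  exact h

lemma cohomologyMap_toCohomology {μ₀ : V →ₗ[ℂ] N₀ →ₗ[ℂ] N₁} {μ₁ : V →ₗ[ℂ] N₁ →ₗ[ℂ] N₂}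
    {μ₀' : V' →ₗ[ℂ] N₀ →ₗ[ℂ] N₁} {μ₁' : V' →ₗ[ℂ] N₁ →ₗ[ℂ] N₂} (g : V →ₗ[ℂ] V')
    (h₀ : ∀ v n, μ₀' (g v) n = μ₀ v n) (h₁ : ∀ v n, μ₁' (g v) n = μ₁ v n) (γ : cycles μ₁ n) :
    cohomologyMap g h₀ h₁ n (toCohomology μ₀ μ₁ n γ) =
      toCohomology μ₀' μ₁' n ⟨_, map_mem_cycles g h₁ γ⟩ := rfl

/-- Koszul cohomology is functorial in the first space. -/
lemma cohomologyMap_comp {V'' : Type} [AddCommGroup V''] [Module ℂ V'']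
    {μ₀ : V →ₗ[ℂ] N₀ →ₗ[ℂ] N₁} {μ₁ : V →ₗ[ℂ] N₁ →ₗ[ℂ] N₂}
    {μ₀' : V' →ₗ[ℂ] N₀ →ₗ[ℂ] N₁} {μ₁' : V' →ₗ[ℂ] N₁ →ₗ[ℂ] N₂}
    {μ₀'' : V'' →ₗ[ℂ] N₀ →ₗ[ℂ] N₁} {μ₁'' : V'' →ₗ[ℂ] N₁ →ₗ[ℂ] N₂}
    (g : V →ₗ[ℂ] V') (g' : V' →ₗ[ℂ] V'') (g'' : V →ₗ[ℂ] V'') (hg : g' ∘ₗ g = g'')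
    (h₀ : ∀ v n, μ₀' (g v) n = μ₀ v n) (h₁ : ∀ v n, μ₁' (g v) n = μ₁ v n)
    (h₀' : ∀ v n, μ₀'' (g' v) n = μ₀' v n) (h₁' : ∀ v n, μ₁'' (g' v) n = μ₁' v n)
    (h₀'' : ∀ v n, μ₀'' (g'' v) n = μ₀ v n) (h₁'' : ∀ v n, μ₁'' (g'' v) n = μ₁ v n) :
    cohomologyMap g'' h₀'' h₁'' n = cohomologyMap g' h₀' h₁' n ∘ₗ cohomologyMap g h₀ h₁ n := by
  refine LinearMap.ext fun κ => ?_
  obtain ⟨γ, rfl⟩ := toCohomology_surjective _ _ _ κ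
  rw [LinearMap.comp_apply, cohomologyMap_toCohomology, cohomologyMap_toCohomology,
    cohomologyMap_toCohomology]
  refine congrArg (toCohomology μ₀'' μ₁'' n) (Subtype.ext ?_)
  simp only
  rw [← LinearMap.comp_apply, ← TensorProduct.map_comp, ← exteriorPower.map_comp, hg,
    LinearMap.id_comp]

end Koszul

namespace Scroll

open ProjSpace ExteriorAlgebra Koszul

variable {d : ℕ} {e : Fin d → ℕ} {p : ℕ}

open Polynomial in
lemma exists_coeff_polynomial (F : H0H e 1) (i : Fin d) :
    ∃ P : ℂ[X], P.natDegree ≤ e i ∧ ∀ t, coeffAt (chart t) i F = P.eval t := by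
  refine ⟨∑ k : Fin (e i + 1), C ((vb e).repr F ⟨i, k⟩) * X ^ (k : ℕ), ?_, fun t => ?_⟩
  · refine natDegree_sum_le_of_forall_le _ _ fun k _ => ?_
    exact (natDegree_C_mul_X_pow_le _ _).trans (Nat.lt_succ_iff.1 k.2)
  · conv_lhs => rw [← (vb e).sum_repr F]
    rw [map_sum, Fintype.sum_sigma, Finset.sum_eq_single i]
    · simp [-ev_apply, coeffAt_chart_vb, eval_finsetSum]
    · intro j _ hj
      simp [-ev_apply, coeffAt_chart_vb, hj]
    · simp

lemma eval_pairVec {b : ℤ} (F : sections e 1 b) (x : cone (Fin 2 → ℂ)) {i j : Fin d}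
    (hij : i ≠ j) : F.1 (pt x (pairVec hij)) = coeffAt x i F + coeffAt x j F :=
  LinearMap.congr_fun (ev_pairVec x hij) F

/-- A family of sections of `H` that is proportional, with a common ratio, to the family of all
sections of `H - R` is the family of multiples of a section of `R`. -/
lemma exists_ratio (hp : ∑ i, e i = p + 1) (hp0 : p ≠ 0) (T : H0HsubR e → H0H e 1) {S : Set ℂ}
    (hS : S.Infinite)
    (hT : ∀ t ∈ S, ∀ z w w', (T w).1 (pt (chart t) z) * w'.1 (pt (chart t) z) =
      (T w').1 (pt (chart t) z) * w.1 (pt (chart t) z)) :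
    ∃ (i₀ : Fin d) (_ : 0 < e i₀) (τ : Fin 2 → ℂ), ∀ t ∈ S, ∀ w i,
      coeffAt (chart t) i (T w) = (τ 0 + τ 1 * t) * coeffAt (chart t) i w := by
  have h1 : ∀ t ∈ S, ∀ i w w', coeffAt (chart t) i (T w) * coeffAt (chart t) i w' =
      coeffAt (chart t) i (T w') * coeffAt (chart t) i w := fun t ht i w w' => hT t ht _ w w'
  -- Over a fixed `t` the hypothesis is an identity of quadratic forms in `z`; this is the
  -- coefficient of `zᵢ zⱼ`, and `h1` that of `zᵢ²`.
  have h2 : ∀ t ∈ S, ∀ i j, i ≠ j → ∀ w w',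
      coeffAt (chart t) i (T w) * coeffAt (chart t) j w' +
        coeffAt (chart t) j (T w) * coeffAt (chart t) i w' =
      coeffAt (chart t) i (T w') * coeffAt (chart t) j w +
        coeffAt (chart t) j (T w') * coeffAt (chart t) i w := by
    intro t ht i j hij w w'
    have := hT t ht (pairVec hij) w w'
    rw [eval_pairVec, eval_pairVec, eval_pairVec, eval_pairVec] at this
    linear_combination this - h1 t ht i w w' - h1 t ht j w w'
  obtain ⟨i₀, hi₀⟩ : ∃ i, 0 < e i := by
    by_contra! h
    have : ∑ i, e i = 0 := Finset.sum_eq_zero fun i _ => Nat.le_zero.1 (h i)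
    omega
  let w₀ := wb e ⟨i₀, ⟨0, hi₀⟩⟩
  let w₁ := wb e ⟨i₀, ⟨e i₀ - 1, by omega⟩⟩
  have hw₀ : ∀ t i, coeffAt (chart t) i w₀ = if i₀ = i then 1 else 0 := fun t i => by
    rw [coeffAt_chart_wb]; simp
  have hw₁ : ∀ t i, coeffAt (chart t) i w₁ = if i₀ = i then t ^ (e i₀ - 1) else 0 := fun t i => by
    rw [coeffAt_chart_wb]
  -- The image of `w₀` must be a multiple of `z_{i₀}`. If another `eⱼ` is positive, comparison with
  -- `zⱼ x₀^(eⱼ-1)` shows it. Otherwise `e i₀ = p + 1 ≥ 2` and the coefficients of `z_l` are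
  -- constants; comparison with `w₁` gives `t ^ (e i₀ - 1) P = Q` between constants, so `P = 0`.
  have hoff : ∀ t ∈ S, ∀ l, l ≠ i₀ → coeffAt (chart t) l (T w₀) = 0 := by
    by_cases hA : ∃ j, j ≠ i₀ ∧ 0 < e j
    · obtain ⟨j, hj, hj0⟩ := hA
      let w' := wb e ⟨j, ⟨0, hj0⟩⟩
      have hw' : ∀ t i, coeffAt (chart t) i w' = if j = i then 1 else 0 := fun t i => by
        rw [coeffAt_chart_wb]; simp
      intro t ht l hl
      have hjj := h1 t ht j w₀ w'
      rw [hw₀, hw', if_pos rfl, if_neg hj.symm, mul_one, mul_zero] at hjj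
      by_cases hlj : l = j
      · rw [hlj, hjj]
      · have := h2 t ht j l (Ne.symm hlj) w₀ w'
        rw [hw₀, hw₀, hw', hw', if_pos rfl, if_neg hj.symm, if_neg hl.symm,
          if_neg (Ne.symm hlj)] at this
        simpa [-ev_apply] using this
    · push Not at hA
      have hei : 2 ≤ e i₀ := by
        rw [Finset.sum_eq_single i₀ (fun j _ hj => Nat.le_zero.1 (hA j hj)) (by simp)] at hp
        omega
      intro t ht l hl
      have hel : e l = 0 := Nat.le_zero.1 (hA l hl)
      obtain ⟨P, hP, hPe⟩ := exists_coeff_polynomial (T w₀) l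
      obtain ⟨Q, hQ, hQe⟩ := exists_coeff_polynomial (T w₁) l
      rw [hel, Nat.le_zero] at hP hQ
      have hid : Polynomial.X ^ (e i₀ - 1) * P = Q := by
        refine Polynomial.eq_of_infinite_eval_eq _ _ (hS.mono fun t ht => ?_)
        have := h2 t ht i₀ l hl.symm w₀ w₁
        rw [hw₀, hw₀, hw₁, hw₁, if_pos rfl, if_pos rfl, if_neg hl.symm, if_neg hl.symm, hPe,
          hQe] at this
        rw [Set.mem_ofPred_eq, Polynomial.eval_mul, Polynomial.eval_pow, Polynomial.eval_X]
        linear_combination this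
      have hP0 : P = 0 := by
        by_contra hne
        have := congrArg Polynomial.natDegree hid
        rw [Polynomial.natDegree_X_pow_mul _ hne, hP, hQ] at this
        omega
      rw [hPe, hP0, Polynomial.eval_zero]
  obtain ⟨P, -, hPe⟩ := exists_coeff_polynomial (T w₀) i₀
  -- The ratio satisfies `t ^ (e i₀ - 1) P = Q` with `deg Q ≤ e i₀`, so it is at most linear in `t`:
  -- a section of `R`.
  have hP1 : P.natDegree ≤ 1 := by
    obtain ⟨Q, hQ, hQe⟩ := exists_coeff_polynomial (T w₁) i₀
    have hid : Polynomial.X ^ (e i₀ - 1) * P = Q := by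
      refine Polynomial.eq_of_infinite_eval_eq _ _ (hS.mono fun t ht => ?_)
      have := h1 t ht i₀ w₀ w₁
      rw [hw₀, hw₁, if_pos rfl, if_pos rfl, hPe, hQe] at this
      rw [Set.mem_ofPred_eq, Polynomial.eval_mul, Polynomial.eval_pow, Polynomial.eval_X]
      linear_combination this
    by_cases hne : P = 0
    · simp [hne]
    · rw [← hid, Polynomial.natDegree_X_pow_mul _ hne] at hQ
      omega
  refine ⟨i₀, hi₀, ![P.coeff 0, P.coeff 1], fun t ht w i => ?_⟩
  have hPt : P.eval t = P.coeff 0 + P.coeff 1 * t := by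
    conv_lhs => rw [Polynomial.eq_X_add_C_of_natDegree_le_one hP1]
    simp
    ring
  simp only [Matrix.cons_val_zero, Matrix.cons_val_one, ← hPt, ← hPe]
  rcases eq_or_ne i i₀ with rfl | hi
  · have := h1 t ht i w w₀
    rwa [hw₀, if_pos rfl, mul_one] at this
  · have := h2 t ht i₀ i hi.symm w w₀
    rwa [hw₀, hw₀, if_pos rfl, if_neg hi.symm, hoff t ht i hi, mul_zero, zero_add, mul_one,
      zero_mul, add_zero] at this

lemma mulBy_injective {a : Fin 2 → ℂ} (ha : a ≠ 0) :
    Function.Injective (mulBy (sec a : H0R e)) := by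
  rw [injective_iff_map_eq_zero]
  intro w hw
  rw [← (wb e).sum_repr w] at hw ⊢
  have key : ∀ i, (fun k : Fin (e i) => (wb e).repr w ⟨i, k⟩) = 0 := by
    intro i
    refine coeff_eq_zero_of_sum_pow _ _ (infinite_ne a ha) fun t ht => ?_
    have h := congrArg (coeffAt (chart t) i) hw
    rw [ev_apply, mulBy_apply, sec_apply] at h
    have h' : coeffAt (chart t) i (∑ j, (wb e).repr w j • wb e j) = 0 := by
      refine (mul_eq_zero.1 h).resolve_right ?_
      simpa [pt, chart] using ht
    rw [map_sum, Fintype.sum_sigma, Finset.sum_eq_single i] at h'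
    · simpa [-ev_apply, coeffAt_chart_wb] using h'
    · intro j _ hj
      simp [-ev_apply, coeffAt_chart_wb, hj]
    · simp
  refine Finset.sum_eq_zero ?_
  rintro ⟨i, k⟩ -
  rw [show (wb e).repr w ⟨i, k⟩ = 0 from congrFun (key i) k, zero_smul]

lemma ev_comp_mulBy (s : H0R e) (y : coords d) :
    (ev y : H0H e 1 →ₗ[ℂ] ℂ) ∘ₗ mulBy s = s.1 y • (ev y : H0HsubR e →ₗ[ℂ] ℂ) := by
  ext w
  exact mul_comm _ _

variable {V : Type} [AddCommGroup V] [Module ℂ V]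

/-- The cycles defining `K_{p,1}(X, H; V)`. -/
abbrev CycV (j : V →ₗ[ℂ] H0H e 1) (p : ℕ) : Submodule ℂ ((⋀[ℂ]^p V) ⊗[ℂ] (H0H e 1)) :=
  Koszul.cycles (mulH j 1 (1 + 1) (add_comm 1 1)) p

/-- The natural map `K_{p,1}(X, H; V) → K_{p,1}(X, H)`. -/
def KVtoK (j : V →ₗ[ℂ] H0H e 1) (p : ℕ) : KV e j p 1 →ₗ[ℂ] K e p 1 :=
  Koszul.cohomologyMap j (fun _ _ => rfl) (fun _ _ => rfl) p

lemma KVtoK_subtype (W : Submodule ℂ (H0H e 1)) :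
    KVtoK (V := W) W.subtype p = KWtoK e W p 1 := rfl

/-- The inclusion of cycles. -/
def inclCyc (j : V →ₗ[ℂ] H0H e 1) (γ : CycV j p) : Cyc e p :=
  ⟨_, map_mem_cycles j (fun _ _ => rfl) γ⟩

lemma mem_range_KVtoK (j : V →ₗ[ℂ] H0H e 1) {α : K e p 1} :
    α ∈ LinearMap.range (KVtoK j p) ↔ ∃ γ : CycV j p, α = cls e p (inclCyc j γ) := by
  constructor
  · rintro ⟨κ, rfl⟩
    obtain ⟨γ, rfl⟩ := toCohomology_surjective _ _ _ κ
    exact ⟨γ, rfl⟩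
  · rintro ⟨γ, rfl⟩
    exact ⟨toCohomology _ _ p γ, rfl⟩

lemma range_KVtoK_le {V' : Type} [AddCommGroup V'] [Module ℂ V'] (g : V →ₗ[ℂ] V')
    (j : V →ₗ[ℂ] H0H e 1) (j' : V' →ₗ[ℂ] H0H e 1) (h : j' ∘ₗ g = j) :
    LinearMap.range (KVtoK j p) ≤ LinearMap.range (KVtoK j' p) := by
  subst h
  have h : KVtoK (j' ∘ₗ g) p = KVtoK j' p ∘ₗ Koszul.cohomologyMap g (fun _ _ => rfl)
    (fun _ _ => rfl) p := cohomologyMap_comp g j' (j' ∘ₗ g) rfl _ _ _ _ _ _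
  rw [h]
  exact LinearMap.range_comp_le_range _ _

/-- The cycles in `⋀ᵖ H⁰(X, H - R) ⊗ H⁰(X, H)` for multiplication by a section of `R`. -/
lemma exists_evT_eq_of_cycle (hp : ∑ i, e i = p + 1) (hp0 : p ≠ 0) {a : Fin 2 → ℂ} (ha : a ≠ 0)
    {θ : (⋀[ℂ]^p (H0HsubR e)) ⊗[ℂ] (H0H e 1)} (hθ : θ ∈ CycV (mulBy (sec a : H0R e)) p) :
    ∃ τ : Fin 2 → ℂ, ∀ t, a 0 * t - a 1 ≠ 0 → ∀ i, evT p (coeffAt (chart t) i) θ =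
      (τ 0 + τ 1 * t) • ctr (coeffAt (chart t) i) (ιMulti ℂ (p + 1) (wbf hp)) := by
  set s : H0R e := sec a with hs
  let S : Set ℂ := {t | a 0 * t - a 1 ≠ 0}
  have hS : S.Infinite := infinite_ne a ha
  have hsval : ∀ t z, s.1 (pt (chart t) z) = a 0 * t - a 1 := fun t z => by
    rw [hs, sec_apply]
    simp [pt, chart]
  have hctr : ∀ t ∈ S, ∀ z, ctr (ev (pt (chart t) z)) (evT p (ev (pt (chart t) z)) θ) = 0 := by
    intro t ht z
    have h' := ctr_evT_of_cycle (mulBy s) hp0 hθ (pt (chart t) z)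
    rw [ev_comp_mulBy, ctr_smul, hsval] at h'
    exact (smul_eq_zero.1 h').resolve_left ht
  let det := detFunctional (wbf hp)
  -- Wedging into top degree identifies `⋀^p` of the space `H⁰(X, H - R)`, of dimension `p + 1`,
  -- with its dual up to a determinant, so `θ` becomes a map `H⁰(X, H - R) → H⁰(X, H)`.
  let T : H0HsubR e → H0H e 1 := fun w =>
    evL (det ∘ₗ LinearMap.mulLeft ℂ (ι ℂ w)) θ
  have hTev : ∀ w y, (T w).1 y = det (ι ℂ w * evT p (ev y) θ) := fun w y =>
    apply_evL _ (ev y) θ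
  have hfin : Module.finrank ℂ (H0HsubR e) = p + 1 := by
    rw [Module.finrank_eq_card_basis (wbf hp), Fintype.card_fin]
  have hTsymm : ∀ t ∈ S, ∀ z w w', (T w).1 (pt (chart t) z) * w'.1 (pt (chart t) z) =
      (T w').1 (pt (chart t) z) * w.1 (pt (chart t) z) := by
    intro t ht z w w'
    set y := pt (chart t) z
    -- The degree `p + 2` exceeds the dimension. Contracting this zero by evaluation, and using that
    -- `θ` is a cycle, gives the symmetry of `T`.
    have h0 : ι ℂ w * (ι ℂ w' * evT p (ev y) θ) = 0 :=
      eq_zero_of_finrank_lt (n := p + 1 + 1) (by omega) (ι_mul_mem _ (ι_mul_mem _ (evT_mem _ _)))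
    have h1 := congrArg (fun x => det (ctr (ev y) x)) h0
    simp only [ctr_ι_mul, hctr t ht z, mul_zero, sub_zero, map_sub, map_smul, map_zero,
      mul_smul_comm, ← hTev, smul_eq_mul, ev_apply, y] at h1
    linear_combination -h1
  obtain ⟨i₀, hi₀, τ, hτ⟩ := exists_ratio hp hp0 T hS hTsymm
  have hval : ∀ t ∈ S, ∀ z w, (T w).1 (pt (chart t) z) =
      (τ 0 + τ 1 * t) * w.1 (pt (chart t) z) := by
    intro t ht z w
    rw [section_apply, section_apply, Finset.mul_sum]
    refine Finset.sum_congr rfl fun i _ => ?_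
    rw [hτ t ht]
    ring
  -- Contracting `u ∧ θ_y = (T u)(y) · top = τ(t) u(y) · top` recovers `θ_y` wherever `u` does not
  -- vanish, hence the condition on `z i₀`.
  have hpoint : ∀ t ∈ S, ∀ z : cone (Fin d → ℂ), z.1 i₀ ≠ 0 →
      evT p (ev (pt (chart t) z)) θ =
        (τ 0 + τ 1 * t) • ctr (ev (pt (chart t) z)) (ιMulti ℂ (p + 1) (wbf hp)) := by
    intro t ht z hz
    let u := wb e ⟨i₀, ⟨0, hi₀⟩⟩
    have hu : u.1 (pt (chart t) z) ≠ 0 := by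
      rw [wb_apply]
      simpa [pt, chart] using hz
    have h1 := eq_detFunctional_smul (wbf hp)
      (ι_mul_mem u (evT_mem (ev (pt (chart t) z)) θ))
    have h2 := congrArg (ctr (ev (pt (chart t) z))) h1
    change _ = ctr _ (det _ • _) at h2
    rw [ctr_ι_mul, hctr t ht z, mul_zero, sub_zero, ← hTev, hval t ht z, map_smul, mul_comm,
      mul_smul] at h2
    exact smul_right_injective _ hu h2
  refine ⟨τ, fun t ht i => ?_⟩
  have h0 := hpoint t ht (unitVec i₀) (by simp [unitVec])
  rcases eq_or_ne i₀ i with rfl | hi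
  · exact h0
  -- The coordinate vector at `i` lies outside the range of `hpoint`; the sum with the one at `i₀`
  -- does not, and by linearity the known part can be subtracted.
  · have h1 := hpoint t ht (pairVec hi) (by simp [pairVec, hi])
    rw [ev_pairVec, ev_pairVec, evT_add, ctr_add, smul_add, h0] at h1
    exact add_left_cancel h1

/-- Syzygies coming from `K_{p,1}(X, H; s H⁰(X, H - R))` lie in the image of `δₛ`. -/
lemma range_KVtoK_mulBy_le [Nonempty (Fin d)] (hp : ∑ i, e i = p + 1) (hp0 : p ≠ 0)
    {a : Fin 2 → ℂ} (ha : a ≠ 0) :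
    LinearMap.range (KVtoK (mulBy (sec a : H0R e)) p) ≤
      Submodule.span ℂ {lastSyzygy hp hp0 a} := by
  intro α hα
  set s : H0R e := sec a with hs
  obtain ⟨γ', rfl⟩ := (mem_range_KVtoK _).1 hα
  set γ : Cyc e p := inclCyc (mulBy s) γ' with hγ
  let θ : (⋀[ℂ]^p (H0HsubR e)) ⊗[ℂ] (H0H e 1) := γ'.1
  have hγθ : ∀ ξ : Module.Dual ℂ (H0H e 1), evT p ξ γ.1 =
      ExteriorAlgebra.map (mulBy s) (evT p ξ θ) := by
    intro ξ
    simp only [hγ, θ, inclCyc]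
    rw [evT_map]
    rfl
  obtain ⟨τ, hcoeff⟩ := exists_evT_eq_of_cycle hp hp0 ha γ'.2
  let S : Set ℂ := {t | a 0 * t - a 1 ≠ 0}
  have hS : S.Infinite := infinite_ne a ha
  have hsval : ∀ t z, s.1 (pt (chart t) z) = a 0 * t - a 1 := fun t z => by
    rw [hs, sec_apply]
    simp [pt, chart]
  -- Since evaluation after multiplication by `s` is `s` times evaluation, this is the same local
  -- solution as for the cycle of `δ_s` attached to `τ`. The residues then coincide, and so do the
  -- classes.
  have hsol : ∀ t ∈ S, Solves γ.1 t (((τ 0 + τ 1 * t) / (a 0 * t - a 1)) • topWedge hp a) := by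
    intro t ht
    refine ⟨Submodule.smul_mem _ _ (topWedge_mem hp a), fun i => ?_⟩
    rw [hγθ, hcoeff t ht, topWedge, ← map_apply_ιMulti, map_smul, map_smul, ctr_map, ev_comp_mulBy,
      hsval, ctr_smul, map_smul, smul_smul, div_mul_cancel₀ _ ht]
  have hres : residuePoly hp hp0 γ = residuePoly hp hp0 (deltaCycle hp a (lin τ)) :=
    residuePoly_eq hp hp0 γ _ hS fun t ht => ⟨_, hsol t ht,
      (residuePoly_eval hp hp0 _ (solves_deltaCycle hp a τ ht)).symm⟩
  have hcls : cls e p γ = cls e p (deltaCycle hp a (lin τ)) := by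
    refine syzygyCoords_injective hp hp0 ?_
    rw [syzygyCoords_cls, syzygyCoords_cls]
    ext j
    rw [innerCoeffs_apply, innerCoeffs_apply, hres]
  obtain ⟨c, hc⟩ := cls_deltaCycle hp hp0 ha (lin τ)
  rw [hcls, hc]
  exact Submodule.smul_mem _ _ (Submodule.mem_span_singleton_self _)

/-- The image of `δₛ` comes from `K_{p,1}(X, H; s H⁰(X, H - R))`. -/
lemma cls_deltaCycle_mem_range (hp : ∑ i, e i = p + 1) (hp0 : p ≠ 0) (a : Fin 2 → ℂ) (τ : H0R e) :
    cls e p (deltaCycle hp a τ) ∈ LinearMap.range (KVtoK (mulBy (sec a : H0R e)) p) := by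
  refine (mem_range_KVtoK _).2 ⟨⟨Koszul.d (mul (e := e) (a := 1) (b := -1) (a' := 0) (b' := 1)
    (a'' := 1) (b'' := 0) (add_zero 1) (neg_add_cancel 1)) p
    (exteriorPower.ιMulti ℂ (p + 1) (wbf hp) ⊗ₜ τ), ?_⟩, rfl⟩
  obtain ⟨q, rfl⟩ := Nat.exists_eq_succ_of_ne_zero hp0
  exact LinearMap.congr_fun (Koszul.d_comp_d _ (mulH (mulBy (sec a : H0R e)) 1 (1 + 1)
    (add_comm 1 1)) (fun v w n => Subtype.ext (by
      change v.1 * (sec a).1 * (w.1 * n.1) = w.1 * (sec a).1 * (v.1 * n.1)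
      ring)) q) _

lemma range_KWtoK_sectionsVanishingOn (s : H0R e) (hs : Function.Injective (mulBy s)) :
    LinearMap.range (KWtoK e (sectionsVanishingOn s) p 1) =
      LinearMap.range (KVtoK (mulBy s) p) := by
  rw [← KVtoK_subtype]
  apply le_antisymm
  · refine range_KVtoK_le (LinearEquiv.ofInjective _ hs).symm.toLinearMap _ _
      (LinearMap.ext fun v => ?_)
    obtain ⟨w, rfl⟩ := (LinearEquiv.ofInjective _ hs).surjective v
    exact congrArg (mulBy s) ((LinearEquiv.ofInjective _ hs).symm_apply_apply w)
  · exact range_KVtoK_le (mulBy s).rangeRestrict _ _ rfl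

/-- A space of dimension less than `p + 1` carries no cycles. -/
lemma cycle_eq_zero_of_finrank_lt [FiniteDimensional ℂ V] (hp0 : p ≠ 0) (j : V →ₗ[ℂ] H0H e 1)
    (hj : Function.Injective j) (hV : Module.finrank ℂ V < p + 1) (γ : CycV j p) : γ.1 = 0 := by
  by_cases hbot : ∃ u : V, u ≠ 0
  · obtain ⟨u, hu⟩ := hbot
    -- The product `u ∧ γ_y` has degree `p + 1`, above the dimension of `V`; its contraction by
    -- evaluation is `u(y) γ_y`, because `γ` is a cycle. So `γ` vanishes wherever `u` does not.
    have key : ∀ y, (j u).1 y • evT p (ev y) γ.1 = 0 := by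
      intro y
      have h0 : ι ℂ u * evT p (ev y) γ.1 = 0 :=
        eq_zero_of_finrank_lt hV (ι_mul_mem u (evT_mem _ _))
      have h1 := congrArg (ctr (ev y ∘ₗ j)) h0
      rw [ctr_ι_mul, ctr_evT_of_cycle j hp0 γ.2, mul_zero, sub_zero, map_zero] at h1
      exact h1
    obtain ⟨t₀, i, hi⟩ : ∃ t i, coeffAt (chart t) i (j u) ≠ 0 := by
      by_contra! h
      exact hu (hj ((section_eq_zero_of_chart Set.infinite_univ fun t _ i => h t i).trans
        (map_zero j).symm))
    obtain ⟨P, -, hP⟩ := exists_coeff_polynomial (j u) i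
    have hP0 : P ≠ 0 := by
      rintro rfl
      exact hi (by rw [hP, Polynomial.eval_zero])
    let S : Set ℂ := {t | P.eval t ≠ 0}
    have hS : S.Infinite := by
      refine Set.Infinite.mono (s := (P.rootSet ℂ)ᶜ) (fun t ht h => ht ?_)
        (Set.Finite.infinite_compl (Polynomial.rootSet_finite P ℂ))
      exact (Polynomial.mem_rootSet_of_ne hP0).2 (by simpa using h)
    refine eq_zero_of_evT (fun y : S × Fin d => coeffAt (chart y.1) y.2)
      (fun F hF => section_eq_zero_of_chart hS fun t ht i => hF (⟨t, ht⟩, i)) _ ?_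
    rintro ⟨⟨t, ht⟩, k⟩
    have hui : coeffAt (chart t) i (j u) ≠ 0 := by rw [hP]; exact ht
    have h0 : evT p (coeffAt (chart t) i) γ.1 = 0 :=
      (smul_eq_zero.1 (key (pt (chart t) (unitVec i)))).resolve_left hui
    rcases eq_or_ne i k with rfl | hik
    · exact h0
    · have h1 := key (pt (chart t) (pairVec hik))
      have h2 := key (pt (chart t) (unitVec k))
      rw [eval_pairVec, ev_pairVec, evT_add, h0, zero_add, add_smul] at h1
      change coeffAt (chart t) k (j u) • evT p (coeffAt (chart t) k) γ.1 = 0 at h2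
      rw [h2, add_zero] at h1
      exact (smul_eq_zero.1 h1).resolve_left hui
  · push Not at hbot
    have hfin : Module.finrank ℂ V < p := by
      have : Subsingleton V := ⟨fun u v => by rw [hbot u, hbot v]⟩
      rw [Module.finrank_zero_of_subsingleton]
      omega
    refine eq_zero_of_evT (fun y : Set.univ × Fin d => coeffAt (chart y.1) y.2)
      (fun F hF => section_eq_zero_of_chart Set.infinite_univ
        fun t ht i => hF (⟨t, ht⟩, i)) _ fun y => ?_
    exact eq_zero_of_finrank_lt hfin (evT_mem _ _)

lemma eq_zero_of_mem_range_KVtoK [FiniteDimensional ℂ V] (hp0 : p ≠ 0) (j : V →ₗ[ℂ] H0H e 1)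
    (hj : Function.Injective j) (hV : Module.finrank ℂ V < p + 1) {α : K e p 1}
    (hα : α ∈ LinearMap.range (KVtoK j p)) : α = 0 := by
  obtain ⟨γ, rfl⟩ := (mem_range_KVtoK j).1 hα
  refine (toCohomology_eq_zero _ _ p _).2 ?_
  have h : (inclCyc j γ).1 = 0 := by
    change TensorProduct.map _ _ γ.1 = 0
    rw [cycle_eq_zero_of_finrank_lt hp0 j hj hV γ, map_zero]
  rw [h]
  exact zero_mem _

lemma eq_zero_of_mem_range_KWtoK (hp0 : p ≠ 0) (W : Submodule ℂ (H0H e 1))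
    (hW : Module.finrank ℂ W < p + 1) {α : K e p 1}
    (hα : α ∈ LinearMap.range (KWtoK e W p 1)) : α = 0 := by
  have hfin : FiniteDimensional ℂ W := inferInstance
  have hinj : Function.Injective W.subtype := W.injective_subtype
  refine @eq_zero_of_mem_range_KVtoK d e p W _ _ hfin hp0 W.subtype hinj ?_ α ?_
  · exact hW
  · exact hα

end Scroll

end

/-! ### The rational normal curve and pullback of sections -/

noncomputable section

namespace ProjSpace

open Scroll

variable {A B : Type} [AddCommGroup A] [Module ℂ A] [AddCommGroup B] [Module ℂ B] {p : ℕ}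

lemma monoVec_smul (c : ℂ) (a : Fin 2 → ℂ) : monoVec p (c • a) = c ^ (p - 1) • monoVec p a := by
  ext j
  have hj : p - 1 = (j : ℕ) + (p - 1 - (j : ℕ)) := by have := j.2; omega
  simp only [monoVec, Pi.smul_apply, smul_eq_mul, mul_pow]
  conv_rhs => rw [hj, pow_add, ← hj]
  ring

lemma zpow_natCast_sub_one (hp0 : p ≠ 0) (c : ℂ) : c ^ ((p : ℤ) - 1) = c ^ (p - 1) := by
  rw [← zpow_natCast, Nat.cast_sub (Nat.one_le_iff_ne_zero.2 hp0), Nat.cast_one]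

/-- The monomials of degree `p - 1` as a map of punctured cones, in given coordinates. -/
def monoLift (κ : A ≃ₗ[ℂ] (Fin 2 → ℂ)) (σ : B ≃ₗ[ℂ] (Fin p → ℂ)) (hp0 : p ≠ 0) (v : cone A) :
    cone B :=
  ⟨σ.symm (monoVec p (κ v)), fun h => monoVec_ne_zero hp0
    ((map_ne_zero_iff κ κ.injective).2 v.2) (by simpa using h)⟩

/-- The map of projective spaces given by the monomials of degree `p - 1`. -/
def monoMap (κ : A ≃ₗ[ℂ] (Fin 2 → ℂ)) (σ : B ≃ₗ[ℂ] (Fin p → ℂ)) (hp0 : p ≠ 0) (P : ℙ ℂ A) :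
    ℙ ℂ B :=
  Projectivization.mk ℂ (monoLift κ σ hp0 ⟨P.rep, P.rep_nonzero⟩ : B)
    (monoLift κ σ hp0 ⟨P.rep, P.rep_nonzero⟩).2

variable (κ : A ≃ₗ[ℂ] (Fin 2 → ℂ)) (σ : B ≃ₗ[ℂ] (Fin p → ℂ)) (hp0 : p ≠ 0)

lemma monoLift_scale (c : ℂˣ) (v : cone A) :
    (monoLift κ σ hp0 (scale c v) : B) = (c : ℂ) ^ ((p : ℤ) - 1) • (monoLift κ σ hp0 v : B) := by
  rw [zpow_natCast_sub_one hp0]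
  change σ.symm (monoVec p (κ ((c : ℂ) • v.1))) = _ • σ.symm (monoVec p (κ v))
  rw [map_smul, monoVec_smul, map_smul]

lemma isHomogeneousLift_monoLift :
    IsHomogeneousLift (monoMap κ σ hp0) ((p : ℤ) - 1) (monoLift κ σ hp0) where
  regular l := by
    let P : A → ℂ := ∑ j : Fin p, l (σ.symm (Pi.single j 1)) •
      ((LinearMap.proj 0 ∘ₗ κ.toLinearMap : Module.Dual ℂ A) ^ (j : ℕ) *
        (LinearMap.proj 1 ∘ₗ κ.toLinearMap : Module.Dual ℂ A) ^ (p - 1 - (j : ℕ)) : A → ℂ)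
    have hP : P ∈ polyFunctions A := sum_mem fun j _ => Subalgebra.smul_mem _
      (mul_mem (pow_mem (linear_mem_polyFunctions _) _) (pow_mem (linear_mem_polyFunctions _) _)) _
    have h := regularFunctions_of_poly (cone A) hP
    convert h using 2 with v
    change l (σ.symm (monoVec p (κ v))) = P v
    conv_lhs => rw [pi_eq_sum_univ' (monoVec p (κ v)), map_sum, map_sum]
    simp only [P, Finset.sum_apply]
    refine Finset.sum_congr rfl fun j _ => ?_
    rw [map_smul, map_smul]
    exact mul_comm _ _
  homogeneous := monoLift_scale κ σ hp0
  lifts v := by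
    obtain ⟨c, hc⟩ := Projectivization.exists_smul_eq_mk_rep ℂ v.1 v.2
    -- The chosen representative of the point is `c • v`, so its image differs from that of `v` by
    -- `c ^ (p - 1)`.
    refine (Projectivization.mk_eq_mk_iff' ℂ _ _ _ _).2 ⟨((c : ℂ) ^ ((p : ℤ) - 1))⁻¹, ?_⟩
    have h : (⟨_, Projectivization.rep_nonzero _⟩ : cone A) = scale c v := Subtype.ext hc.symm
    rw [h, monoLift_scale, inv_smul_smul₀ (zpow_ne_zero _ c.ne_zero)]

lemma submodule_monoMap (v : cone A) :
    (monoMap κ σ hp0 (Projectivization.mk ℂ v.1 v.2)).submodule =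
      Submodule.span ℂ {(monoLift κ σ hp0 v : B)} := by
  rw [← (isHomogeneousLift_monoLift κ σ hp0).lifts v]
  exact Projectivization.submodule_mk _ _

/-- Sections of `𝒪(1)` are linear forms. -/
lemma exists_dual_eq (F : sections B 1) : ∃ l : Module.Dual ℂ B, ∀ v, F.1 v = l v.1 := by
  have hU : ∀ x : cone B, (0 : B) + (LinearMap.id : B →ₗ[ℂ] B) x.1 ∈ cone B :=
    fun x => by simp
  have hval : ∀ x : cone B, F.1 ⟨_, hU x⟩ = F.1 x := fun x =>
    congrArg F.1 (Subtype.ext (zero_add _))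
  obtain ⟨l, hl⟩ := linear_of_regular F.2.1 0 (LinearMap.id : B →ₗ[ℂ] B) hU fun c x => by
    rw [hval, hval, F.2.2, zpow_one]
  exact ⟨l, fun v => by rw [← hl, hval]⟩

/-- A linear form, as a section of `𝒪(1)`. -/
def dualToSections : Module.Dual ℂ B →ₗ[ℂ] sections B 1 where
  toFun l := ⟨fun v => l v.1, regularFunctions_of_poly _ (linear_mem_polyFunctions l), fun c v => by
    rw [zpow_one]
    exact map_smul l (c : ℂ) v.1⟩
  map_add' _ _ := rfl
  map_smul' _ _ := rfl

lemma dualToSections_bijective : Function.Bijective (dualToSections (B := B)) := by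
  constructor
  · intro l l' h
    ext v
    by_cases hv : v = 0
    · simp [hv]
    · exact congrFun (congrArg Subtype.val h) ⟨v, hv⟩
  · intro F
    obtain ⟨l, hl⟩ := exists_dual_eq F
    exact ⟨l, Subtype.ext (funext fun v => (hl v).symm)⟩

/-- Pullback of sections of `𝒪(1)` along a homogeneous lift. -/
def pullback {φ : ℙ ℂ A → ℙ ℂ B} {n : ℤ} {Φ : cone A → cone B} (h : IsHomogeneousLift φ n Φ) :
    sections B 1 →ₗ[ℂ] sections A n where
  toFun F := ⟨fun v => F.1 (Φ v), by
    obtain ⟨l, hl⟩ := exists_dual_eq F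
    simpa only [hl] using h.regular l, fun c v => by
    obtain ⟨l, hl⟩ := exists_dual_eq F
    simp only [hl]
    rw [h.homogeneous, map_smul, smul_eq_mul]⟩
  map_add' _ _ := rfl
  map_smul' _ _ := rfl

/-- A section of `𝒪(1)` is a linear form. If its pullback is zero then it vanishes on every line in
the image of `φ`, hence on their span. -/
lemma pullback_injective {φ : ℙ ℂ A → ℙ ℂ B} {n : ℤ} {Φ : cone A → cone B}
    (h : IsHomogeneousLift φ n Φ) (hspan : ⨆ P, (φ P).submodule = ⊤) :
    Function.Injective (pullback h) := by
  rw [injective_iff_map_eq_zero]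
  intro F hF
  obtain ⟨l, hl⟩ := exists_dual_eq F
  have hker : (⊤ : Submodule ℂ B) ≤ LinearMap.ker l := by
    rw [← hspan]
    refine iSup_le fun P => ?_
    induction P using Projectivization.ind with
    | h v hv =>
      rw [← h.lifts ⟨v, hv⟩]
      refine (Submodule.span_singleton_le_iff_mem (Φ ⟨v, hv⟩).1 _).2 (LinearMap.mem_ker.2 ?_)
      rw [← hl]
      exact congrFun (congrArg Subtype.val hF) ⟨v, hv⟩
  exact Subtype.ext (funext fun v => (hl v).trans (hker Submodule.mem_top))

/-- Sections of `𝒪(p - 1)` on a projective line are binary forms. -/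
lemma pullback_monoLift_surjective :
    Function.Surjective (pullback (isHomogeneousLift_monoLift κ σ hp0)) := by
  intro G
  -- The coordinates are swapped because `monoVec` lists increasing powers of the first coordinate,
  -- whereas binary forms are expanded in increasing powers of the second.
  have hx : ∀ x : Fin 2 → ℂ, (0 : A) + (x 0 • κ.symm ![0, 1] + x 1 • κ.symm ![1, 0]) =
      κ.symm ![x 1, x 0] := fun x => by
    rw [zero_add, ← map_smul, ← map_smul, ← map_add]
    simp
  have hU : ∀ x : cone (Fin 2 → ℂ),
      (0 : A) + (x.1 0 • κ.symm ![0, 1] + x.1 1 • κ.symm ![1, 0]) ∈ cone A := fun x h => by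
    rw [hx, LinearEquiv.map_eq_zero_iff] at h
    refine x.2 (funext fun i => ?_)
    fin_cases i
    · exact congrFun h 1
    · exact congrFun h 0
  obtain ⟨a, ha⟩ := exists_form_of_regular G.2.1 (N := p) (κ.symm ![0, 1]) (κ.symm ![1, 0]) 0 hU
    fun c x => by
      rw [← G.2.2]
      refine congrArg G.1 (Subtype.ext ?_)
      simp only [scale, Pi.smul_apply, Units.smul_def, smul_eq_mul, zero_add, smul_add, mul_smul]
  refine ⟨dualToSections (∑ k, a k • (LinearMap.proj k ∘ₗ σ.toLinearMap)),
    Subtype.ext (funext fun v => ?_)⟩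
  have hv : (![κ v.1 1, κ v.1 0] : Fin 2 → ℂ) ≠ 0 := fun h => by
    refine (map_ne_zero_iff κ κ.injective).2 v.2 (funext fun i => ?_)
    fin_cases i
    · exact congrFun h 1
    · exact congrFun h 0
  have hGv : G.1 ⟨_, hU ⟨_, hv⟩⟩ = G.1 v := congrArg G.1 (Subtype.ext (by
    refine (hx ![κ v.1 1, κ v.1 0]).trans ((LinearEquiv.symm_apply_eq κ).2 (funext fun i => ?_))
    fin_cases i <;> rfl))
  rw [← hGv, ha]
  change (∑ k, a k • (LinearMap.proj k ∘ₗ σ.toLinearMap)) (σ.symm (monoVec p (κ v))) = _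
  simp only [LinearMap.sum_apply, LinearMap.smul_apply, LinearMap.comp_apply, LinearMap.proj_apply,
    LinearEquiv.coe_coe, LinearEquiv.apply_symm_apply, smul_eq_mul, monoVec]
  refine Finset.sum_congr rfl fun k _ => ?_
  simp only [Matrix.cons_val_zero, Matrix.cons_val_one]
  ring

lemma iSup_monoMap : ⨆ P, (monoMap κ σ hp0 P).submodule = ⊤ := by
  rw [eq_top_iff]
  rintro b -
  have h := Submodule.mem_map_of_mem (f := σ.symm.toLinearMap) (vec_eq_smul_monoVec (σ b))
  rw [Submodule.map_span, LinearEquiv.coe_coe, σ.symm_apply_apply] at h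
  refine Submodule.span_le.2 ?_ h
  rintro _ ⟨_, ⟨i, rfl⟩, rfl⟩
  let a : Fin 2 → ℂ := ![((i : ℕ) : ℂ), 1]
  have ha : κ.symm a ≠ 0 := (map_ne_zero_iff _ κ.symm.injective).2 (vec_ne_zero_right _)
  refine Submodule.mem_iSup_of_mem (Projectivization.mk ℂ (κ.symm a) ha) ?_
  rw [submodule_monoMap κ σ hp0 ⟨_, ha⟩]
  convert Submodule.mem_span_singleton_self _
  exact congrArg (fun x => σ.symm (monoVec p x)) (κ.apply_symm_apply a).symm

/-- Pullback along the monomial map is an isomorphism. -/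
lemma pullback_monoMap_bijective {Φ : cone A → cone B}
    (h : IsHomogeneousLift (monoMap κ σ hp0) ((p : ℤ) - 1) Φ) :
    Function.Bijective (pullback h) := by
  have hinj : ∀ {Φ : cone A → cone B} (h : IsHomogeneousLift (monoMap κ σ hp0) ((p : ℤ) - 1) Φ),
      Function.Injective (pullback h) := fun h => pullback_injective h (iSup_monoMap κ σ hp0)
  have : FiniteDimensional ℂ B := σ.symm.finiteDimensional
  have : FiniteDimensional ℂ (sections B 1) :=
    (LinearEquiv.ofBijective _ dualToSections_bijective).finiteDimensional
  let E := LinearEquiv.ofBijective (pullback (isHomogeneousLift_monoLift κ σ hp0))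
    ⟨hinj _, pullback_monoLift_surjective κ σ hp0⟩
  have : FiniteDimensional ℂ (sections A ((p : ℤ) - 1)) := E.finiteDimensional
  -- The explicit lift shows that the two spaces have equal finite dimension; injectivity, which
  -- only uses the span of the image of `φ`, then settles every other lift.
  exact ⟨hinj h, (LinearMap.injective_iff_surjective_of_finrank_eq_finrank E.finrank_eq).1 (hinj h)⟩

end ProjSpace

/-! ### Assembling the theorem: `φ` as the monomial map in syzygy coordinates -/

namespace Scroll

open ProjSpace

variable {d : ℕ} {e : Fin d → ℕ} {p : ℕ}

/-- A point of `ℙ¹` and the section of `R` vanishing there. -/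
def secEquiv [Nonempty (Fin d)] : (Fin 2 → ℂ) ≃ₗ[ℂ] H0R e :=
  LinearEquiv.ofBijective
    { toFun := fun a => sec a
      map_add' := fun a b => by
        simp only [sec, ← map_add]
        congr 1
        ext i
        fin_cases i <;> simp [add_comm]
      map_smul' := fun c a => by
        simp only [sec, ← map_smul]
        congr 1
        ext i
        fin_cases i <;> simp }
    ⟨fun a b h => by
        have h' : (![-(a 1), a 0] : Fin 2 → ℂ) = ![-(b 1), b 0] := lin_injective h
        ext i
        fin_cases i
        · exact congrFun h' 1
        · exact neg_injective (congrFun h' 0),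
      fun s => by
        obtain ⟨t, rfl⟩ := lin_surjective s
        refine ⟨![t 1, -(t 0)], congrArg lin ?_⟩
        ext i
        fin_cases i <;> simp⟩

lemma finrank_sectionsVanishingOn (hp : ∑ i, e i = p + 1) {a : Fin 2 → ℂ} (ha : a ≠ 0) :
    Module.finrank ℂ (sectionsVanishingOn (sec a : H0R e)) = p + 1 := by
  rw [sectionsVanishingOn, LinearMap.finrank_range_of_inj (mulBy_injective ha),
    Module.finrank_eq_card_basis (wbf hp), Fintype.card_fin]

lemma range_KWtoK [Nonempty (Fin d)] (hp : ∑ i, e i = p + 1) (hp0 : p ≠ 0)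
    {a : Fin 2 → ℂ}
    (ha : a ≠ 0) : LinearMap.range (KWtoK e (sectionsVanishingOn (sec a)) p 1) =
      Submodule.span ℂ {lastSyzygy hp hp0 a} := by
  rw [range_KWtoK_sectionsVanishingOn _ (mulBy_injective ha)]
  refine le_antisymm (range_KVtoK_mulBy_le hp hp0 ha) ?_
  obtain ⟨τ, hτ⟩ := exists_syzygyCoords_eq hp hp0 ha
  have h : lastSyzygy hp hp0 a = cls e p (deltaCycle hp a τ) :=
    (LinearEquiv.symm_apply_eq (syzygyEquiv hp hp0)).2 hτ.symm
  rw [Submodule.span_singleton_le_iff_mem, h]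
  exact cls_deltaCycle_mem_range hp hp0 a τ

/-- The subspace `s H⁰(X, H - R)` attains dimension `p + 1`, and no smaller subspace supports a
nonzero class. -/
lemma rank_eq [Nonempty (Fin d)] (hp : ∑ i, e i = p + 1) (hp0 : p ≠ 0)
    {a : Fin 2 → ℂ} (ha : a ≠ 0)
    {α : K e p 1} (hα : α ∈ LinearMap.range (KWtoK e (sectionsVanishingOn (sec a)) p 1))
    (hα0 : α ≠ 0) : rank α = p + 1 := by
  have hmem : p + 1 ∈ {n | ∃ W : Submodule ℂ (H0H e 1),
      Module.finrank ℂ W = n ∧ α ∈ LinearMap.range (KWtoK e W p 1)} :=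
    ⟨_, finrank_sectionsVanishingOn hp ha, hα⟩
  refine le_antisymm (Nat.sInf_le hmem) (le_csInf ⟨_, hmem⟩ ?_)
  rintro _ ⟨W, rfl, hW⟩
  by_contra! h
  exact hα0 (eq_zero_of_mem_range_KWtoK hp0 W h hW)

theorem last_syzygies {f : ℕ} (hf : f = ∑ i, e i) (hfp : f = p + 1) (hp0 : p ≠ 0) :
    ∃ φ : ℙ ℂ (H0R e) → ℙ ℂ (K e p 1),
      (∀ (s : H0R e) (hs : s ≠ 0),
        (φ (Projectivization.mk ℂ s hs)).submodule = LinearMap.range (delta s p) ∧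
        (φ (Projectivization.mk ℂ s hs)).submodule =
          LinearMap.range (KWtoK e (sectionsVanishingOn s) p 1)) ∧
      (∃ Φ, IsHomogeneousLift φ ((f : ℤ) - 2) Φ) ∧
      (∀ Φ, IsHomogeneousLift φ ((f : ℤ) - 2) Φ →
        ∃ ψ : ProjSpace.sections (K e p 1) 1 ≃ₗ[ℂ] ProjSpace.sections (H0R e) ((f : ℤ) - 2),
          ∀ F v, (ψ F).1 v = F.1 (Φ v)) ∧
      Submodule.span ℂ {α : K e p 1 | α ≠ 0 ∧ rank α = f ∧ ∃ s : H0R e, s ≠ 0 ∧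
          α ∈ LinearMap.range (KWtoK e (sectionsVanishingOn s) p 1)} = ⊤ := by
  have hp : ∑ i, e i = p + 1 := hf.symm.trans hfp
  have hn : (f : ℤ) - 2 = (p : ℤ) - 1 := by omega
  -- For `d = 0` the sum of the `eᵢ` would be `0`, not `p + 1`.
  have : Nonempty (Fin d) := by
    by_contra h
    rw [not_nonempty_iff] at h
    simp at hp
  rw [hn]
  let κ : H0R e ≃ₗ[ℂ] (Fin 2 → ℂ) := secEquiv.symm
  let σ := syzygyEquiv hp hp0
  have hκ : ∀ s : H0R e, s ≠ 0 → ∃ a : Fin 2 → ℂ, a ≠ 0 ∧ s = sec a ∧ κ s = a := fun s hs =>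
    ⟨κ s, (map_ne_zero_iff κ κ.injective).2 hs, (secEquiv.apply_symm_apply s).symm, rfl⟩
  have hφ : ∀ (s : H0R e) (hs : s ≠ 0), (monoMap κ σ hp0 (Projectivization.mk ℂ s hs)).submodule =
      Submodule.span ℂ {lastSyzygy hp hp0 (κ s)} := fun s hs =>
    submodule_monoMap κ σ hp0 ⟨s, hs⟩
  have hrange : ∀ (s : H0R e) (hs : s ≠ 0),
      (monoMap κ σ hp0 (Projectivization.mk ℂ s hs)).submodule =
        LinearMap.range (KWtoK e (sectionsVanishingOn s) p 1) := by
    intro s hs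
    obtain ⟨a, ha, rfl, hκa⟩ := hκ s hs
    rw [hφ, hκa, range_KWtoK hp hp0 ha]
  refine ⟨monoMap κ σ hp0, fun s hs => ⟨?_, hrange s hs⟩,
    ⟨_, isHomogeneousLift_monoLift κ σ hp0⟩, fun Φ hΦ =>
      ⟨LinearEquiv.ofBijective (pullback hΦ) (pullback_monoMap_bijective κ σ hp0 hΦ),
        fun F v => rfl⟩, ?_⟩
  · obtain ⟨a, ha, rfl, hκa⟩ := hκ s hs
    rw [hφ, hκa, range_delta hp hp0 ha]
  -- The lines `φ([s])` already span, and every nonzero vector on such a line is one of the rank `f`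
  -- syzygies.
  · rw [eq_top_iff, ← iSup_monoMap κ σ hp0]
    refine iSup_le fun P => ?_
    induction P using Projectivization.ind with
    | h s hs =>
      rw [hrange s hs]
      intro α hα
      by_cases hα0 : α = 0
      · rw [hα0]
        exact zero_mem _
      · refine Submodule.subset_span ⟨hα0, ?_, s, hs, hα⟩
        obtain ⟨a, ha, rfl, -⟩ := hκ s hs
        rw [hfp]
        exact rank_eq hp hp0 ha hα hα0

end Scroll

end

theorem mainTheorem9 {d : ℕ} (e : Fin d → ℕ) (he : Antitone e) (f : ℕ) (hf : f = ∑ i, e i)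
    (hf2 : 2 ≤ f) :
    ∃ φ : ℙ ℂ (Scroll.H0R e) → ℙ ℂ (Scroll.K e (f - 1) 1),
      -- `φ([s])` is the image of `⋀^f H⁰(H - R) ⊗ H⁰(R) / ⟨s⟩`, which is also the image of
      -- `K_{f-1,1}(X, H; H⁰(H ⊗ I_{Z(s)}))`
      (∀ (s : Scroll.H0R e) (hs : s ≠ 0),
        (φ (Projectivization.mk ℂ s hs)).submodule = LinearMap.range (Scroll.delta s (f - 1)) ∧
        (φ (Projectivization.mk ℂ s hs)).submodule =
          LinearMap.range (Scroll.KWtoK e (Scroll.sectionsVanishingOn s) (f - 1) 1)) ∧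
      -- `φ` is a morphism with `φ^* 𝒪(1) ≅ 𝒪(f - 2)`
      (∃ Φ, ProjSpace.IsHomogeneousLift φ ((f : ℤ) - 2) Φ) ∧
      -- pullback of sections along `φ` is an isomorphism
      (∀ Φ, ProjSpace.IsHomogeneousLift φ ((f : ℤ) - 2) Φ →
        ∃ ψ : ProjSpace.sections (Scroll.K e (f - 1) 1) 1 ≃ₗ[ℂ]
            ProjSpace.sections (Scroll.H0R e) ((f : ℤ) - 2),
          ∀ F v, (ψ F).1 v = F.1 (Φ v)) ∧
      -- the last syzygy space is spanned by syzygies of rank `f`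
      Submodule.span ℂ {α : Scroll.K e (f - 1) 1 | α ≠ 0 ∧ Scroll.rank α = f ∧
        ∃ s : Scroll.H0R e, s ≠ 0 ∧
          α ∈ LinearMap.range (Scroll.KWtoK e (Scroll.sectionsVanishingOn s) (f - 1) 1)} = ⊤ :=
  Scroll.last_syzygies hf (by omega) (by omega)
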